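/- Let $d\ge 1$, let $v\colon\mathbb T^d=\mathbb R^d/\mathbb Z^d\to\mathbb R$ be continuous, and let $\alpha=(\alpha_1,\dots,\alpha_d)\in\mathbb R^d$ be such that $1,\alpha_1,\dots,\alpha_d$ are linearly independent over $\mathbb Q$. For $x\in\mathbb T^d$ let $H(x)$ and $A$ be the bounded operators on $\ell^2(\mathbb Z)$ given by $$(H(x)\psi)_n=\psi_{n+1}+\psi_{n-1}+v(x+n\alpha)\psi_n,\qquad (A\psi)_n=i(\psi_{n+1}-\psi_{n-1}),\qquad n\in\mathbb Z.$$ Let $N(\Delta)=\int_{\mathbb T^d}(\mathbb E_{H(x)}(\Delta)\delta_0,\delta_0)\,dx$ be the density of states measure, where $\mathbb E_{H(x)}$ denotes the spectral projections of $H(x)$. For $E\in\mathbb R$ put $S_{v,E}(x)=\begin{pmatrix}E-v(x)&-1\\1&0\end{pmatrix}$, and let $\rho(E)$ be the fibered rotation number of the cocycle $(x,w)\mapsto(x+\alpha,S_{v,E}(x)w)$, that is, the average number of turns per iteration of a nonzero real vector $w\in\mathbb R^2$, where the angle by which $S_{v,E}(x)$ turns $w$ is chosen continuously in $(E,x,w)$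 and equal to $\pi/2$ when $E=v(x)$ (so that $\rho(E)\in[0,1/2]$). Assume that the family is $L^2$-degree $0$ reducible: for $N$-almost every $E$ there is a matrix function $B(\cdot,E)\in L^2(\mathbb T^d;\mathrm{GL}(2,\mathbb C))$ with $|\det B(x,E)|=1$ and $$B(x+\alpha,E)\,S_{v,E}(x)\,B(x,E)^{-1}=\begin{pmatrix}e^{2\pi i\rho(E)}&0\\0&e^{-2\pi i\rho(E)}\end{pmatrix}\quad\text{for a.e. }x\in\mathbb T^d.$$ Then there exist a set $\mathbb T_0\subset\mathbb T^d$ of full Lebesgue measure, a sequence of real numbers $T_k\to+\infty$, and bounded operators $Q(x)$ on $\ell^2(\mathbb Z)$ for $x\in\mathbb T_0$, such that for every $x\in\mathbb T_0$ $$\frac1{T_k}\int_0^{T_k}e^{iH(x)t}Ae^{-iH(x)t}\,dt\longrightarrow Q(x)\quad\text{strongly as }k\to\infty,$$ every $Q(x)$, $x\in\mathbb T_0$, has trivial kernel, and $\|Q(x)\|$ is constant on $\mathbb T_0$. -/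

import Mathlib

open MeasureTheory Filter Topology
open scoped ENNReal CompactlySupported

noncomputable section

/-- The torus `𝕋^d = (ℝ/ℤ)^d`. -/
abbrev QPTorus (d : ℕ) : Type := UnitAddTorus (Fin d)

/-- Normalized Lebesgue (Haar probability) measure on `𝕋^d`. -/
def torusMeasure (d : ℕ) : Measure (QPTorus d) :=
  Measure.pi fun _ : Fin d => (AddCircle.haarAddCircle : Measure UnitAddCircle)

/-- The class of the vector `α ∈ ℝ^d` in the torus. -/
def torusPoint {d : ℕ} (α : Fin d → ℝ) : QPTorus d := fun i => (α i : UnitAddCircle)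

/-- The numbers `1, α₁, …, α_d` are linearly independent over `ℚ`. -/
def RationallyIndependent {d : ℕ} (α : Fin d → ℝ) : Prop :=
  LinearIndependent ℚ (Fin.cons 1 α : Fin (d + 1) → ℝ)

/-- The Hilbert space `ℓ²(ℤ)` of square summable complex sequences. -/
abbrev EllTwo : Type := lp (fun _ : ℤ => ℂ) 2

theorem memlp_shift (m : ℤ) (ψ : EllTwo) :
    Memℓp (fun n : ℤ => (ψ : ℤ → ℂ) (n + m)) 2 := by
  have h := (memℓp_gen_iff (p := 2) (by norm_num)).1 (lp.memℓp ψ)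
  exact (memℓp_gen_iff (p := 2) (by norm_num)).2 ((Equiv.addRight m).summable_iff.2 h)

/-- The shift `(shift m ψ)_n = ψ_{n+m}` on `ℓ²(ℤ)`. -/
def shift (m : ℤ) : EllTwo →L[ℂ] EllTwo :=
  LinearMap.mkContinuous
    { toFun := fun ψ => ⟨fun n => (ψ : ℤ → ℂ) (n + m), memlp_shift m ψ⟩
      map_add' := fun _ _ => rfl
      map_smul' := fun _ _ => rfl } 1 (by
    intro ψ
    rw [one_mul]
    refine lp.norm_le_of_tsum_le (p := 2) (by norm_num) (norm_nonneg _) ?_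
    rw [lp.norm_rpow_eq_tsum (p := 2) (by norm_num) ψ]
    exact le_of_eq ((Equiv.addRight m).tsum_eq fun n => ‖(ψ : ℤ → ℂ) n‖ ^ (2 : ℝ≥0∞).toReal))

@[simp] theorem shift_apply (m : ℤ) (ψ : EllTwo) (n : ℤ) :
    (shift m ψ : ℤ → ℂ) n = (ψ : ℤ → ℂ) (n + m) := rfl

theorem potential_bound {d : ℕ} (v : C(QPTorus d, ℝ)) (y : QPTorus d) (z : ℂ) :
    ‖((v y : ℝ) : ℂ) * z‖ ≤ ‖v‖ * ‖z‖ := by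
  rw [norm_mul, Complex.norm_real]
  exact mul_le_mul_of_nonneg_right (v.norm_coe_le_norm y) (norm_nonneg _)

theorem memlp_potential {d : ℕ} (α : Fin d → ℝ) (v : C(QPTorus d, ℝ)) (x : QPTorus d)
    (ψ : EllTwo) :
    Memℓp (fun n : ℤ => ((v (x + n • torusPoint α) : ℝ) : ℂ) * (ψ : ℤ → ℂ) n) 2 := by
  have h := (memℓp_gen_iff (p := 2) (by norm_num)).1 (lp.memℓp ψ)
  refine (memℓp_gen_iff (p := 2) (by norm_num)).2 ?_
  refine Summable.of_nonneg_of_le (fun n => by positivity) (fun n => ?_)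
    (h.mul_left (‖v‖ ^ (2 : ℝ≥0∞).toReal))
  rw [← Real.mul_rpow (norm_nonneg _) (norm_nonneg _)]
  exact Real.rpow_le_rpow (norm_nonneg _) (potential_bound v _ _) (by norm_num)

/-- Multiplication by the quasiperiodic potential: `(Vψ)_n = v(x + nα) ψ_n`. -/
def potential {d : ℕ} (α : Fin d → ℝ) (v : C(QPTorus d, ℝ)) (x : QPTorus d) :
    EllTwo →L[ℂ] EllTwo :=
  LinearMap.mkContinuous
    { toFun := fun ψ =>
        ⟨fun n => ((v (x + n • torusPoint α) : ℝ) : ℂ) * (ψ : ℤ → ℂ) n, memlp_potential α v x ψ⟩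
      map_add' := fun ψ φ => by
        ext n
        exact mul_add _ _ _
      map_smul' := fun c ψ => by
        ext n
        exact mul_left_comm _ _ _ } ‖v‖ (by
    intro ψ
    refine lp.norm_le_of_forall_sum_le (p := 2) (by norm_num) (by positivity) fun s => ?_
    rw [Real.mul_rpow (norm_nonneg _) (norm_nonneg _)]
    refine le_trans ?_ (mul_le_mul_of_nonneg_left
      (lp.sum_rpow_le_norm_rpow (p := 2) (by norm_num) ψ s) (by positivity))
    rw [Finset.mul_sum]
    refine Finset.sum_le_sum fun n _ => ?_
    rw [← Real.mul_rpow (norm_nonneg _) (norm_nonneg _)]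
    exact Real.rpow_le_rpow (norm_nonneg _) (potential_bound v _ _) (by norm_num))

@[simp] theorem potential_apply {d : ℕ} (α : Fin d → ℝ) (v : C(QPTorus d, ℝ)) (x : QPTorus d)
    (ψ : EllTwo) (n : ℤ) :
    (potential α v x ψ : ℤ → ℂ) n = ((v (x + n • torusPoint α) : ℝ) : ℂ) * (ψ : ℤ → ℂ) n := rfl

/-- The quasiperiodic Schrödinger operator
`(H(x)ψ)_n = ψ_{n+1} + ψ_{n-1} + v(x + nα) ψ_n` on `ℓ²(ℤ)`. -/
def schrodinger {d : ℕ} (α : Fin d → ℝ) (v : C(QPTorus d, ℝ)) (x : QPTorus d) :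
    EllTwo →L[ℂ] EllTwo :=
  shift 1 + shift (-1) + potential α v x

theorem schrodinger_apply {d : ℕ} (α : Fin d → ℝ) (v : C(QPTorus d, ℝ)) (x : QPTorus d)
    (ψ : EllTwo) (n : ℤ) :
    (schrodinger α v x ψ : ℤ → ℂ) n = (ψ : ℤ → ℂ) (n + 1) + (ψ : ℤ → ℂ) (n - 1) +
      ((v (x + n • torusPoint α) : ℝ) : ℂ) * (ψ : ℤ → ℂ) n := rfl

theorem inner_shift (m : ℤ) (ψ φ : EllTwo) :
    inner ℂ (shift m ψ) φ = inner ℂ ψ (shift (-m) φ) := by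
  rw [lp.inner_eq_tsum, lp.inner_eq_tsum]
  rw [← (Equiv.addRight m).tsum_eq fun n => inner ℂ ((ψ : ℤ → ℂ) n) ((shift (-m) φ : ℤ → ℂ) n)]
  simp

theorem inner_potential {d : ℕ} (α : Fin d → ℝ) (v : C(QPTorus d, ℝ)) (x : QPTorus d)
    (ψ φ : EllTwo) : inner ℂ (potential α v x ψ) φ = inner ℂ ψ (potential α v x φ) := by
  rw [lp.inner_eq_tsum, lp.inner_eq_tsum]
  refine tsum_congr fun n => ?_
  simp [mul_left_comm, mul_comm]

theorem schrodinger_isSelfAdjoint {d : ℕ} (α : Fin d → ℝ) (v : C(QPTorus d, ℝ))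
    (x : QPTorus d) : IsSelfAdjoint (schrodinger α v x) := by
  rw [ContinuousLinearMap.isSelfAdjoint_iff_isSymmetric]
  intro ψ φ
  have h1 := inner_shift 1 ψ φ
  have h2 := inner_shift (-1) ψ φ
  have h3 := inner_potential α v x ψ φ
  rw [neg_neg] at h2
  change inner ℂ (shift 1 ψ + shift (-1) ψ + potential α v x ψ) φ =
    inner ℂ ψ (shift 1 φ + shift (-1) φ + potential α v x φ)
  simp only [inner_add_left, inner_add_right, h1, h2, h3]
  ring

/-- The current operator `(Aψ)_n = i (ψ_{n+1} - ψ_{n-1})`. -/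
def currentOp : EllTwo →L[ℂ] EllTwo := Complex.I • (shift 1 - shift (-1))

/-- The Cesàro average `(1/T) ∫₀ᵀ e^{iHt} A e^{-iHt} dt`; the integrand is norm continuous in `t`,
so this is a Bochner integral in the Banach space of bounded operators. -/
def cesaroAverage (H A : EllTwo →L[ℂ] EllTwo) (T : ℝ) : EllTwo →L[ℂ] EllTwo :=
  T⁻¹ • ∫ t in (0 : ℝ)..T,
    NormedSpace.exp ((Complex.I * (t : ℂ)) • H) * A * NormedSpace.exp (-((Complex.I * (t : ℂ)) • H))

/-- The positive functional `f ↦ ⟨ψ, f(H) ψ⟩` on compactly supported continuous functions, with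
`f(H)` given by the continuous functional calculus of the self-adjoint operator `H`. -/
def spectralFunctional {E : Type*} [NormedAddCommGroup E] [InnerProductSpace ℂ E]
    [CompleteSpace E] (H : E →L[ℂ] E) (ψ : E) : C_c(ℝ, ℝ) →ₚ[ℝ] ℝ :=
  PositiveLinearMap.mk₀
    { toFun := fun f => (inner ℂ ψ (cfc (f : ℝ → ℝ) H ψ)).re
      map_add' := fun f g => by
        have h : cfc (⇑(f + g)) H = cfc (⇑f) H + cfc (⇑g) H :=
          cfc_add (R := ℝ) H f g f.continuous.continuousOn g.continuous.continuousOn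
        rw [h, _root_.add_apply, inner_add_right, Complex.add_re]
      map_smul' := fun c f => by
        have h : cfc (⇑(c • f)) H = c • cfc (⇑f) H :=
          cfc_smul (R := ℝ) c f H f.continuous.continuousOn
        rw [h, _root_.smul_apply, inner_smul_right_eq_smul, Complex.smul_re,
          RingHom.id_apply] }
    (fun f hf => by
      have h : 0 ≤ cfc (f : ℝ → ℝ) H := cfc_nonneg fun x _ => hf x
      exact ((ContinuousLinearMap.nonneg_iff_isPositive _).1 h).re_inner_nonneg_right ψ)

/-- The spectral measure `Δ ↦ (𝔼_H(Δ) ψ, ψ)` of the bounded self-adjoint operator `H` at `ψ`: the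
Borel measure representing the functional `f ↦ ⟨ψ, f(H) ψ⟩`. -/
def spectralMeasure {E : Type*} [NormedAddCommGroup E] [InnerProductSpace ℂ E]
    [CompleteSpace E] (H : E →L[ℂ] E) (ψ : E) : Measure ℝ :=
  RealRMK.rieszMeasure (spectralFunctional H ψ)

/-- The basis vector `δ₀ ∈ ℓ²(ℤ)`. -/
def deltaZero : EllTwo := lp.single 2 0 1

/-- The density of states measure `N(Δ) = ∫_{𝕋^d} (𝔼_{H(x)}(Δ) δ₀, δ₀) dx`. -/
def densityOfStates {d : ℕ} (α : Fin d → ℝ) (v : C(QPTorus d, ℝ)) : Measure ℝ :=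
  (torusMeasure d).bind fun x => spectralMeasure (schrodinger α v x) deltaZero

/-- The Schrödinger transfer matrix `S_{v,E}(x)`. -/
def transferMatrix {d : ℕ} (v : C(QPTorus d, ℝ)) (E : ℝ) (x : QPTorus d) :
    Matrix (Fin 2) (Fin 2) ℝ :=
  !![E - v x, -1; 1, 0]

/-- The fibre component `S_{v,E}(x + (n-1)α) ⋯ S_{v,E}(x) w` of the `n`-th iterate of the cocycle
`(α, S_{v,E})` at `(x, w)`. -/
def cocycleOrbit {d : ℕ} (α : Fin d → ℝ) (v : C(QPTorus d, ℝ)) (E : ℝ) (x : QPTorus d)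
    (w : Fin 2 → ℝ) : ℕ → Fin 2 → ℝ
  | 0 => w
  | n + 1 => (transferMatrix v E (x + n • torusPoint α)).mulVec (cocycleOrbit α v E x w n)

/-- A vector of the plane `ℝ²` as a complex number. -/
def planeToComplex (w : Fin 2 → ℝ) : ℂ := ⟨w 0, w 1⟩

/-- The angle by which `S_{v,E}(x)` turns the vector `w ≠ 0`, as a continuous real-valued function
of `(E, x, w)`: `S_{v,E}(x)` is the shear `(w₀, w₁) ↦ (w₀, w₁ - (E - v x) w₀)` followed by the
rotation through `π/2`; the shear never turns a vector to its opposite direction, so that its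
turning angle is a principal argument in `(-π, π)`. This is the displacement `F(φ) - φ` of the lift
`F` to the universal cover of the circle of directions, in the homotopy class of the rotation
through `π/2`. -/
def angleIncrement {d : ℕ} (v : C(QPTorus d, ℝ)) (E : ℝ) (x : QPTorus d) (w : Fin 2 → ℝ) : ℝ :=
  Real.pi / 2 +
    Complex.arg (planeToComplex ((transferMatrix v E x).mulVec w) / (Complex.I * planeToComplex w))

/-- The fibered rotation number `ρ(E)` of the cocycle `(α, S_{v,E})`: the average number of turns
per step of a vector under the iterates of the cocycle, in the lift described above (so that
`ρ` decreases from `1/2` to `0` as `E` increases). The limit exists and does not depend on the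
starting point of the torus and the starting vector, which are `0` and `(1, 0)` here. -/
def fiberedRotationNumber {d : ℕ} (α : Fin d → ℝ) (v : C(QPTorus d, ℝ)) (E : ℝ) : ℝ :=
  limUnder atTop fun n : ℕ =>
    (∑ j ∈ Finset.range n,
      angleIncrement v E ((j : ℕ) • torusPoint α) (cocycleOrbit α v E 0 ![1, 0] j)) /
        (2 * Real.pi * n)

/-- The diagonal matrix `A_⋆` with entries `e^{2πiρ}` and `e^{-2πiρ}`. -/
def rotationDiag (ρ : ℝ) : Matrix (Fin 2) (Fin 2) ℂ :=
  !![Complex.exp (2 * Real.pi * Complex.I * ρ), 0; 0, Complex.exp (-(2 * Real.pi * Complex.I * ρ))]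

/-- `L²`-degree-`0` reducibility: for almost every `E` with respect to the density of states
measure there is `B ∈ L²(𝕋^d; GL(2,ℂ))` with `|det B| = 1` which conjugates the Schrödinger cocycle
to `A_⋆` almost everywhere. -/
def IsL2DegreeZeroReducible {d : ℕ} (α : Fin d → ℝ) (v : C(QPTorus d, ℝ)) : Prop :=
  ∀ᵐ E ∂(densityOfStates α v), ∃ B : QPTorus d → Matrix (Fin 2) (Fin 2) ℂ,
    (∀ i j, MemLp (fun x => B x i j) 2 (torusMeasure d)) ∧
    (∀ᵐ x ∂(torusMeasure d), ‖(B x).det‖ = 1) ∧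
    ∀ᵐ x ∂(torusMeasure d),
      B (x + torusPoint α) * (transferMatrix v E x).map Complex.ofReal * (B x)⁻¹ =
        rotationDiag (fiberedRotationNumber α v E)

end

/-!
The proof is a form of Aubry duality. The family `H(x)` on `ℓ²(ℤ)` is decomposed a second time, over
the Fourier variable `θ` dual to the lattice: the operators
`(h(θ)f)(x) = e^{2πiθ} f(x + α) + e^{-2πiθ} f(x - α) + v(x) f(x)` on `L²(𝕋^d)` (`dualOperator`), with
the current `a(θ)` (`dualCurrent`), correspond to `H(x)` and `A` under a unitary map between
`L²(𝕋^d; ℓ²(ℤ))` and `L²(𝕋; L²(𝕋^d))`.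

*The dual operators have simple pure point spectrum, with nonzero currents.* A matrix function that
conjugates the cocycle at energy `E` to a diagonal matrix gives two square integrable Floquet
solutions with multipliers `e^{±2πiρ(E)}` (`hasFloquetPair_of_conjugation`), and these are
eigenvectors of `h(±ρ(E))`. For a nonresonant phase, constancy of Wronskians along the ergodic
rotation shows that the eigenvalue is simple and that the current of the eigenvector is, up to the
factor `i`, the Wronskian of the solution and its complex conjugate, which does not vanish
(`exists_dual_eigenvector`). Oscillation theory
on boxes gives `2ρ(E) = N(E, ∞)` (`fiberedRotationNumber_eq`), and `N` has no atoms; hence the energy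
can be written as a measure preserving function `e(θ)` on the circle with `ρ(e(θ)) = ‖θ‖`
(`exists_dual_energy`), and almost every `θ` carries an eigenvector `f_θ` of `h(θ)`. Multiplying
`f_{θ + k·α}` by the character `e_k` gives, for every `k ∈ ℤ^d`, an eigenvector of the same `h(θ)`.
These vectors are orthonormal, because the function `N(·, ∞)` separates their eigenvalues, and they
are complete, because integrating Bessel's inequality over `θ` gives an equality. So the time
averages of `a(θ)` converge strongly, as `T → ∞`, to an injective operator
(`ae_exists_injective_limit_dual`).

*Transfer to `ℓ²(ℤ)`.* Duality of vector fields (`IsDualPair`) preserves `L²` norms and is respected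
by `H` and `h`, hence by exponentials, time averages, strong limits and kernel projections
(`IsIntertwined`). Convergence for almost every `θ` therefore implies `L²` convergence of the averages
applied to `δ₀`, and almost everywhere convergence along a sequence of times
(`exists_subsequence_ae_tendsto`); covariance under the shift and boundedness extend it to all of
`ℓ²(ℤ)`. The kernel projections of the dual limits vanish, so those of `Q(x)` annihilate `δ₀`
(`ae_starProjection_ker_delta_zero`), and covariance shows that the kernel is trivial. Finally
`‖Q(x)‖` is a measurable function invariant under the ergodic rotation.
-/

open MeasureTheory Filter Topology
open scoped ENNReal CompactlySupported

noncomputable section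

/-! ### The irrational rotation of the torus -/

instance torusMeasure.isProbabilityMeasure (d : ℕ) : IsProbabilityMeasure (torusMeasure d) := by
  unfold torusMeasure; infer_instance

instance torusMeasure.isAddRightInvariant (d : ℕ) : (torusMeasure d).IsAddRightInvariant := by
  unfold torusMeasure; infer_instance

theorem measurePreserving_add_torus {d : ℕ} (a : QPTorus d) :
    MeasurePreserving (fun x => x + a) (torusMeasure d) (torusMeasure d) :=
  measurePreserving_add_right _ a

/-- The characters of the torus, as a Hilbert basis of `L²(𝕋^d)`. -/
def torusBasis (d : ℕ) : HilbertBasis (Fin d → ℤ) ℂ (Lp ℂ 2 (torusMeasure d)) :=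
  UnitAddTorus.mFourierBasis

theorem coeFn_torusBasis {d : ℕ} (k : Fin d → ℤ) :
    torusBasis d k =ᵐ[torusMeasure d] UnitAddTorus.mFourier k := by
  have h : torusBasis d k = UnitAddTorus.mFourierLp 2 k :=
    congrFun UnitAddTorus.coe_mFourierBasis k
  rw [h]
  exact UnitAddTorus.coeFn_mFourierLp 2 k

/-- The point `k · α` of the circle. -/
def frequency {d : ℕ} (α : Fin d → ℝ) (k : Fin d → ℤ) : UnitAddCircle :=
  ((∑ i, (k i : ℝ) * α i : ℝ) : UnitAddCircle)

theorem mFourier_add_arg {d : ℕ} (k : Fin d → ℤ) (x y : QPTorus d) :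
    UnitAddTorus.mFourier k (x + y) = UnitAddTorus.mFourier k x * UnitAddTorus.mFourier k y := by
  simp only [UnitAddTorus.mFourier, ContinuousMap.coe_mk, ← Finset.prod_mul_distrib, Pi.add_apply]
  refine Finset.prod_congr rfl fun i _ => ?_
  simp [fourier_apply, smul_add, AddCircle.toCircle_add]

theorem mFourier_torusPoint {d : ℕ} (α : Fin d → ℝ) (k : Fin d → ℤ) :
    UnitAddTorus.mFourier k (torusPoint α) = fourier 1 (frequency α k) := by
  simp only [UnitAddTorus.mFourier, ContinuousMap.coe_mk, torusPoint, frequency, fourier_coe_apply]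
  rw [← Complex.exp_sum]
  congr 1
  push_cast
  rw [Finset.mul_sum, Finset.sum_div]
  refine Finset.sum_congr rfl fun i _ => ?_
  ring

theorem fourier_one_add (x y : UnitAddCircle) :
    (fourier 1 (x + y) : ℂ) = fourier 1 x * fourier 1 y := by
  simp [fourier_apply, AddCircle.toCircle_add]

theorem fourier_one_injective {x y : UnitAddCircle} (h : (fourier 1 x : ℂ) = fourier 1 y) :
    x = y := by
  simp only [fourier_one] at h
  exact AddCircle.injective_toCircle one_ne_zero (Subtype.coe_injective h)

theorem frequency_add {d : ℕ} (α : Fin d → ℝ) (k l : Fin d → ℤ) :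
    frequency α (k + l) = frequency α k + frequency α l := by
  simp only [frequency, ← AddCircle.coe_add, ← Finset.sum_add_distrib]
  congr 1
  refine Finset.sum_congr rfl fun i _ => ?_
  simp only [Pi.add_apply]; push_cast; ring

theorem frequency_neg {d : ℕ} (α : Fin d → ℝ) (k : Fin d → ℤ) :
    frequency α (-k) = - frequency α k := by
  simp only [frequency, ← AddCircle.coe_neg, ← Finset.sum_neg_distrib]
  congr 1
  refine Finset.sum_congr rfl fun i _ => ?_
  simp

theorem frequency_sub {d : ℕ} (α : Fin d → ℝ) (k l : Fin d → ℤ) :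
    frequency α (k - l) = frequency α k - frequency α l := by
  rw [sub_eq_add_neg, frequency_add, frequency_neg, sub_eq_add_neg]

theorem RationallyIndependent.frequency_eq_zero {d : ℕ} {α : Fin d → ℝ}
    (hα : RationallyIndependent α) {k : Fin d → ℤ} (h : frequency α k = 0) : k = 0 := by
  rw [frequency, AddCircle.coe_eq_zero_iff] at h
  obtain ⟨n, hn⟩ := h
  have h2 := Fintype.linearIndependent_iff.1 hα
    (Fin.cons (-(n : ℚ)) fun i => (k i : ℚ)) (by
      rw [Fin.sum_univ_succ]
      simp only [Fin.cons_zero, Fin.cons_succ, Rat.smul_def]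
      push_cast
      rw [← hn]
      simp)
  funext i
  have := h2 i.succ
  simpa using this

/-- A translation multiplies the Fourier coefficients by character values. -/
theorem repr_translate {d : ℕ} (α : Fin d → ℝ) (k : Fin d → ℤ) (f g : Lp ℂ 2 (torusMeasure d))
    (c : ℂ) (h : ∀ᵐ x ∂(torusMeasure d), f (x + torusPoint α) = c * g x) :
    fourier 1 (frequency α k) * inner ℂ (torusBasis d k) f = c * inner ℂ (torusBasis d k) g := by
  have h1 : inner ℂ (torusBasis d k) f =
      ∫ x, (starRingEnd ℂ) (UnitAddTorus.mFourier k x) * f x ∂(torusMeasure d) := by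
    rw [L2.inner_def]
    refine integral_congr_ae ?_
    filter_upwards [coeFn_torusBasis k] with x hx
    rw [hx, RCLike.inner_apply, mul_comm]
  have h2 : inner ℂ (torusBasis d k) g =
      ∫ x, (starRingEnd ℂ) (UnitAddTorus.mFourier k x) * g x ∂(torusMeasure d) := by
    rw [L2.inner_def]
    refine integral_congr_ae ?_
    filter_upwards [coeFn_torusBasis k] with x hx
    rw [hx, RCLike.inner_apply, mul_comm]
  rw [h1, h2, ← integral_add_right_eq_self _ (torusPoint α), ← integral_const_mul,
    ← integral_const_mul]
  refine integral_congr_ae ?_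
  filter_upwards [h] with x hx
  rw [hx, mFourier_add_arg, map_mul, mFourier_torusPoint]
  have h3 : (fourier 1 (frequency α k) : ℂ) * (starRingEnd ℂ) (fourier 1 (frequency α k)) = 1 := by
    rw [Complex.mul_conj, Complex.normSq_eq_norm_sq, fourier_apply, Circle.norm_coe]; simp
  linear_combination (c * g x * (starRingEnd ℂ) (UnitAddTorus.mFourier k x)) * h3

theorem repr_eq_zero_of_translate {d : ℕ} (α : Fin d → ℝ) (k : Fin d → ℤ)
    (f : Lp ℂ 2 (torusMeasure d))
    (c : ℂ) (h : ∀ᵐ x ∂(torusMeasure d), f (x + torusPoint α) = c * f x)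
    (hc : c ≠ fourier 1 (frequency α k)) : inner ℂ (torusBasis d k) f = 0 := by
  have := repr_translate α k f f c h
  rcases mul_eq_mul_right_iff.1 this with h | h
  · exact absurd h.symm hc
  · exact h

/-- An irrational rotation multiplies no nonzero `L²` function by a number which is not the value
of a character. -/
theorem eq_zero_of_translate {d : ℕ} (α : Fin d → ℝ) (f : Lp ℂ 2 (torusMeasure d))
    (c : ℂ) (h : ∀ᵐ x ∂(torusMeasure d), f (x + torusPoint α) = c * f x)
    (hc : ∀ k, c ≠ fourier 1 (frequency α k)) : f = 0 := by
  refine (torusBasis d).repr.injective ?_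
  ext k
  rw [HilbertBasis.repr_apply_apply, repr_eq_zero_of_translate α k f c h (hc k)]
  simp

/-- Invariance kills every Fourier coefficient except the one at `0`. -/
theorem ae_const_of_invariant {d : ℕ} {α : Fin d → ℝ} (hα : RationallyIndependent α)
    (f : Lp ℂ 2 (torusMeasure d))
    (h : ∀ᵐ x ∂(torusMeasure d), f (x + torusPoint α) = f x) :
    ∃ c : ℂ, ∀ᵐ x ∂(torusMeasure d), f x = c := by
  have h0 : ∀ k : Fin d → ℤ, k ≠ 0 → inner ℂ (torusBasis d k) f = 0 := fun k hk =>
    repr_eq_zero_of_translate α k f 1 (by simpa using h) fun h1 => hk <| by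
      refine hα.frequency_eq_zero (fourier_one_injective ?_)
      rw [← h1]; simp
  have hs := (torusBasis d).hasSum_repr f
  have h1 : f = (torusBasis d).repr f 0 • torusBasis d 0 := by
    refine hs.unique ?_
    refine hasSum_single 0 fun k hk => ?_
    rw [HilbertBasis.repr_apply_apply, h0 k hk, zero_smul]
  refine ⟨(torusBasis d).repr f 0, ?_⟩
  have h2 := Lp.coeFn_smul ((torusBasis d).repr f 0) (torusBasis d 0)
  rw [← h1] at h2
  filter_upwards [h2, coeFn_torusBasis (0 : Fin d → ℤ)] with x hx hx2
  rw [hx, Pi.smul_apply, hx2, UnitAddTorus.mFourier_zero]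
  simp

theorem ergodic_add_torusPoint {d : ℕ} {α : Fin d → ℝ} (hα : RationallyIndependent α) :
    Ergodic (fun x : QPTorus d => x + torusPoint α) (torusMeasure d) := by
  refine ⟨measurePreserving_add_torus _, ⟨fun s hs hinv => ?_⟩⟩
  let f : Lp ℂ 2 (torusMeasure d) := indicatorConstLp 2 hs (measure_ne_top _ s) (1 : ℂ)
  have hf : f =ᵐ[torusMeasure d] s.indicator fun _ => (1 : ℂ) := indicatorConstLp_coeFn
  have hf' := (measurePreserving_add_torus (torusPoint α)).quasiMeasurePreserving.ae hf
  obtain ⟨c, hc⟩ := ae_const_of_invariant hα f (by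
    filter_upwards [hf, hf'] with x hx hx'
    rw [hx, hx']
    have : x + torusPoint α ∈ s ↔ x ∈ s := by
      conv_rhs => rw [← hinv]
      rfl
    by_cases hxs : x ∈ s <;> simp [hxs, this])
  rw [Filter.eventuallyConst_set']
  by_cases h1 : c = 1
  · right
    filter_upwards [hf, hc] with x hx hx'
    rw [hx, h1] at hx'
    by_contra hne
    have : x ∉ s := fun h => hne (eq_iff_iff.2 (iff_of_true h trivial))
    simp [this] at hx'
  · left
    filter_upwards [hf, hc] with x hx hx'
    rw [hx] at hx'
    by_contra hne
    have : x ∈ s := by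
      by_contra h
      exact hne (eq_iff_iff.2 (iff_of_false h id))
    simp [this] at hx'
    exact h1 hx'.symm

theorem integral_mFourier {d : ℕ} (k : Fin d → ℤ) (hk : k ≠ 0) :
    ∫ x, UnitAddTorus.mFourier k x ∂(torusMeasure d) = 0 := by
  have h : inner ℂ (torusBasis d 0) (torusBasis d k) = 0 :=
    (torusBasis d).orthonormal.2 hk.symm
  rw [L2.inner_def] at h
  rw [← h]
  refine integral_congr_ae ?_
  filter_upwards [coeFn_torusBasis k, coeFn_torusBasis (0 : Fin d → ℤ)] with x hx hx2
  rw [hx, hx2, UnitAddTorus.mFourier_zero]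
  simp

theorem mFourier_nsmul {d : ℕ} (α : Fin d → ℝ) (k : Fin d → ℤ) (n : ℕ) :
    UnitAddTorus.mFourier k (n • torusPoint α) = (fourier 1 (frequency α k) : ℂ) ^ n := by
  induction n with
  | zero => simp [UnitAddTorus.mFourier]
  | succ n ih => rw [succ_nsmul, mFourier_add_arg, ih, mFourier_torusPoint, pow_succ]

/-- Weyl's theorem: the orbit of `0` under an irrational rotation is equidistributed. -/
theorem tendsto_average_orbit {d : ℕ} {α : Fin d → ℝ} (hα : RationallyIndependent α)
    (g : C(QPTorus d, ℂ)) :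
    Tendsto (fun n : ℕ => (n : ℂ)⁻¹ * ∑ j ∈ Finset.range n, g (j • torusPoint α)) atTop
      (𝓝 (∫ x, g x ∂(torusMeasure d))) := by
  have hbd : ∀ (f : C(QPTorus d, ℂ)) (n : ℕ),
      ‖(n : ℂ)⁻¹ * ∑ j ∈ Finset.range n, f (j • torusPoint α)‖ ≤ ‖f‖ := by
    intro f n
    rcases Nat.eq_zero_or_pos n with rfl | hn
    · simp
    have hn' : (0 : ℝ) < n := by exact_mod_cast hn
    rw [norm_mul, norm_inv, Complex.norm_natCast, inv_mul_le_iff₀ hn']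
    refine (norm_sum_le _ _).trans ((Finset.sum_le_sum fun j _ => f.norm_coe_le_norm _).trans ?_)
    simp
  have hint : ∀ f : C(QPTorus d, ℂ), Integrable f (torusMeasure d) := fun f =>
    f.continuous.integrable_of_hasCompactSupport (HasCompactSupport.of_compactSpace _)
  have hbd2 : ∀ f : C(QPTorus d, ℂ), ‖∫ x, f x ∂(torusMeasure d)‖ ≤ ‖f‖ := fun f => by
    have := norm_integral_le_of_norm_le_const (μ := torusMeasure d)
      (Eventually.of_forall fun x => f.norm_coe_le_norm x)
    simpa using this
  have hg : g ∈ (Submodule.span ℂ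
      (Set.range <| UnitAddTorus.mFourier (d := Fin d))).topologicalClosure := by
    rw [UnitAddTorus.span_mFourier_closure_eq_top]; trivial
  let S : Submodule ℂ C(QPTorus d, ℂ) :=
    { carrier := {f | Tendsto (fun n : ℕ => (n : ℂ)⁻¹ * ∑ j ∈ Finset.range n,
        f (j • torusPoint α)) atTop (𝓝 (∫ x, f x ∂(torusMeasure d)))}
      zero_mem' := by simp
      add_mem' := by
        intro a b ha hb
        have := Tendsto.add ha hb
        simp only [Set.mem_ofPred_eq, ContinuousMap.add_apply, Finset.sum_add_distrib, mul_add]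
        rwa [integral_add (hint a) (hint b)]
      smul_mem' := by
        intro c f hf
        have := Tendsto.const_mul c hf
        simp only [Set.mem_ofPred_eq, ContinuousMap.smul_apply, smul_eq_mul, ← Finset.mul_sum]
        rw [integral_const_mul]
        refine this.congr fun n => by ring }
  have hspan : Submodule.span ℂ (Set.range <| UnitAddTorus.mFourier (d := Fin d)) ≤ S := by
    rw [Submodule.span_le]
    rintro _ ⟨k, rfl⟩
    change Tendsto _ _ _
    simp only [mFourier_nsmul]
    by_cases hk : k = 0
    · subst hk
      have h1 : (fourier 1 (frequency α 0) : ℂ) = 1 := by simp [frequency]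
      simp only [h1, UnitAddTorus.mFourier_zero]
      refine tendsto_const_nhds.congr' ?_
      filter_upwards [eventually_gt_atTop 0] with n hn
      have : (n : ℂ) ≠ 0 := by exact_mod_cast hn.ne'
      simp [this]
    · rw [integral_mFourier k hk]
      set w : ℂ := fourier 1 (frequency α k) with hw
      have hw1 : w ≠ 1 := fun h => hk <| hα.frequency_eq_zero <| fourier_one_injective <| by
        rw [← hw, h]; simp
      have hwn : ‖w‖ = 1 := by rw [hw, fourier_apply, Circle.norm_coe]
      have hw2 : 0 < ‖w - 1‖ := norm_pos_iff.2 (sub_ne_zero.2 hw1)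
      refine squeeze_zero_norm (a := fun n : ℕ => (2 / ‖w - 1‖) * (n : ℝ)⁻¹) (fun n => ?_) ?_
      · rw [geom_sum_eq hw1, norm_mul, norm_inv, Complex.norm_natCast, norm_div, mul_comm]
        gcongr
        refine (norm_sub_le _ _).trans ?_
        rw [norm_pow, hwn]; norm_num
      · have := tendsto_inv_atTop_nhds_zero_nat (𝕜 := ℝ)
        simpa using this.const_mul (2 / ‖w - 1‖)
  rw [Metric.tendsto_atTop]
  intro ε hε
  obtain ⟨f, hf, hfg⟩ := Metric.mem_closure_iff.1 hg (ε / 3) (by positivity)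
  obtain ⟨n0, hn0⟩ := Metric.tendsto_atTop.1 (hspan hf) (ε / 3) (by positivity)
  refine ⟨n0, fun n hn => ?_⟩
  have h1 := hn0 n hn
  have h2 := hbd (g - f) n
  have h3 := hbd2 (g - f)
  simp only [ContinuousMap.sub_apply, Finset.sum_sub_distrib, mul_sub] at h2
  have h4 : ∫ x, (g - f) x ∂(torusMeasure d) =
      (∫ x, g x ∂(torusMeasure d)) - ∫ x, f x ∂(torusMeasure d) := integral_sub (hint g) (hint f)
  rw [h4] at h3
  rw [dist_eq_norm] at *
  set a := (n : ℂ)⁻¹ * ∑ j ∈ Finset.range n, g (j • torusPoint α)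
  set b := (n : ℂ)⁻¹ * ∑ j ∈ Finset.range n, f (j • torusPoint α)
  set A := ∫ x, g x ∂(torusMeasure d)
  set B := ∫ x, f x ∂(torusMeasure d)
  have : a - A = (a - b) + (b - B) - (A - B) := by ring
  rw [this]
  refine (norm_sub_le _ _).trans_lt ?_
  have := norm_add_le (a - b) (b - B)
  linarith

/-! ### Time averages of the Heisenberg evolution -/

section Abstract

theorem neg_I_smul {M : Type*} [AddCommGroup M] [Module ℂ M] (H : M) (t : ℝ) :
    -((Complex.I * (t : ℂ)) • H) = (Complex.I * ((-t : ℝ) : ℂ)) • H := by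
  rw [← neg_smul]; congr 1; push_cast; ring

variable {E : Type*} [NormedAddCommGroup E] [InnerProductSpace ℂ E] [CompleteSpace E]

/-- The Cesàro means of the powers of the contraction `1 - (T / R)²`, where `‖T‖ ≤ R`. They are
polynomials in `T` and approximate the projection onto the kernel of `T`, so that kernel projections
inherit measurability and commutation properties from `T`. -/
def kernelMean (T : E →L[ℂ] E) (R : ℝ) (n : ℕ) : E →L[ℂ] E :=
  (n : ℂ)⁻¹ • ∑ k ∈ Finset.range n, (1 - (((R⁻¹ ^ 2 : ℝ)) : ℂ) • (T * T)) ^ k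

theorem IsSelfAdjoint.inner_apply {T : E →L[ℂ] E} (hT : IsSelfAdjoint T) (u v : E) :
    inner ℂ (T u) v = inner ℂ u (T v) :=
  (ContinuousLinearMap.isSelfAdjoint_iff_isSymmetric.1 hT) u v

theorem norm_one_sub_sq_le {T : E →L[ℂ] E} (hT : IsSelfAdjoint T) {R : ℝ} (hR : 0 < R)
    (hTR : ‖T‖ ≤ R) : ‖1 - (((R⁻¹ ^ 2 : ℝ)) : ℂ) • (T * T)‖ ≤ 1 := by
  refine ContinuousLinearMap.opNorm_le_bound _ zero_le_one fun u => ?_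
  rw [one_mul]
  have h1 : (1 - (((R⁻¹ ^ 2 : ℝ)) : ℂ) • (T * T)) u = u - (((R⁻¹ ^ 2 : ℝ)) : ℂ) • T (T u) := rfl
  rw [h1]
  have h2 : ‖u - (((R⁻¹ ^ 2 : ℝ)) : ℂ) • T (T u)‖ ^ 2 ≤ ‖u‖ ^ 2 := by
    rw [@norm_sub_sq ℂ, inner_smul_right, ← hT.inner_apply, inner_self_eq_norm_sq_to_K, norm_smul]
    have h3 : ‖T (T u)‖ ≤ R * ‖T u‖ := T.le_of_opNorm_le hTR _
    have h4 : (RCLike.re ((((R⁻¹ ^ 2 : ℝ)) : ℂ) * ((‖T u‖ : ℂ)) ^ 2) : ℝ)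
        = R⁻¹ ^ 2 * ‖T u‖ ^ 2 := by
      have : ((((R⁻¹ ^ 2 : ℝ)) : ℂ) * ((‖T u‖ : ℂ)) ^ 2) = ((R⁻¹ ^ 2 * ‖T u‖ ^ 2 : ℝ) : ℂ) := by
        push_cast; ring
      rw [this]; exact Complex.ofReal_re _
    have h5 : ‖(((R⁻¹ ^ 2 : ℝ)) : ℂ)‖ = R⁻¹ ^ 2 := by
      rw [Complex.norm_real, Real.norm_of_nonneg (by positivity)]
    rw [h5]
    have h6 : (R⁻¹ ^ 2 * ‖T (T u)‖) ^ 2 ≤ R⁻¹ ^ 2 * ‖T u‖ ^ 2 := by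
      have h7 : R⁻¹ ^ 2 * ‖T (T u)‖ ≤ R⁻¹ * ‖T u‖ := by
        calc R⁻¹ ^ 2 * ‖T (T u)‖ ≤ R⁻¹ ^ 2 * (R * ‖T u‖) := by gcongr
          _ = R⁻¹ * ‖T u‖ := by field_simp
      calc _ ≤ (R⁻¹ * ‖T u‖) ^ 2 := by gcongr
        _ = _ := by ring
    have h8 : 0 ≤ R⁻¹ ^ 2 * ‖T u‖ ^ 2 := by positivity
    have h9 : (RCLike.re ((((R⁻¹ ^ 2 : ℝ)) : ℂ) * (((‖T u‖ : ℝ) : ℂ)) ^ 2) : ℝ)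
        = R⁻¹ ^ 2 * ‖T u‖ ^ 2 := h4
    erw [h9]
    linarith
  exact le_of_sq_le_sq h2 (norm_nonneg _)

theorem norm_kernelMean_le {T : E →L[ℂ] E} (hT : IsSelfAdjoint T) {R : ℝ} (hR : 0 < R)
    (hTR : ‖T‖ ≤ R) (n : ℕ) : ‖kernelMean T R n‖ ≤ 1 := by
  unfold kernelMean
  rcases Nat.eq_zero_or_pos n with rfl | hn
  · simp
  have hn' : (0 : ℝ) < n := by exact_mod_cast hn
  rw [norm_smul, norm_inv, Complex.norm_natCast, inv_mul_le_iff₀ hn', mul_one]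
  refine (norm_sum_le _ _).trans ?_
  have h : ∀ k ∈ Finset.range n, ‖(1 - (((R⁻¹ ^ 2 : ℝ)) : ℂ) • (T * T)) ^ k‖ ≤ 1 := by
    intro k hk
    clear hk
    induction k with
    | zero => rw [pow_zero]; exact ContinuousLinearMap.norm_id_le
    | succ k ih =>
      rw [pow_succ]
      exact (norm_mul_le _ _).trans (mul_le_one₀ ih (norm_nonneg _) (norm_one_sub_sq_le hT hR hTR))
  exact (Finset.sum_le_sum h).trans (by simp)

/-- The mean ergodic theorem applied to `1 - (T / R)²` yields the orthogonal projection onto the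
kernel of a self-adjoint operator as a limit of polynomials in it. -/
theorem tendsto_kernelMean {T : E →L[ℂ] E} (hT : IsSelfAdjoint T) {R : ℝ} (hR : 0 < R)
    (hTR : ‖T‖ ≤ R) (u : E) :
    Tendsto (fun n => kernelMean T R n u) atTop (𝓝 (T.ker.starProjection u)) := by
  have h := ContinuousLinearMap.tendsto_birkhoffAverage_orthogonalProjection
    (𝕜 := ℂ) _ (norm_one_sub_sq_le hT hR hTR) u
  have hk : ((1 - (((R⁻¹ ^ 2 : ℝ)) : ℂ) • (T * T)).eqLocus (1 : E →L[ℂ] E)) = T.ker := by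
    ext w
    simp only [LinearMap.mem_eqLocus, LinearMap.mem_ker]
    have hR' : (((R⁻¹ ^ 2 : ℝ)) : ℂ) ≠ 0 := by
      exact_mod_cast (by positivity : (R⁻¹ ^ 2 : ℝ) ≠ 0)
    have h1 : (1 - (((R⁻¹ ^ 2 : ℝ)) : ℂ) • (T * T)) w = w - (((R⁻¹ ^ 2 : ℝ)) : ℂ) • T (T w) := rfl
    constructor
    · intro hw
      change (1 - (((R⁻¹ ^ 2 : ℝ)) : ℂ) • (T * T)) w = w at hw
      rw [h1, sub_eq_self, smul_eq_zero_iff_right hR'] at hw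
      have : inner ℂ (T w) (T w) = 0 := by rw [hT.inner_apply, hw, inner_zero_right]
      exact inner_self_eq_zero.1 this
    · intro hw
      change T w = 0 at hw
      change (1 - (((R⁻¹ ^ 2 : ℝ)) : ℂ) • (T * T)) w = w
      rw [h1, hw, map_zero, smul_zero, sub_zero]
  have h2 : (((1 - (((R⁻¹ ^ 2 : ℝ)) : ℂ) • (T * T)).eqLocus (1 : E →L[ℂ] E)).orthogonalProjectionOnto
      u : E) = T.ker.starProjection u := by
    change Submodule.starProjection _ u = _
    simp only [hk]
  rw [h2] at h
  refine h.congr fun n => ?_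
  simp only [birkhoffAverage, birkhoffSum, kernelMean, id, _root_.smul_apply,
    _root_.sum_apply]
  congr 1
  refine Finset.sum_congr rfl fun k _ => ?_
  rw [FunLike.coe_pow_eq_iterate]

/-- A bounded family of operators which converges on a total set converges strongly. -/
theorem exists_strong_limit {ι : Type*} {l : Filter ι} [l.NeBot] (X : ι → E →L[ℂ] E) {C : ℝ}
    (hC0 : 0 ≤ C) (hC : ∀ᶠ i in l, ‖X i‖ ≤ C) {s : Set E}
    (hs : (Submodule.span ℂ s).topologicalClosure = ⊤)
    (h : ∀ u ∈ s, ∃ w, Tendsto (fun i => X i u) l (𝓝 w)) :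
    ∃ Q : E →L[ℂ] E, ‖Q‖ ≤ C ∧ ∀ u, Tendsto (fun i => X i u) l (𝓝 (Q u)) := by
  let S : Submodule ℂ E :=
    { carrier := {u | ∃ w, Tendsto (fun i => X i u) l (𝓝 w)}
      zero_mem' := ⟨0, by simp⟩
      add_mem' := by
        rintro a b ⟨u, hu⟩ ⟨w, hw⟩
        exact ⟨u + w, by simpa using hu.add hw⟩
      smul_mem' := by
        rintro c a ⟨u, hu⟩
        exact ⟨c • u, by simpa using hu.const_smul c⟩ }
  have hspan : Submodule.span ℂ s ≤ S := Submodule.span_le.2 h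
  have hall : ∀ u, ∃ w, Tendsto (fun i => X i u) l (𝓝 w) := by
    intro u
    have hu : u ∈ (Submodule.span ℂ s).topologicalClosure := by rw [hs]; trivial
    refine cauchy_map_iff_exists_tendsto.1 ?_
    rw [Metric.cauchy_iff]
    refine ⟨inferInstance, fun ε hε => ?_⟩
    obtain ⟨w, hw, huw⟩ := Metric.mem_closure_iff.1 hu (ε / (4 * (C + 1))) (by positivity)
    obtain ⟨y, hy⟩ := hspan hw
    have h1 := Metric.tendsto_nhds.1 hy (ε / 4) (by positivity)
    refine ⟨_, image_mem_map (inter_mem h1 hC), ?_⟩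
    have key : ∀ i, dist (X i w) y < ε / 4 → ‖X i‖ ≤ C → dist (X i u) y < ε / 2 := by
      intro i h2 h3
      have h4 : dist (X i u) (X i w) ≤ ε / 4 := by
        rw [dist_eq_norm, ← map_sub]
        refine ((X i).le_of_opNorm_le h3 _).trans ?_
        rw [dist_eq_norm] at huw
        calc C * ‖u - w‖ ≤ (C + 1) * (ε / (4 * (C + 1))) := by gcongr; linarith
          _ = ε / 4 := by field_simp
      linarith [dist_triangle (X i u) (X i w) y]
    rintro _ ⟨i, ⟨hi1, hi2⟩, rfl⟩ _ ⟨j, ⟨hj1, hj2⟩, rfl⟩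
    have ha := key i hi1 hi2
    have hb := key j hj1 hj2
    linarith [dist_triangle_right (X i u) (X j u) y]
  choose q hq using hall
  refine ⟨LinearMap.mkContinuous
    { toFun := q
      map_add' := fun a b => tendsto_nhds_unique (hq (a + b)) (by simpa using (hq a).add (hq b))
      map_smul' := fun c a => tendsto_nhds_unique (hq (c • a))
        (by simpa using (hq a).const_smul c) } C fun u => ?_, ?_, hq⟩
  · refine le_of_tendsto (hq u).norm ?_
    filter_upwards [hC] with i hi using (X i).le_of_opNorm_le hi u
  · exact LinearMap.mkContinuous_norm_le _ hC0 _

/-- The Heisenberg evolution `e^{iHt} A e^{-iHt}`. -/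
def heisenberg (H A : E →L[ℂ] E) (t : ℝ) : E →L[ℂ] E :=
  NormedSpace.exp ((Complex.I * (t : ℂ)) • H) * A * NormedSpace.exp (-((Complex.I * (t : ℂ)) • H))

/-- The Cesàro average over `[0, T]` of the Heisenberg evolution: `cesaroAverage`, on an arbitrary
Hilbert space. -/
def timeAverage (H A : E →L[ℂ] E) (T : ℝ) : E →L[ℂ] E :=
  T⁻¹ • ∫ t in (0 : ℝ)..T, heisenberg H A t

theorem exp_mem_unitary {H : E →L[ℂ] E} (hH : IsSelfAdjoint H) (t : ℝ) :
    NormedSpace.exp ((Complex.I * (t : ℂ)) • H) ∈ unitary (E →L[ℂ] E) := by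
  have h1 : IsSelfAdjoint ((t : ℂ) • H) := by
    rw [IsSelfAdjoint, star_smul, hH.star_eq]; simp
  have := (selfAdjoint.expUnitary ⟨(t : ℂ) • H, h1⟩).2
  rwa [selfAdjoint.expUnitary_coe, smul_smul] at this

theorem norm_exp_le {H : E →L[ℂ] E} (hH : IsSelfAdjoint H) (t : ℝ) :
    ‖NormedSpace.exp ((Complex.I * (t : ℂ)) • H)‖ ≤ 1 := by
  rcases subsingleton_or_nontrivial (E →L[ℂ] E) with h | h
  · rw [Subsingleton.elim (NormedSpace.exp ((Complex.I * (t : ℂ)) • H)) 0, norm_zero]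
    exact zero_le_one
  · exact (CStarRing.norm_of_mem_unitary (exp_mem_unitary hH t)).le

theorem norm_heisenberg_le {H : E →L[ℂ] E} (hH : IsSelfAdjoint H) (A : E →L[ℂ] E) (t : ℝ) :
    ‖heisenberg H A t‖ ≤ ‖A‖ := by
  unfold heisenberg
  rw [neg_I_smul]
  refine (norm_mul_le _ _).trans ?_
  calc _ ≤ (1 * ‖A‖) * 1 := by
        gcongr
        · exact (norm_mul_le _ _).trans (by gcongr; exact norm_exp_le hH t)
        · exact norm_exp_le hH _
    _ = ‖A‖ := by ring

theorem continuous_exp_smul (H : E →L[ℂ] E) :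
    Continuous fun t : ℝ => NormedSpace.exp ((Complex.I * (t : ℂ)) • H) := by
  let +nondep : NormedAlgebra ℚ (E →L[ℂ] E) := NormedAlgebra.restrictScalars ℚ ℂ _
  refine NormedSpace.exp_continuous.comp ?_
  fun_prop

theorem continuous_heisenberg (H A : E →L[ℂ] E) : Continuous (heisenberg H A) := by
  unfold heisenberg
  simp only [neg_I_smul]
  refine ((continuous_exp_smul H).mul continuous_const).mul ?_
  exact (continuous_exp_smul H).comp continuous_neg

theorem norm_timeAverage_le {H : E →L[ℂ] E} (hH : IsSelfAdjoint H) (A : E →L[ℂ] E) {T : ℝ}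
    (hT : 0 ≤ T) : ‖timeAverage H A T‖ ≤ ‖A‖ := by
  unfold timeAverage
  have h := intervalIntegral.norm_integral_le_of_norm_le_const (a := 0) (b := T) (C := ‖A‖)
    fun t _ => norm_heisenberg_le hH A t
  rw [norm_smul, norm_inv, Real.norm_of_nonneg hT]
  rw [sub_zero, abs_of_nonneg hT] at h
  rcases hT.eq_or_lt with rfl | hT
  · simp
  · rw [inv_mul_le_iff₀ hT, mul_comm]; exact h

theorem isSelfAdjoint_heisenberg {H A : E →L[ℂ] E} (hH : IsSelfAdjoint H) (hA : IsSelfAdjoint A)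
    (t : ℝ) : IsSelfAdjoint (heisenberg H A t) := by
  let +nondep : NormedAlgebra ℚ (E →L[ℂ] E) := NormedAlgebra.restrictScalars ℚ ℂ _
  have hs : star ((Complex.I * (t : ℂ)) • H) = -((Complex.I * (t : ℂ)) • H) := by
    rw [star_smul, hH.star_eq, ← neg_smul]; simp
  unfold heisenberg
  rw [IsSelfAdjoint, star_mul, star_mul, hA.star_eq, NormedSpace.star_exp, NormedSpace.star_exp,
    star_neg, hs, neg_neg, mul_assoc]

theorem isSelfAdjoint_timeAverage {H A : E →L[ℂ] E} (hH : IsSelfAdjoint H) (hA : IsSelfAdjoint A)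
    (T : ℝ) : IsSelfAdjoint (timeAverage H A T) := by
  unfold timeAverage
  refine IsSelfAdjoint.smul (IsSelfAdjoint.all _) ?_
  have h := ContinuousLinearMap.intervalIntegral_comp_comm (μ := volume) (a := 0) (b := T)
    ((starL' ℝ : (E →L[ℂ] E) ≃L[ℝ] (E →L[ℂ] E)) : (E →L[ℂ] E) →L[ℝ] (E →L[ℂ] E))
    ((continuous_heisenberg H A).intervalIntegrable _ _)
  have h2 : ∀ t, ((starL' ℝ : (E →L[ℂ] E) ≃L[ℝ] (E →L[ℂ] E)) : (E →L[ℂ] E) →L[ℝ] (E →L[ℂ] E))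
      (heisenberg H A t) = heisenberg H A t := fun t => isSelfAdjoint_heisenberg hH hA t
  simp only [h2] at h
  exact h.symm

theorem exp_smul_apply_eigenvector (H : E →L[ℂ] E) {f : E} {e : ℝ} (hf : H f = (e : ℂ) • f)
    (t : ℝ) : NormedSpace.exp ((Complex.I * (t : ℂ)) • H) f =
      Complex.exp (Complex.I * t * e) • f := by
  have h1 := (NormedSpace.exp_series_hasSum_exp' (𝕂 := ℂ) ((Complex.I * (t : ℂ)) • H)).mapL
    (ContinuousLinearMap.apply ℂ E f)
  have h2 := (NormedSpace.exp_series_hasSum_exp' (𝕂 := ℂ) (Complex.I * t * e)).smul_const f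
  rw [← Complex.exp_eq_exp_ℂ] at h2
  refine h1.unique (h2.congr_fun fun n => ?_)
  have h3 : (((Complex.I * (t : ℂ)) • H) ^ n) f = (Complex.I * t * e) ^ n • f := by
    induction n with
    | zero => simp
    | succ n ih =>
      rw [pow_succ, mul_apply_eq_comp]
      simp only [_root_.smul_apply, hf, map_smul, ih, smul_smul]
      congr 1; ring
  simp [h3, smul_smul]

/-- The time average of the evolution `e^{it(H-e)}`. -/
def phaseAverage (H : E →L[ℂ] E) (e : ℝ) (T : ℝ) : E →L[ℂ] E :=
  T⁻¹ • ∫ t in (0 : ℝ)..T, Complex.exp (-(Complex.I * t * e)) •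
    NormedSpace.exp ((Complex.I * (t : ℂ)) • H)

theorem continuous_phase (H : E →L[ℂ] E) (e : ℝ) :
    Continuous fun t : ℝ => Complex.exp (-(Complex.I * t * e)) •
      NormedSpace.exp ((Complex.I * (t : ℂ)) • H) := by
  have h : Continuous fun t : ℝ => Complex.exp (-(Complex.I * t * e)) := by fun_prop
  exact h.smul (continuous_exp_smul H)

theorem phaseAverage_apply (H : E →L[ℂ] E) (e : ℝ) (T : ℝ) (u : E) :
    phaseAverage H e T u = T⁻¹ • ∫ t in (0 : ℝ)..T, Complex.exp (-(Complex.I * t * e)) •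
      NormedSpace.exp ((Complex.I * (t : ℂ)) • H) u := by
  unfold phaseAverage
  rw [_root_.smul_apply, ContinuousLinearMap.intervalIntegral_apply
    ((continuous_phase H e).intervalIntegrable _ _)]
  rfl

/-- On an eigenvector `f` the right factor of the Heisenberg evolution is a scalar, so that the average
of `A` at `f` is the phase average at the vector `A f`. -/
theorem timeAverage_apply_eigenvector (H A : E →L[ℂ] E) {f : E} {e : ℝ} (hf : H f = (e : ℂ) • f)
    (T : ℝ) : timeAverage H A T f = phaseAverage H e T (A f) := by
  rw [phaseAverage_apply]
  unfold timeAverage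
  rw [_root_.smul_apply, ContinuousLinearMap.intervalIntegral_apply
    ((continuous_heisenberg H A).intervalIntegrable _ _)]
  congr 1
  refine intervalIntegral.integral_congr fun t _ => ?_
  simp only [heisenberg, neg_I_smul, mul_apply_eq_comp]
  rw [exp_smul_apply_eigenvector H hf, map_smul, map_smul]
  congr 2
  push_cast; ring

theorem phaseAverage_eigenvector (H : E →L[ℂ] E) {f : E} {e e' : ℝ} (hf : H f = (e' : ℂ) • f)
    (T : ℝ) : phaseAverage H e T f =
      (T⁻¹ • ∫ t in (0 : ℝ)..T, Complex.exp ((Complex.I * (e' - e : ℝ)) * t)) • f := by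
  rw [phaseAverage_apply, smul_assoc, ← intervalIntegral.integral_smul_const]
  congr 1
  refine intervalIntegral.integral_congr fun t _ => ?_
  rw [exp_smul_apply_eigenvector H hf, smul_smul, ← Complex.exp_add]
  congr 2
  push_cast; ring

theorem tendsto_phase_mean {c : ℝ} (hc : c ≠ 0) :
    Tendsto (fun T : ℝ => T⁻¹ • ∫ t in (0 : ℝ)..T, Complex.exp ((Complex.I * c) * t)) atTop
      (𝓝 0) := by
  have hc' : (Complex.I * c) ≠ 0 := mul_ne_zero Complex.I_ne_zero (by exact_mod_cast hc)
  have hT := tendsto_inv_atTop_zero.mul_const (2 / |c|)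
  rw [zero_mul] at hT
  refine squeeze_zero_norm' ?_ hT
  filter_upwards [eventually_gt_atTop 0] with T hT0
  rw [integral_exp_mul_complex hc', norm_smul, norm_inv, Real.norm_of_nonneg hT0.le, norm_div]
  have h1 : ‖Complex.I * (c : ℂ)‖ = |c| := by simp
  rw [h1]
  gcongr
  refine (norm_sub_le _ _).trans ?_
  have h2 : ∀ s : ℝ, ‖Complex.exp (Complex.I * c * s)‖ = 1 := fun s => by
    have := Complex.norm_exp_ofReal_mul_I (c * s)
    rw [← this]; congr 2; push_cast; ring
  rw [h2, h2]; norm_num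

theorem norm_phaseAverage_le {H : E →L[ℂ] E} (hH : IsSelfAdjoint H) (e : ℝ) {T : ℝ}
    (hT : 0 < T) : ‖phaseAverage H e T‖ ≤ 1 := by
  unfold phaseAverage
  have h := intervalIntegral.norm_integral_le_of_norm_le_const (a := 0) (b := T) (C := 1)
    (f := fun t : ℝ => Complex.exp (-(Complex.I * t * e)) •
      NormedSpace.exp ((Complex.I * (t : ℂ)) • H)) fun t _ => by
    rw [norm_smul]
    have h2 : ‖Complex.exp (-(Complex.I * t * e))‖ = 1 := by
      have := Complex.norm_exp_ofReal_mul_I (-(t * e))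
      rw [← this]; congr 2; push_cast; ring
    rw [h2, one_mul]
    exact norm_exp_le hH t
  rw [norm_smul, norm_inv, Real.norm_of_nonneg hT.le, inv_mul_le_iff₀ hT, mul_comm]
  simpa [abs_of_pos hT] using h

theorem inner_eq_zero_of_eigenvalue_ne {H : E →L[ℂ] E} (hH : IsSelfAdjoint H) {f g : E}
    {e e' : ℝ} (hf : H f = (e : ℂ) • f) (hg : H g = (e' : ℂ) • g) (hne : e ≠ e') :
    inner ℂ f g = 0 := by
  have h := hH.inner_apply f g
  rw [hf, hg, inner_smul_left, inner_smul_right, Complex.conj_ofReal] at h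
  have : ((e : ℂ) - e') * inner ℂ f g = 0 := by linear_combination h
  rcases mul_eq_zero.1 this with h | h
  · exact absurd (by exact_mod_cast sub_eq_zero.1 h) hne
  · exact h

/-- If the eigenvectors are total, then the time averages of the Heisenberg evolution of `A`
converge strongly, and on a simple eigenvector `f` the limit is multiplication by
`⟨f, A f⟩ / ‖f‖²`. -/
theorem exists_limit_timeAverage {H : E →L[ℂ] E} (hH : IsSelfAdjoint H) (A : E →L[ℂ] E)
    {ι : Type*} (b : ι → E) (e : ι → ℝ) (hb : ∀ i, H (b i) = (e i : ℂ) • b i)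
    (hinj : Function.Injective e)
    (hs : (Submodule.span ℂ (Set.range b)).topologicalClosure = ⊤) :
    ∃ Q : E →L[ℂ] E, ‖Q‖ ≤ ‖A‖ ∧
      (∀ u, Tendsto (fun T => timeAverage H A T u) atTop (𝓝 (Q u))) ∧
      ∀ i, ∃ c : ℂ, Q (b i) = c • b i ∧ inner ℂ (b i) (A (b i)) = c * inner ℂ (b i) (b i) := by
  classical
  -- A closed subspace which contains the eigenvectors is everything.
  have hcl : ∀ (S : Submodule ℂ E), IsClosed (S : Set E) → (∀ i, b i ∈ S) → ∀ u, u ∈ S := by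
    intro S hS hbS u
    have h1 : Submodule.span ℂ (Set.range b) ≤ S :=
      Submodule.span_le.2 (by rintro _ ⟨i, rfl⟩; exact hbS i)
    have h2 := Submodule.topologicalClosure_minimal _ h1 hS
    exact h2 (by rw [hs]; trivial)
  have hlim : ∀ i j, Tendsto (fun T => phaseAverage H (e i) T (b j)) atTop
      (𝓝 (if i = j then b j else 0)) := by
    intro i j
    simp only [phaseAverage_eigenvector H (hb j)]
    split_ifs with hij
    · subst hij
      refine tendsto_const_nhds.congr' ?_
      filter_upwards [eventually_gt_atTop 0] with T hT
      have : (T : ℂ) ≠ 0 := by exact_mod_cast hT.ne'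
      simp [this]
    · have := (tendsto_phase_mean (c := e j - e i)
        (sub_ne_zero.2 fun h => hij (hinj h.symm))).smul_const (b j)
      simpa using this
  -- Since the eigenvalues are distinct, the phase averages converge to the projection onto the line
  -- of `b i`.
  have key : ∀ i u, ∃ c : ℂ, Tendsto (fun T => phaseAverage H (e i) T u) atTop (𝓝 (c • b i)) ∧
      inner ℂ (b i) u = c * inner ℂ (b i) (b i) := by
    intro i
    obtain ⟨P, -, hP⟩ := exists_strong_limit (l := atTop) (fun T => phaseAverage H (e i) T)
      zero_le_one
      ((eventually_gt_atTop 0).mono fun T hT => norm_phaseAverage_le hH (e i) hT) hs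
      (by rintro _ ⟨j, rfl⟩; exact ⟨_, hlim i j⟩)
    have hPb : ∀ j, P (b j) = if i = j then b j else 0 := fun j =>
      tendsto_nhds_unique (hP _) (hlim i j)
    have hP1 : ∀ u, P u ∈ Submodule.span ℂ {b i} := by
      refine fun u => hcl ((Submodule.span ℂ {b i}).comap (P : E →ₗ[ℂ] E)) ?_ ?_ u
      · exact (Submodule.closed_of_finiteDimensional (Submodule.span ℂ {b i})).preimage P.continuous
      · intro j
        rw [Submodule.mem_comap]
        change P (b j) ∈ _
        rw [hPb]
        split_ifs with h
        · subst h; exact Submodule.mem_span_singleton_self _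
        · exact zero_mem _
    have hP2 : ∀ u, inner ℂ (b i) (P u) = inner ℂ (b i) u := by
      intro u
      have := hcl (LinearMap.ker (((innerSL ℂ (b i)).comp P - innerSL ℂ (b i) : E →L[ℂ] ℂ) :
        E →ₗ[ℂ] ℂ)) (ContinuousLinearMap.isClosed_ker _) (fun j => by
          rw [LinearMap.mem_ker]
          change inner ℂ (b i) (P (b j)) - inner ℂ (b i) (b j) = 0
          rw [hPb]
          split_ifs with h
          · rw [sub_self]
          · rw [inner_zero_right, inner_eq_zero_of_eigenvalue_ne hH (hb i) (hb j)
              (fun h' => h (hinj h')), sub_zero]) u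
      rw [LinearMap.mem_ker] at this
      exact sub_eq_zero.1 this
    intro u
    obtain ⟨c, hc⟩ := Submodule.mem_span_singleton.1 (hP1 u)
    refine ⟨c, hc ▸ hP u, ?_⟩
    rw [← hP2, ← hc, inner_smul_right]
  obtain ⟨Q, hQ1, hQ2⟩ := exists_strong_limit (l := atTop) (fun T => timeAverage H A T)
    (norm_nonneg A)
    ((eventually_ge_atTop 0).mono fun T hT => norm_timeAverage_le hH A hT) hs
    (by
      rintro _ ⟨j, rfl⟩
      obtain ⟨c, hc, -⟩ := key j (A (b j))
      exact ⟨_, hc.congr fun T => (timeAverage_apply_eigenvector H A (hb j) T).symm⟩)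
  refine ⟨Q, hQ1, hQ2, fun i => ?_⟩
  obtain ⟨c, hc, hc2⟩ := key i (A (b i))
  refine ⟨c, tendsto_nhds_unique (hQ2 _) ?_, hc2⟩
  exact hc.congr fun T => (timeAverage_apply_eigenvector H A (hb i) T).symm

theorem isSelfAdjoint_of_tendsto {ι : Type*} {l : Filter ι} [l.NeBot] {X : ι → E →L[ℂ] E}
    (hX : ∀ i, IsSelfAdjoint (X i)) {Q : E →L[ℂ] E}
    (hQ : ∀ u, Tendsto (fun i => X i u) l (𝓝 (Q u))) : IsSelfAdjoint Q := by
  rw [ContinuousLinearMap.isSelfAdjoint_iff_isSymmetric]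
  intro u w
  refine tendsto_nhds_unique ((hQ u).inner (𝕜 := ℂ) tendsto_const_nhds) ?_
  refine ((tendsto_const_nhds (x := u)).inner (𝕜 := ℂ) (hQ w)).congr fun i => ?_
  exact ((hX i).inner_apply u w).symm

/-- If the eigenvectors are total, the eigenvalues are simple, and the self-adjoint operator `A` has
nonzero mean in each eigenvector, then the time averages of `A` have an injective strong limit. -/
theorem exists_injective_limit_timeAverage {H : E →L[ℂ] E} (hH : IsSelfAdjoint H) {A : E →L[ℂ] E}
    (hA : IsSelfAdjoint A)
    {ι : Type*} (b : ι → E) (e : ι → ℝ) (hb : ∀ i, H (b i) = (e i : ℂ) • b i)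
    (hinj : Function.Injective e)
    (hs : (Submodule.span ℂ (Set.range b)).topologicalClosure = ⊤)
    (hne : ∀ i, inner ℂ (b i) (A (b i)) ≠ 0) :
    ∃ Q : E →L[ℂ] E, ‖Q‖ ≤ ‖A‖ ∧
      (∀ u, Tendsto (fun T => timeAverage H A T u) atTop (𝓝 (Q u))) ∧
      ∀ u, Q u = 0 → u = 0 := by
  obtain ⟨Q, hQ1, hQ2, hQ3⟩ := exists_limit_timeAverage hH A b e hb hinj hs
  refine ⟨Q, hQ1, hQ2, fun u hu => ?_⟩
  have hQs : IsSelfAdjoint Q := isSelfAdjoint_of_tendsto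
    (fun T => isSelfAdjoint_timeAverage hH hA T) hQ2
  have h1 : ∀ i, inner ℂ u (b i) = 0 := by
    intro i
    obtain ⟨c, hc, hc2⟩ := hQ3 i
    have hc0 : c ≠ 0 := by
      rintro rfl
      exact hne i (by rw [hc2, zero_mul])
    have h2 := hQs.inner_apply u (b i)
    rw [hu, inner_zero_left, hc, inner_smul_right] at h2
    exact (mul_eq_zero.1 h2.symm).resolve_left hc0
  have h3 : Submodule.span ℂ (Set.range b) ≤ LinearMap.ker ((innerSL ℂ u : E →L[ℂ] ℂ) : E →ₗ[ℂ] ℂ) :=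
    Submodule.span_le.2 (by rintro _ ⟨i, rfl⟩; exact h1 i)
  have h4 := Submodule.topologicalClosure_minimal _ h3 (ContinuousLinearMap.isClosed_ker _)
  have h5 : u ∈ LinearMap.ker ((innerSL ℂ u : E →L[ℂ] ℂ) : E →ₗ[ℂ] ℂ) :=
    h4 (by rw [hs]; trivial)
  exact inner_self_eq_zero.1 h5

end Abstract

/-! ### Spectral measures of bounded self-adjoint operators -/

section Spectral

variable {E : Type*} [NormedAddCommGroup E] [InnerProductSpace ℂ E] [CompleteSpace E]

/-- The expectation `⟨ψ, f(H) ψ⟩` of a continuous function of `H`. -/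
def expectation (H : E →L[ℂ] E) (ψ : E) (f : ℝ → ℝ) : ℝ := (inner ℂ ψ (cfc f H ψ)).re

theorem spectrum_real_subset {H : E →L[ℂ] E} {R : ℝ} (hR : ‖H‖ ≤ R) :
    spectrum ℝ H ⊆ Set.Icc (-R) R := by
  rcases subsingleton_or_nontrivial E with h | h
  · have : Subsingleton (E →L[ℂ] E) := inferInstance
    rw [spectrum.of_subsingleton]; exact Set.empty_subset _
  · intro t ht
    have h1 := spectrum.norm_le_norm_of_mem ht
    rw [Real.norm_eq_abs] at h1
    exact abs_le.1 (h1.trans hR)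

theorem expectation_congr {H : E →L[ℂ] E} {R : ℝ} (hR : ‖H‖ ≤ R) (ψ : E) {f g : ℝ → ℝ}
    (h : Set.EqOn f g (Set.Icc (-R) R)) : expectation H ψ f = expectation H ψ g := by
  unfold expectation
  rw [cfc_congr (h.mono (spectrum_real_subset hR))]

theorem expectation_nonneg {H : E →L[ℂ] E} {R : ℝ} (hR : ‖H‖ ≤ R) (ψ : E) {f : ℝ → ℝ}
    (h : ∀ t ∈ Set.Icc (-R) R, 0 ≤ f t) : 0 ≤ expectation H ψ f := by
  have h : 0 ≤ cfc f H := cfc_nonneg fun x hx => h x (spectrum_real_subset hR hx)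
  exact ((ContinuousLinearMap.nonneg_iff_isPositive _).1 h).re_inner_nonneg_right ψ

theorem expectation_one {H : E →L[ℂ] E} (hH : IsSelfAdjoint H) (ψ : E) :
    expectation H ψ (fun _ => 1) = ‖ψ‖ ^ 2 := by
  unfold expectation
  have h : cfc (fun _ : ℝ => (1 : ℝ)) H = 1 := cfc_one ℝ H hH
  rw [h, one_apply_eq_self]
  exact inner_self_eq_norm_sq (𝕜 := ℂ) ψ

theorem expectation_sub {H : E →L[ℂ] E} (ψ : E) {f g : ℝ → ℝ}
    (hf : Continuous f) (hg : Continuous g) :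
    expectation H ψ (fun t => f t - g t) = expectation H ψ f - expectation H ψ g := by
  unfold expectation
  rw [cfc_sub f g H hf.continuousOn hg.continuousOn, _root_.sub_apply, inner_sub_right,
    Complex.sub_re]

theorem spectralMeasure_compl_Icc {H : E →L[ℂ] E} {R : ℝ} (hR : ‖H‖ ≤ R) (ψ : E) :
    spectralMeasure H ψ (Set.Icc (-R) R)ᶜ = 0 := by
  have hreg : (spectralMeasure H ψ).Regular := by unfold spectralMeasure; infer_instance
  rw [(isClosed_Icc.isOpen_compl (X := ℝ)).measure_eq_iSup_isCompact]
  simp only [ENNReal.iSup_eq_zero]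
  intro K hKU hK
  obtain ⟨f, hf1, hf0, hfc, hf⟩ := exists_continuous_one_zero_of_isCompact hK
    (isClosed_Icc (a := -R) (b := R))
    (Set.disjoint_left.2 fun x hx => hKU hx)
  let g : C_c(ℝ, ℝ) := ⟨f, hfc⟩
  have h1 := RealRMK.rieszMeasure_le_of_eq_one (spectralFunctional H ψ) (f := g)
    (fun x => (hf x).1) hK (fun x hx => hf1 hx)
  have h2 : spectralFunctional H ψ g = 0 := by
    change expectation H ψ f = 0
    rw [expectation_congr hR ψ (g := fun _ => 0) hf0]
    unfold expectation
    rw [cfc_const_zero]; simp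
  rw [h2, ENNReal.ofReal_zero] at h1
  exact le_antisymm h1 zero_le

theorem spectralMeasure_lt_top {H : E →L[ℂ] E} (ψ : E) :
    spectralMeasure H ψ Set.univ < ∞ := by
  have hreg : (spectralMeasure H ψ).Regular := by unfold spectralMeasure; infer_instance
  rw [← measure_add_measure_compl (isClosed_Icc (a := -‖H‖) (b := ‖H‖)).measurableSet,
    spectralMeasure_compl_Icc le_rfl, add_zero]
  exact isCompact_Icc.measure_lt_top

instance spectralMeasure.isFiniteMeasure (H : E →L[ℂ] E) (ψ : E) :
    IsFiniteMeasure (spectralMeasure H ψ) := ⟨spectralMeasure_lt_top ψ⟩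

theorem lintegral_spectralMeasure {H : E →L[ℂ] E} {R : ℝ} (hR : ‖H‖ ≤ R) (ψ : E) {f : ℝ → ℝ}
    (hf : Continuous f) (hf0 : ∀ t ∈ Set.Icc (-R) R, 0 ≤ f t) :
    ∫⁻ t, ENNReal.ofReal (f t) ∂(spectralMeasure H ψ) = ENNReal.ofReal (expectation H ψ f) := by
  obtain ⟨χ, hχ1, -, hχc, hχ⟩ := exists_continuous_one_zero_of_isCompact
    (isCompact_Icc (a := -R) (b := R)) (isClosed_empty (X := ℝ)) (Set.disjoint_empty _)
  let g : C_c(ℝ, ℝ) := ⟨⟨fun t => max (f t) 0 * χ t, by fun_prop⟩, hχc.mul_left⟩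
  have hfg : Set.EqOn f g (Set.Icc (-R) R) := fun t ht => by
    change f t = max (f t) 0 * χ t
    rw [hχ1 ht, max_eq_left (hf0 t ht)]; simp
  have h1 : ∫ t, g t ∂(spectralMeasure H ψ) = expectation H ψ g :=
    RealRMK.integral_rieszMeasure (spectralFunctional H ψ) g
  have hae : ∀ᵐ t ∂(spectralMeasure H ψ), t ∈ Set.Icc (-R) R := by
    rw [ae_iff]; exact spectralMeasure_compl_Icc hR ψ
  have h2 : ∫⁻ t, ENNReal.ofReal (f t) ∂(spectralMeasure H ψ) =
      ∫⁻ t, ENNReal.ofReal (g t) ∂(spectralMeasure H ψ) :=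
    lintegral_congr_ae (hae.mono fun t ht => by simp only [hfg ht])
  have hg0 : ∀ t, 0 ≤ g t := fun t => mul_nonneg (le_max_right _ _) (hχ t).1
  rw [h2, expectation_congr hR ψ hfg, ← h1]
  exact (ofReal_integral_eq_lintegral_ofReal
    (g.continuous.integrable_of_hasCompactSupport g.hasCompactSupport)
    (Eventually.of_forall hg0)).symm

theorem spectralMeasure_univ {H : E →L[ℂ] E} (hH : IsSelfAdjoint H) (ψ : E) :
    spectralMeasure H ψ Set.univ = ENNReal.ofReal (‖ψ‖ ^ 2) := by
  have h := lintegral_spectralMeasure le_rfl ψ (H := H) (f := fun _ => 1) continuous_const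
    (fun _ _ => zero_le_one)
  rw [expectation_one hH] at h
  rw [← h]; simp

theorem continuous_expectation {X : Type*} [TopologicalSpace X] {H : X → E →L[ℂ] E}
    (hH : Continuous H) (hsa : ∀ x, IsSelfAdjoint (H x)) {R : ℝ} (hR : ∀ x, ‖H x‖ ≤ R) (ψ : E)
    {f : ℝ → ℝ} (hf : Continuous f) : Continuous fun x => expectation (H x) ψ f := by
  unfold expectation
  have h := Continuous.cfc' (isCompact_Icc (a := -R) (b := R)) f hH
    (fun x => spectrum_real_subset (hR x)) hf.continuousOn hsa
  exact Complex.continuous_re.comp (continuous_const.inner (h.clm_apply continuous_const))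

/-- The measure of a closed set is the limit of expectations of continuous functions, which are
continuous in the parameter. -/
theorem measurable_spectralMeasure {X : Type*} [TopologicalSpace X] [MeasurableSpace X]
    [OpensMeasurableSpace X] {H : X → E →L[ℂ] E}
    (hH : Continuous H) (hsa : ∀ x, IsSelfAdjoint (H x)) {R : ℝ} (hR : ∀ x, ‖H x‖ ≤ R) (ψ : E) :
    Measurable fun x => spectralMeasure (H x) ψ := by
  refine Measurable.measure_of_isPiSystem (S := {s : Set ℝ | IsClosed s}) ?_ isPiSystem_isClosed
    ?_ ?_
  · rw [← borel_eq_generateFrom_isClosed]; exact BorelSpace.measurable_eq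
  · intro F hF
    have hF : IsClosed F := hF
    have hδ : ∀ n : ℕ, (0 : ℝ) < 1 / ((n : ℝ) + 1) := fun n => by positivity
    refine measurable_of_tendsto_metrizable (f := fun n x =>
      ∫⁻ t, (thickenedIndicator (hδ n) F t : ℝ≥0∞) ∂(spectralMeasure (H x) ψ)) (fun n => ?_) ?_
    · have h1 : ∀ x, ∫⁻ t, (thickenedIndicator (hδ n) F t : ℝ≥0∞) ∂(spectralMeasure (H x) ψ) =
          ENNReal.ofReal (expectation (H x) ψ fun t => (thickenedIndicator (hδ n) F t : ℝ)) := by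
        intro x
        rw [← lintegral_spectralMeasure (hR x) ψ
          (f := fun t => (thickenedIndicator (hδ n) F t : ℝ))
          (NNReal.continuous_coe.comp (thickenedIndicator (hδ n) F).continuous)
          (fun _ _ => NNReal.coe_nonneg _)]
        simp only [ENNReal.ofReal_coe_nnreal]
      simp only [h1]
      exact (ENNReal.measurable_ofReal.comp (continuous_expectation hH hsa hR ψ
        (NNReal.continuous_coe.comp (thickenedIndicator (hδ n) F).continuous)).measurable)
    · rw [tendsto_pi_nhds]
      exact fun x => tendsto_lintegral_thickenedIndicator_of_isClosed _ hF hδ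
        tendsto_one_div_add_atTop_nhds_zero_nat
  · simp only [spectralMeasure_univ (hsa _)]
    exact measurable_const

/-- The functions of the spectral parameter on the right-hand side converge to the indicator
function of `{e}` on `[e - R, e + R]`. -/
theorem kernelMean_eq_cfc {H : E →L[ℂ] E} (hH : IsSelfAdjoint H) (e R : ℝ) (n : ℕ) :
    kernelMean (H - (e : ℂ) • 1) R n =
      cfc (fun t : ℝ => (n : ℝ)⁻¹ * ∑ k ∈ Finset.range n, (1 - R⁻¹ ^ 2 * (t - e) ^ 2) ^ k) H := by
  let q : Polynomial ℝ := Polynomial.C (n : ℝ)⁻¹ * ∑ k ∈ Finset.range n,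
    (1 - Polynomial.C (R⁻¹ ^ 2) * (Polynomial.X - Polynomial.C e) ^ 2) ^ k
  have h1 : (fun t : ℝ => (n : ℝ)⁻¹ * ∑ k ∈ Finset.range n, (1 - R⁻¹ ^ 2 * (t - e) ^ 2) ^ k) =
      q.eval := by
    funext t
    simp [q, Polynomial.eval_finsetSum]
  have hsm : ∀ (r : ℝ) (T : E →L[ℂ] E), (r : ℂ) • T = algebraMap ℝ (E →L[ℂ] E) r * T := by
    intro r T
    rw [← Algebra.smul_def]
    exact (RCLike.real_smul_eq_coe_smul (K := ℂ) r T).symm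
  rw [h1, cfc_polynomial q H hH]
  simp only [q, map_mul, map_sum, map_pow, map_sub, map_one, Polynomial.aeval_C,
    Polynomial.aeval_X]
  unfold kernelMean
  have h2 : ((n : ℂ))⁻¹ = (((n : ℝ)⁻¹ : ℝ) : ℂ) := by push_cast; rfl
  rw [h2]
  simp only [hsm, mul_one, sq]
  simp

end Spectral

/-- The trace of an orthogonal projection bounds the sum of its diagonal matrix elements. -/
theorem sum_norm_sq_projection_le {E : Type*} [NormedAddCommGroup E] [InnerProductSpace ℂ E]
    {ι : Type*} (W : Submodule ℂ E) [FiniteDimensional ℂ W]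
    {b : ι → E} (hb : Orthonormal ℂ b) (s : Finset ι) :
    ∑ i ∈ s, ‖W.starProjection (b i)‖ ^ 2 ≤ Module.finrank ℂ W := by
  let w := stdOrthonormalBasis ℂ W
  have h1 : ∀ u : E, ‖W.starProjection u‖ ^ 2 = ∑ j, ‖inner ℂ (u) (w j : E)‖ ^ 2 := by
    intro u
    rw [Submodule.starProjection_apply, Submodule.norm_coe, ← w.sum_sq_norm_inner_right]
    refine Finset.sum_congr rfl fun j _ => ?_
    have h := W.inner_orthogonalProjectionOnto_eq_of_mem_left (w j) u
    rw [norm_inner_symm u, ← h]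
  simp only [h1]
  rw [Finset.sum_comm]
  calc _ ≤ ∑ j, ‖(w j : E)‖ ^ 2 := Finset.sum_le_sum fun j _ => hb.sum_inner_products_le _
    _ = _ := by
      have hn : ∀ j, ‖(w j : E)‖ = 1 := fun j => w.orthonormal.1 j
      simp [hn]

/-! ### The Schrödinger family and its density of states -/

theorem shift_shift (m n : ℤ) (ψ : EllTwo) : shift m (shift n ψ) = shift (m + n) ψ := by
  ext j
  simp only [shift_apply]
  ring_nf

theorem shift_zero (ψ : EllTwo) : shift 0 ψ = ψ := by
  ext j; simp

theorem norm_shift_apply (m : ℤ) (ψ : EllTwo) : ‖shift m ψ‖ = ‖ψ‖ := by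
  have h : inner ℂ (shift m ψ) (shift m ψ) = inner ℂ ψ ψ := by
    rw [inner_shift, shift_shift, neg_add_cancel, shift_zero]
  rw [inner_self_eq_norm_sq_to_K, inner_self_eq_norm_sq_to_K] at h
  have h2 : ‖shift m ψ‖ ^ 2 = ‖ψ‖ ^ 2 := by exact_mod_cast h
  exact (pow_left_inj₀ (norm_nonneg _) (norm_nonneg _) two_ne_zero).1 h2

theorem norm_shift_le (m : ℤ) : ‖shift m‖ ≤ 1 :=
  ContinuousLinearMap.opNorm_le_bound _ zero_le_one fun ψ => by
    rw [norm_shift_apply, one_mul]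

/-- The standard basis vector `δ_n` of `ℓ²(ℤ)`. -/
def delta (n : ℤ) : EllTwo := lp.single 2 n 1

theorem delta_apply (n j : ℤ) : (delta n : ℤ → ℂ) j = if j = n then 1 else 0 := by
  unfold delta
  rw [lp.coeFn_single, Pi.single_apply]

theorem shift_delta (m n : ℤ) : shift m (delta n) = delta (n - m) := by
  ext j
  rw [shift_apply, delta_apply, delta_apply]
  congr 1
  exact propext ⟨fun h => by omega, fun h => by omega⟩

theorem inner_delta_left (n : ℤ) (ψ : EllTwo) : inner ℂ (delta n) ψ = (ψ : ℤ → ℂ) n := by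
  unfold delta
  rw [lp.inner_single_left]; simp

theorem orthonormal_delta : Orthonormal ℂ delta := by
  rw [orthonormal_iff_ite]
  intro i j
  rw [inner_delta_left, delta_apply]

theorem norm_delta (n : ℤ) : ‖delta n‖ = 1 := orthonormal_delta.1 n

theorem span_delta : (Submodule.span ℂ (Set.range delta)).topologicalClosure = ⊤ := by
  rw [Submodule.topologicalClosure_eq_top_iff, Submodule.eq_bot_iff]
  intro ψ hψ
  ext n
  rw [Submodule.mem_orthogonal] at hψ
  have := hψ (delta n) (Submodule.subset_span ⟨n, rfl⟩)
  rwa [inner_delta_left] at this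

theorem potential_norm_sub_le {d : ℕ} (α : Fin d → ℝ) (v : C(QPTorus d, ℝ)) (x y : QPTorus d)
    {ε : ℝ} (hε : 0 ≤ ε)
    (h : ∀ n : ℤ, |v (x + n • torusPoint α) - v (y + n • torusPoint α)| ≤ ε) :
    ‖potential α v x - potential α v y‖ ≤ ε := by
  refine ContinuousLinearMap.opNorm_le_bound _ hε fun ψ => ?_
  refine lp.norm_le_of_forall_sum_le (p := 2) (by norm_num) (by positivity) fun s => ?_
  rw [Real.mul_rpow hε (norm_nonneg _)]
  refine le_trans ?_ (mul_le_mul_of_nonneg_left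
    (lp.sum_rpow_le_norm_rpow (p := 2) (by norm_num) ψ s) (by positivity))
  rw [Finset.mul_sum]
  refine Finset.sum_le_sum fun n _ => ?_
  rw [← Real.mul_rpow hε (norm_nonneg _)]
  refine Real.rpow_le_rpow (norm_nonneg _) ?_ (by norm_num)
  have : ((potential α v x - potential α v y) ψ : ℤ → ℂ) n =
      ((v (x + n • torusPoint α) - v (y + n • torusPoint α) : ℝ) : ℂ) * (ψ : ℤ → ℂ) n := by
    have h1 : ((potential α v x - potential α v y) ψ : ℤ → ℂ) n =
      (potential α v x ψ : ℤ → ℂ) n - (potential α v y ψ : ℤ → ℂ) n := rfl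
    rw [h1, potential_apply, potential_apply]; push_cast; ring
  rw [this, norm_mul, Complex.norm_real]
  exact mul_le_mul_of_nonneg_right (h n) (norm_nonneg _)

theorem norm_potential_le {d : ℕ} (α : Fin d → ℝ) (v : C(QPTorus d, ℝ)) (x : QPTorus d) :
    ‖potential α v x‖ ≤ ‖v‖ := LinearMap.mkContinuous_norm_le _ (norm_nonneg _) _

theorem continuous_potential {d : ℕ} (α : Fin d → ℝ) (v : C(QPTorus d, ℝ)) :
    Continuous (potential α v) := by
  have hu : UniformContinuous v := CompactSpace.uniformContinuous_of_continuous v.continuous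
  rw [Metric.uniformContinuous_iff] at hu
  rw [Metric.continuous_iff]
  intro y ε hε
  obtain ⟨δ, hδ, h⟩ := hu (ε / 2) (by positivity)
  refine ⟨δ, hδ, fun x hx => ?_⟩
  rw [dist_eq_norm]
  refine (potential_norm_sub_le α v x y (ε := ε / 2) (by positivity) fun n => ?_).trans_lt
    (by linarith)
  have : dist (x + n • torusPoint α) (y + n • torusPoint α) < δ := by
    rwa [dist_add_right]
  exact (h this).le

theorem continuous_schrodinger {d : ℕ} (α : Fin d → ℝ) (v : C(QPTorus d, ℝ)) :
    Continuous (schrodinger α v) := by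
  unfold schrodinger
  exact continuous_const.add (continuous_potential α v)

theorem norm_schrodinger_le {d : ℕ} (α : Fin d → ℝ) (v : C(QPTorus d, ℝ)) (x : QPTorus d) :
    ‖schrodinger α v x‖ ≤ 2 + ‖v‖ := by
  unfold schrodinger
  have h1 := norm_add_le (shift 1 + shift (-1)) (potential α v x)
  have h2 := norm_add_le (shift 1) (shift (-1))
  linarith [norm_shift_le 1, norm_shift_le (-1), norm_potential_le α v x]

theorem schrodinger_shift {d : ℕ} (α : Fin d → ℝ) (v : C(QPTorus d, ℝ)) (x : QPTorus d) (n : ℤ)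
    (ψ : EllTwo) : schrodinger α v (x + n • torusPoint α) (shift n ψ) =
      shift n (schrodinger α v x ψ) := by
  ext j
  have h0 : (shift n (schrodinger α v x ψ) : ℤ → ℂ) j = (schrodinger α v x ψ : ℤ → ℂ) (j + n) := rfl
  rw [h0]
  simp only [schrodinger_apply, shift_apply]
  have h : x + n • torusPoint α + j • torusPoint α = x + (j + n) • torusPoint α := by
    rw [add_smul, add_assoc, add_comm (n • torusPoint α)]
  rw [h]
  congr 3 <;> ring_nf

section DensityOfStates

variable {d : ℕ} (α : Fin d → ℝ) (v : C(QPTorus d, ℝ))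

theorem measurable_spectralMeasure_schrodinger (ψ : EllTwo) :
    Measurable fun x => spectralMeasure (schrodinger α v x) ψ :=
  measurable_spectralMeasure (continuous_schrodinger α v) (schrodinger_isSelfAdjoint α v)
    (norm_schrodinger_le α v) ψ

theorem lintegral_densityOfStates {f : ℝ → ℝ} (hf : Continuous f)
    (hf0 : ∀ t ∈ Set.Icc (-(2 + ‖v‖)) (2 + ‖v‖), 0 ≤ f t) :
    ∫⁻ t, ENNReal.ofReal (f t) ∂(densityOfStates α v) =
      ∫⁻ x, ENNReal.ofReal (expectation (schrodinger α v x) (delta 0) f) ∂(torusMeasure d) := by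
  unfold densityOfStates
  rw [Measure.lintegral_bind (f := fun t => ENNReal.ofReal (f t))
    (measurable_spectralMeasure_schrodinger α v _).aemeasurable
    (ENNReal.measurable_ofReal.comp hf.measurable).aemeasurable]
  refine lintegral_congr fun x => ?_
  exact lintegral_spectralMeasure (norm_schrodinger_le α v x) _ hf hf0

instance densityOfStates.isProbabilityMeasure : IsProbabilityMeasure (densityOfStates α v) := by
  constructor
  have h := lintegral_densityOfStates α v (f := fun _ => 1) continuous_const
    fun _ _ => zero_le_one
  simp only [expectation_one (schrodinger_isSelfAdjoint α v _), norm_delta] at h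
  simpa using h

theorem kernelMean_shift (x : QPTorus d) (e R : ℝ) (n : ℤ) (j : ℕ) (ψ : EllTwo) :
    kernelMean (schrodinger α v (x + n • torusPoint α) - (e : ℂ) • 1) R j (shift n ψ) =
      shift n (kernelMean (schrodinger α v x - (e : ℂ) • 1) R j ψ) := by
  unfold kernelMean
  set X := schrodinger α v (x + n • torusPoint α) - (e : ℂ) • 1
  set Y := schrodinger α v x - (e : ℂ) • 1
  have h1 : ∀ ψ, X (shift n ψ) = shift n (Y ψ) := fun ψ => by
    simp only [X, Y, _root_.sub_apply, schrodinger_shift, map_sub]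
    rfl
  have h2 : ∀ ψ : EllTwo, (1 - (((R⁻¹ ^ 2 : ℝ)) : ℂ) • (X * X)) (shift n ψ) =
      shift n ((1 - (((R⁻¹ ^ 2 : ℝ)) : ℂ) • (Y * Y)) ψ) := fun ψ => by
    simp only [_root_.sub_apply, _root_.smul_apply, mul_apply_eq_comp, h1, map_sub, map_smul,
      one_apply_eq_self]
  have h3 : ∀ (k : ℕ) (ψ : EllTwo), ((1 - (((R⁻¹ ^ 2 : ℝ)) : ℂ) • (X * X)) ^ k) (shift n ψ) =
      shift n (((1 - (((R⁻¹ ^ 2 : ℝ)) : ℂ) • (Y * Y)) ^ k) ψ) := fun k => by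
    induction k with
    | zero => intro ψ; simp
    | succ k ih =>
      intro ψ
      simp only [pow_succ _ k, mul_apply_eq_comp]
      rw [h2, ih]
  simp only [_root_.smul_apply, _root_.sum_apply, h3, map_smul, map_sum]

/-- The eigenspaces of `H(x)` have dimension at most `2`, since a solution of the eigenvalue
equation is determined by two neighbouring values. -/
theorem finrank_eigenspace_le (x : QPTorus d) (e : ℝ) :
    FiniteDimensional ℂ (schrodinger α v x - (e : ℂ) • 1).ker ∧
      Module.finrank ℂ (schrodinger α v x - (e : ℂ) • 1).ker ≤ 2 := by
  let W := (schrodinger α v x - (e : ℂ) • 1).ker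
  let φ : W →ₗ[ℂ] (Fin 2 → ℂ) :=
    { toFun := fun ψ => ![((ψ : EllTwo) : ℤ → ℂ) 0, ((ψ : EllTwo) : ℤ → ℂ) 1]
      map_add' := fun a b => by ext i; fin_cases i <;> rfl
      map_smul' := fun a b => by ext i; fin_cases i <;> rfl }
  have hφ : Function.Injective φ := by
    rw [injective_iff_map_eq_zero]
    intro ψ hψ
    have h0 : ((ψ : EllTwo) : ℤ → ℂ) 0 = 0 := congrFun hψ 0
    have h1 : ((ψ : EllTwo) : ℤ → ℂ) 1 = 0 := congrFun hψ 1
    have heq : ∀ n : ℤ, ((ψ : EllTwo) : ℤ → ℂ) (n + 1) + ((ψ : EllTwo) : ℤ → ℂ) (n - 1) +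
        ((v (x + n • torusPoint α) : ℝ) : ℂ) * ((ψ : EllTwo) : ℤ → ℂ) n =
        e * ((ψ : EllTwo) : ℤ → ℂ) n := by
      intro n
      have h := ψ.2
      have h2 : schrodinger α v x ψ - (e : ℂ) • (ψ : EllTwo) = 0 := h
      rw [sub_eq_zero] at h2
      have h3 := congrArg (fun w : EllTwo => (w : ℤ → ℂ) n) h2
      exact h3
    -- Two vanishing neighbouring values propagate in both directions.
    have hpos : ∀ n : ℕ, ((ψ : EllTwo) : ℤ → ℂ) n = 0 ∧ ((ψ : EllTwo) : ℤ → ℂ) (n + 1) = 0 := by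
      intro n
      induction n with
      | zero => exact ⟨by simpa using h0, by simpa using h1⟩
      | succ n ih =>
        have h := heq (n + 1)
        rw [ih.2, add_sub_cancel_right, ih.1] at h
        refine ⟨by exact_mod_cast ih.2, ?_⟩
        push_cast
        simpa using h
    have hneg : ∀ n : ℕ, ((ψ : EllTwo) : ℤ → ℂ) (-n) = 0 ∧
        ((ψ : EllTwo) : ℤ → ℂ) (-n + 1) = 0 := by
      intro n
      induction n with
      | zero => exact ⟨by simpa using h0, by simpa using h1⟩
      | succ n ih =>
        have h := heq (-n)
        rw [ih.2, ih.1] at h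
        have h5 : (-((n + 1 : ℕ) : ℤ)) = -(n : ℤ) - 1 := by push_cast; ring
        refine ⟨?_, ?_⟩
        · rw [h5]; simpa using h
        · rw [h5, sub_add_cancel]; exact ih.1
    ext n
    rcases Int.eq_nat_or_neg n with ⟨m, rfl | rfl⟩
    · exact (hpos m).1
    · exact (hneg m).1
  have hfd : FiniteDimensional ℂ W := FiniteDimensional.of_injective φ hφ
  refine ⟨hfd, ?_⟩
  exact (LinearMap.finrank_le_finrank_of_injective hφ).trans (by simp)

/-- The density of states measure has no atoms: by covariance the mass of `{e}` is at most the mean of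
`‖P(x) δ_n‖²` for each `n`, where `P(x)` is the projection onto the eigenspace, while the sum of these
numbers over `n` is at most the dimension of the eigenspace. -/
theorem densityOfStates_singleton (e : ℝ) : densityOfStates α v {e} = 0 := by
  set R : ℝ := 2 + ‖v‖ + |e| + 1 with hR
  have hR0 : 0 < R := by positivity
  let T : QPTorus d → EllTwo →L[ℂ] EllTwo := fun x => schrodinger α v x - (e : ℂ) • 1
  have hTR : ∀ x, ‖T x‖ ≤ R := by
    intro x
    refine (norm_sub_le _ _).trans ?_
    have h1 : ‖(e : ℂ) • (1 : EllTwo →L[ℂ] EllTwo)‖ ≤ |e| := by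
      rw [norm_smul, Complex.norm_real, Real.norm_eq_abs]
      calc _ ≤ |e| * 1 := by gcongr; exact ContinuousLinearMap.norm_id_le
        _ = _ := mul_one _
    linarith [norm_schrodinger_le α v x]
  have hTsa : ∀ x, IsSelfAdjoint (T x) := fun x => by
    refine (schrodinger_isSelfAdjoint α v x).sub ?_
    rw [IsSelfAdjoint, star_smul]; simp
  have hTcont : Continuous T := (continuous_schrodinger α v).sub continuous_const
  let f : ℕ → ℝ → ℝ := fun j t =>
    (j : ℝ)⁻¹ * ∑ k ∈ Finset.range j, (1 - R⁻¹ ^ 2 * (t - e) ^ 2) ^ k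
  have hfcont : ∀ j, Continuous (f j) := fun j => by fun_prop
  have hfnn : ∀ j, ∀ t ∈ Set.Icc (-(2 + ‖v‖)) (2 + ‖v‖), 0 ≤ f j t := by
    intro j t ht
    refine mul_nonneg (by positivity) (Finset.sum_nonneg fun k _ => pow_nonneg ?_ _)
    have h1 : |t - e| ≤ R := by
      have := abs_le.2 ht
      linarith [abs_sub t e]
    have h2 : (R⁻¹ * |t - e|) ^ 2 ≤ 1 := by
      have : R⁻¹ * |t - e| ≤ 1 := by rw [inv_mul_le_iff₀ hR0]; linarith
      exact pow_le_one₀ (by positivity) this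
    rw [mul_pow, sq_abs] at h2
    linarith
  have hK : ∀ x j, expectation (schrodinger α v x) (delta 0) (f j) =
      (inner ℂ (delta 0) (kernelMean (T x) R j (delta 0))).re := by
    intro x j
    simp only [T]
    rw [kernelMean_eq_cfc (schrodinger_isSelfAdjoint α v x)]
    rfl
  let P : QPTorus d → EllTwo →L[ℂ] EllTwo := fun x => (T x).ker.starProjection
  have hlim : ∀ x n, Tendsto (fun j => kernelMean (T x) R j (delta n)) atTop
      (𝓝 (P x (delta n))) := fun x n => tendsto_kernelMean (hTsa x) hR0 (hTR x) _
  have hPn : ∀ x n, (inner ℂ (delta n) (P x (delta n))).re = ‖P x (delta n)‖ ^ 2 := by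
    intro x n
    have h1 : inner ℂ (delta n) (P x (delta n)) = inner ℂ (P x (delta n)) (P x (delta n)) := by
      simp only [P]
      rw [Submodule.inner_starProjection_left_eq_right]
      congr 1
      exact ((T x).ker.starProjection_eq_self_iff.2 ((T x).ker.starProjection_apply_mem _)).symm
    rw [h1]
    exact inner_self_eq_norm_sq (𝕜 := ℂ) _
  have hkcont : ∀ j n, Continuous fun x => kernelMean (T x) R j (delta n) := by
    intro j n
    refine Continuous.clm_apply ?_ continuous_const
    unfold kernelMean
    fun_prop
  have hmeas : ∀ n, StronglyMeasurable fun x => P x (delta n) := fun n =>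
    stronglyMeasurable_of_tendsto atTop (fun j => (hkcont j n).stronglyMeasurable)
      (tendsto_pi_nhds.2 fun x => hlim x n)
  have hmeas2 : ∀ n, Measurable fun x => ENNReal.ofReal (‖P x (delta n)‖ ^ 2) := fun n =>
    ENNReal.measurable_ofReal.comp ((hmeas n).norm.measurable.pow_const 2)
  have hle : densityOfStates α v {e} ≤ ∫⁻ x, ENNReal.ofReal (‖P x (delta 0)‖ ^ 2)
      ∂(torusMeasure d) := by
    have h1 : Tendsto (fun j => ∫⁻ x, ENNReal.ofReal (expectation (schrodinger α v x) (delta 0)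
        (f j)) ∂(torusMeasure d)) atTop
        (𝓝 (∫⁻ x, ENNReal.ofReal (‖P x (delta 0)‖ ^ 2) ∂(torusMeasure d))) := by
      refine tendsto_lintegral_of_dominated_convergence (fun _ => 1) (fun j => ?_) (fun j => ?_)
        (by simp) ?_
      · exact ENNReal.measurable_ofReal.comp (continuous_expectation (continuous_schrodinger α v)
          (schrodinger_isSelfAdjoint α v) (norm_schrodinger_le α v) _ (hfcont j)).measurable
      · refine Eventually.of_forall fun x => ?_
        rw [ENNReal.ofReal_le_one, hK]
        refine (Complex.re_le_norm _).trans ((norm_inner_le_norm _ _).trans ?_)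
        rw [norm_delta, one_mul]
        have h2 := ContinuousLinearMap.le_opNorm (kernelMean (T x) R j) (delta 0)
        rw [norm_delta, mul_one] at h2
        exact h2.trans (norm_kernelMean_le (hTsa x) hR0 (hTR x) j)
      · refine Eventually.of_forall fun x => ?_
        simp only [hK]
        rw [← hPn]
        refine (ENNReal.continuous_ofReal.tendsto _).comp ((Complex.continuous_re.tendsto _).comp ?_)
        exact tendsto_const_nhds.inner (hlim x 0)
    refine ge_of_tendsto h1 ?_
    filter_upwards [eventually_gt_atTop 0] with j hj
    rw [← lintegral_densityOfStates α v (hfcont j) (hfnn j), ← lintegral_indicator_one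
      (measurableSet_singleton e)]
    refine lintegral_mono fun t => ?_
    by_cases ht : t = e
    · subst ht
      have : (j : ℝ) ≠ 0 := by exact_mod_cast hj.ne'
      simp [f, this]
    · simp [ht]
  have hinv : ∀ n : ℤ, ∫⁻ x, ENNReal.ofReal (‖P x (delta n)‖ ^ 2) ∂(torusMeasure d) =
      ∫⁻ x, ENNReal.ofReal (‖P x (delta 0)‖ ^ 2) ∂(torusMeasure d) := by
    intro n
    have h1 : ∀ x, ‖P x (delta n)‖ = ‖P (x + n • torusPoint α) (delta 0)‖ := by
      intro x
      have h2 : P (x + n • torusPoint α) (delta 0) = shift n (P x (delta n)) := by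
        refine tendsto_nhds_unique (hlim _ 0) ?_
        refine (((shift n).continuous.tendsto _).comp (hlim x n)).congr fun j => ?_
        simp only [Function.comp, T]
        rw [← kernelMean_shift, shift_delta, sub_self]
      rw [h2, norm_shift_apply]
    simp only [h1]
    exact (measurePreserving_add_torus (n • torusPoint α)).lintegral_comp (hmeas2 0)
  have hbound : ∀ K : ℕ, (K : ℝ≥0∞) * densityOfStates α v {e} ≤ 2 := by
    intro K
    calc (K : ℝ≥0∞) * densityOfStates α v {e}
        ≤ K * ∫⁻ x, ENNReal.ofReal (‖P x (delta 0)‖ ^ 2) ∂(torusMeasure d) := by gcongr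
      _ = ∑ n ∈ Finset.range K, ∫⁻ x, ENNReal.ofReal (‖P x (delta n)‖ ^ 2)
            ∂(torusMeasure d) := by
          simp only [hinv, Finset.sum_const, Finset.card_range, nsmul_eq_mul]
      _ = ∫⁻ x, ∑ n ∈ Finset.range K, ENNReal.ofReal (‖P x (delta n)‖ ^ 2)
            ∂(torusMeasure d) :=
          (lintegral_finsetSum _ fun (n : ℕ) _ => hmeas2 n).symm
      _ ≤ ∫⁻ x, 2 ∂(torusMeasure d) := by
          refine lintegral_mono fun x => ?_
          rw [← ENNReal.ofReal_sum_of_nonneg fun _ _ => by positivity]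
          obtain ⟨hfd, hfr⟩ := finrank_eigenspace_le α v x e
          have h1 := sum_norm_sq_projection_le (T x).ker
            (orthonormal_delta.comp (fun n : ℕ => (n : ℤ)) Nat.cast_injective) (Finset.range K)
          refine (ENNReal.ofReal_le_ofReal (h1.trans (Nat.cast_le.2 hfr))).trans ?_
          simp
      _ = 2 := by simp
  by_contra hne
  obtain ⟨K, hK⟩ := ENNReal.exists_nat_mul_gt hne (b := 2) (by simp)
  exact absurd (hbound K) (not_le.2 hK)

end DensityOfStates

/-! ### The Dirichlet solution and the rotation number -/

section RotationNumber

variable {d : ℕ} (α : Fin d → ℝ) (v : C(QPTorus d, ℝ))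

/-- The potential along the orbit of `0`. -/
def orbitPotential (n : ℤ) : ℝ := v (n • torusPoint α)

/-- The first component of the orbit of `(1, 0)` over `0`: the Dirichlet solution. -/
def dirichlet (E : ℝ) (n : ℕ) : ℝ := cocycleOrbit α v E 0 ![1, 0] n 0

/-- The second component of the orbit of `(1, 0)` over `0`. -/
def dirichletPrev (E : ℝ) (n : ℕ) : ℝ := cocycleOrbit α v E 0 ![1, 0] n 1

@[simp] theorem dirichlet_zero (E : ℝ) : dirichlet α v E 0 = 1 := rfl

@[simp] theorem dirichletPrev_zero (E : ℝ) : dirichletPrev α v E 0 = 0 := rfl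

theorem dirichlet_succ (E : ℝ) (n : ℕ) : dirichlet α v E (n + 1) =
    (E - orbitPotential α v n) * dirichlet α v E n - dirichletPrev α v E n := by
  simp only [dirichlet, dirichletPrev, cocycleOrbit, transferMatrix, orbitPotential,
    Matrix.mulVec, dotProduct, Fin.sum_univ_two]
  simp
  ring

theorem dirichletPrev_succ (E : ℝ) (n : ℕ) :
    dirichletPrev α v E (n + 1) = dirichlet α v E n := by
  simp [dirichlet, dirichletPrev, cocycleOrbit, transferMatrix, Matrix.mulVec, dotProduct,
    Fin.sum_univ_two]

/-- The Dirichlet solution is a monic polynomial in the energy, so that it vanishes somewhere for only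
countably many energies. -/
theorem exists_dirichlet_polynomial (n : ℕ) : ∃ p q : Polynomial ℝ, p.Monic ∧ q.degree < p.degree ∧
    ∀ E, p.eval E = dirichlet α v E n ∧ q.eval E = dirichletPrev α v E n := by
  induction n with
  | zero => exact ⟨1, 0, Polynomial.monic_one, by simp, fun E => by simp⟩
  | succ n ih =>
    obtain ⟨p, q, hp, hpq, he⟩ := ih
    set a := Polynomial.X - Polynomial.C (orbitPotential α v n) with ha
    have ham : a.Monic := Polynomial.monic_X_sub_C _
    have hdeg : (a * p).degree = 1 + p.degree := by
      rw [Polynomial.degree_mul, ha, Polynomial.degree_X_sub_C]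
    have hlt : p.degree < (a * p).degree := by
      rw [hdeg, Polynomial.degree_eq_natDegree hp.ne_zero]
      exact_mod_cast (by omega : p.natDegree < 1 + p.natDegree)
    have hq : q.degree < (a * p).degree := hpq.trans hlt
    refine ⟨a * p - q, p, (ham.mul hp).sub_of_left hq, ?_, fun E => ?_⟩
    · rwa [Polynomial.degree_sub_eq_left_of_degree_lt hq]
    · rw [dirichlet_succ, dirichletPrev_succ, ← (he E).1, ← (he E).2]
      simp [ha]

theorem countable_dirichlet_eq_zero : {E : ℝ | ∃ n, dirichlet α v E n = 0}.Countable := by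
  have : {E : ℝ | ∃ n, dirichlet α v E n = 0} = ⋃ n, {E : ℝ | dirichlet α v E n = 0} := by
    ext E; simp
  rw [this]
  refine Set.countable_iUnion fun n => ?_
  obtain ⟨p, q, hp, -, he⟩ := exists_dirichlet_polynomial α v n
  refine (p.rootSet_finite ℝ).countable.mono fun E hE => ?_
  rw [Polynomial.mem_rootSet]
  refine ⟨hp.ne_zero, ?_⟩
  rw [Polynomial.coe_aeval_eq_eval, (he E).1]; exact hE

/-- The ratio of consecutive values of the Dirichlet solution. -/
def dirichletRatio (E : ℝ) (n : ℕ) : ℝ := dirichlet α v E (n + 1) / dirichlet α v E n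

theorem dirichletRatio_eq {E : ℝ} (h : ∀ n, dirichlet α v E n ≠ 0) (n : ℕ) :
    dirichletRatio α v E n =
      E - orbitPotential α v n - dirichletPrev α v E n / dirichlet α v E n := by
  unfold dirichletRatio
  rw [dirichlet_succ]
  have := h n
  field_simp

theorem dirichletPrev_div_succ (E : ℝ) (n : ℕ) :
    dirichletPrev α v E (n + 1) / dirichlet α v E (n + 1) = (dirichletRatio α v E n)⁻¹ := by
  rw [dirichletPrev_succ, dirichletRatio, inv_div]

/-- The arguments of `1 - ir` and `1 + is` are `-arctan r` and `arctan s`, and their difference stays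
in `(-π, π)`. -/
theorem arg_shear (r s : ℝ) :
    Complex.arg ((1 - Complex.I * r) / (1 + Complex.I * s)) = -(Real.arctan r + Real.arctan s) := by
  set A := Real.arctan r with hA
  set B := Real.arctan s with hB
  have hcA : 0 < Real.cos A := Real.cos_arctan_pos r
  have hcB : 0 < Real.cos B := Real.cos_arctan_pos s
  have hr : (r : ℂ) = Real.sin A / Real.cos A := by
    rw [← Complex.ofReal_div, ← Real.tan_eq_sin_div_cos, hA, Real.tan_arctan]
  have hs : (s : ℂ) = Real.sin B / Real.cos B := by
    rw [← Complex.ofReal_div, ← Real.tan_eq_sin_div_cos, hB, Real.tan_arctan]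
  have hcA' : (Real.cos A : ℂ) ≠ 0 := by exact_mod_cast hcA.ne'
  have hcB' : (Real.cos B : ℂ) ≠ 0 := by exact_mod_cast hcB.ne'
  have h1 : (1 - Complex.I * r) = Complex.exp (-(A * Complex.I)) / Real.cos A := by
    rw [← neg_mul, ← Complex.ofReal_neg, Complex.exp_mul_I, ← Complex.ofReal_cos,
      ← Complex.ofReal_sin, Real.cos_neg, Real.sin_neg, hr]
    field_simp
    push_cast; ring
  have h2 : (1 + Complex.I * s) = Complex.exp (B * Complex.I) / Real.cos B := by
    rw [Complex.exp_mul_I, ← Complex.ofReal_cos, ← Complex.ofReal_sin, hs]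
    field_simp
  have h3 : (1 - Complex.I * r) / (1 + Complex.I * s) =
      ((Real.cos B / Real.cos A : ℝ) : ℂ) * Complex.exp ((-(A + B) : ℝ) * Complex.I) := by
    have h4 : ((-(A + B) : ℝ) : ℂ) * Complex.I = -(A * Complex.I) - B * Complex.I := by
      push_cast; ring
    rw [h1, h2, h4, Complex.exp_sub]
    have := Complex.exp_ne_zero (B * Complex.I)
    push_cast
    field_simp
  rw [h3, Complex.arg_real_mul _ (by positivity), Complex.arg_exp_mul_I,
    toIocMod_eq_self]
  have a1 := Real.arctan_lt_pi_div_two r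
  have a2 := Real.neg_pi_div_two_lt_arctan r
  have b1 := Real.arctan_lt_pi_div_two s
  have b2 := Real.neg_pi_div_two_lt_arctan s
  constructor <;> linarith

theorem angleIncrement_dirichlet {E : ℝ} (h : ∀ n, dirichlet α v E n ≠ 0) (n : ℕ) :
    angleIncrement v E ((n : ℕ) • torusPoint α) (cocycleOrbit α v E 0 ![1, 0] n) =
      Real.pi / 2 - Real.arctan (dirichletRatio α v E n) -
        Real.arctan (dirichletPrev α v E n / dirichlet α v E n) := by
  unfold angleIncrement
  have h1 : (transferMatrix v E ((n : ℕ) • torusPoint α)).mulVec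
      (cocycleOrbit α v E 0 ![1, 0] n) = cocycleOrbit α v E 0 ![1, 0] (n + 1) := by
    simp [cocycleOrbit]
  rw [h1]
  have h2 : planeToComplex (cocycleOrbit α v E 0 ![1, 0] (n + 1)) /
      (Complex.I * planeToComplex (cocycleOrbit α v E 0 ![1, 0] n)) =
      (1 - Complex.I * dirichletRatio α v E n) /
        (1 + Complex.I * (dirichletPrev α v E n / dirichlet α v E n : ℝ)) := by
    have e1 : planeToComplex (cocycleOrbit α v E 0 ![1, 0] (n + 1)) =
        dirichlet α v E (n + 1) + dirichlet α v E n * Complex.I := by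
      rw [← dirichletPrev_succ α v E n]
      exact Complex.mk_eq_add_mul_I _ _
    have e2 : planeToComplex (cocycleOrbit α v E 0 ![1, 0] n) =
        dirichlet α v E n + dirichletPrev α v E n * Complex.I := Complex.mk_eq_add_mul_I _ _
    rw [e1, e2, dirichletRatio]
    have hp : (dirichlet α v E n : ℂ) ≠ 0 := by exact_mod_cast h n
    have e3 : (dirichlet α v E n : ℂ) + dirichletPrev α v E n * Complex.I =
        dirichlet α v E n * (1 + Complex.I * (dirichletPrev α v E n / dirichlet α v E n : ℝ)) := by
      push_cast; field_simp
    have e4 : (dirichlet α v E (n + 1) : ℂ) + dirichlet α v E n * Complex.I =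
        Complex.I * dirichlet α v E n *
          (1 - Complex.I * (dirichlet α v E (n + 1) / dirichlet α v E n : ℝ)) := by
      push_cast; field_simp; ring_nf; simp
    rw [e3, e4, ← mul_assoc, mul_div_mul_left _ _ (mul_ne_zero Complex.I_ne_zero hp)]
  rw [h2, arg_shear]
  ring

/-- The number of sign changes of the Dirichlet solution on `{0, …, n}`, as the number of negative
ratios of consecutive values; it is used for energies at which no value vanishes. -/
def signChanges (E : ℝ) (n : ℕ) : ℕ :=
  ((Finset.range n).filter fun j => dirichletRatio α v E j < 0).card

/-- The total angle is, up to a bounded error, `π` times the number of sign changes. -/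
theorem sum_angleIncrement {E : ℝ} (h : ∀ n, dirichlet α v E n ≠ 0) (n : ℕ) :
    ∑ j ∈ Finset.range n,
      angleIncrement v E ((j : ℕ) • torusPoint α) (cocycleOrbit α v E 0 ![1, 0] j) =
      Real.pi * signChanges α v E n +
        Real.arctan (dirichletPrev α v E n / dirichlet α v E n) := by
  induction n with
  | zero => simp [signChanges]
  | succ n ih =>
    rw [Finset.sum_range_succ, ih, angleIncrement_dirichlet α v h, dirichletPrev_div_succ]
    have hr : dirichletRatio α v E n ≠ 0 := div_ne_zero (h _) (h _)
    rcases lt_or_gt_of_ne hr with hr | hr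
    · have : signChanges α v E (n + 1) = signChanges α v E n + 1 := by
        unfold signChanges
        rw [Finset.range_add_one, Finset.filter_insert, if_pos hr, Finset.card_insert_of_notMem]
        simp
      rw [this, Real.arctan_inv_of_neg hr]
      push_cast; ring
    · have : signChanges α v E (n + 1) = signChanges α v E n := by
        unfold signChanges
        rw [Finset.range_add_one, Finset.filter_insert, if_neg (not_lt.2 hr.le)]
      rw [this, Real.arctan_inv_of_pos hr]
      ring

theorem fiberedRotationNumber_eq_of_tendsto {E : ℝ} (h : ∀ n, dirichlet α v E n ≠ 0) {c : ℝ}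
    (hc : Tendsto (fun n : ℕ => (signChanges α v E n : ℝ) / n) atTop (𝓝 c)) :
    fiberedRotationNumber α v E = c / 2 := by
  unfold fiberedRotationNumber
  refine Tendsto.limUnder_eq ?_
  simp only [sum_angleIncrement α v h]
  have h1 : Tendsto (fun n : ℕ => Real.arctan (dirichletPrev α v E n / dirichlet α v E n) *
      (2 * Real.pi * n)⁻¹) atTop (𝓝 0) := by
    refine squeeze_zero_norm (a := fun n : ℕ => (n : ℝ)⁻¹) (fun n => ?_)
      tendsto_inv_atTop_nhds_zero_nat
    rcases Nat.eq_zero_or_pos n with rfl | hn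
    · simp
    have hn' : (0 : ℝ) < n := by exact_mod_cast hn
    have hpi := Real.pi_pos
    have h2 : |Real.arctan (dirichletPrev α v E n / dirichlet α v E n)| ≤ 2 * Real.pi :=
      abs_le.2 ⟨by linarith [Real.neg_pi_div_two_lt_arctan (dirichletPrev α v E n /
        dirichlet α v E n)], by linarith [Real.arctan_lt_pi_div_two (dirichletPrev α v E n /
        dirichlet α v E n)]⟩
    rw [norm_mul, Real.norm_eq_abs, Real.norm_of_nonneg (by positivity), mul_inv, ← mul_assoc]
    calc _ ≤ (2 * Real.pi) * (2 * Real.pi)⁻¹ * (n : ℝ)⁻¹ := by gcongr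
      _ = _ := by field_simp
  have h2 := (hc.div_const 2).add h1
  rw [add_zero] at h2
  refine h2.congr fun n => ?_
  have := Real.pi_ne_zero
  rcases Nat.eq_zero_or_pos n with rfl | hn
  · simp
  · have hn' : (n : ℝ) ≠ 0 := by exact_mod_cast hn.ne'
    field_simp

end RotationNumber

/-- If there were more negative coefficients in the first diagonalization, some nonzero vector would
annihilate the forms `l i` with `a i ≥ 0` and the forms `m i` with `b i < 0`, and the quadratic form
would be both negative and nonnegative there. -/
theorem card_neg_le_of_sum_sq_eq {n : ℕ} (a b : Fin n → ℝ)
    (l m : Fin n → (Fin n → ℝ) →ₗ[ℝ] ℝ)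
    (hq : ∀ y, ∑ i, a i * (l i y) ^ 2 = ∑ i, b i * (m i y) ^ 2)
    (hl : ∀ y, (∀ i, l i y = 0) → y = 0) :
    (Finset.univ.filter fun i => a i < 0).card ≤ (Finset.univ.filter fun i => b i < 0).card := by
  by_contra hlt
  push Not at hlt
  let φ : (Fin n → ℝ) →ₗ[ℝ] ({i // ¬ a i < 0} → ℝ) × ({i // b i < 0} → ℝ) :=
    (LinearMap.pi fun i => l i.1).prod (LinearMap.pi fun i => m i.1)
  have hker : LinearMap.ker φ ≠ ⊥ := by
    refine LinearMap.ker_ne_bot_of_finrank_lt ?_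
    simp only [Module.finrank_prod, Module.finrank_fintype_fun_eq_card, Fintype.card_fin]
    rw [Fintype.card_subtype, Fintype.card_subtype]
    have := Finset.card_filter_add_card_filter_not (s := (Finset.univ : Finset (Fin n)))
      (fun i => a i < 0)
    rw [Finset.card_univ, Fintype.card_fin] at this
    omega
  obtain ⟨y, hy, hy0⟩ := Submodule.exists_mem_ne_zero_of_ne_bot hker
  have h1 : ∀ i, ¬ a i < 0 → l i y = 0 := fun i hi =>
    congrFun (congrArg Prod.fst (LinearMap.mem_ker.1 hy)) ⟨i, hi⟩
  have h2 : ∀ i, b i < 0 → m i y = 0 := fun i hi =>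
    congrFun (congrArg Prod.snd (LinearMap.mem_ker.1 hy)) ⟨i, hi⟩
  have h3 : ∑ i, a i * (l i y) ^ 2 < 0 := by
    obtain ⟨k, hk⟩ : ∃ k, l k y ≠ 0 := by
      by_contra hne
      push Not at hne
      exact hy0 (hl y hne)
    have hak : a k < 0 := by
      by_contra h
      exact hk (h1 k h)
    refine Finset.sum_neg' (fun i _ => ?_) ⟨k, Finset.mem_univ _, mul_neg_of_neg_of_pos hak
      (by positivity)⟩
    by_cases hi : a i < 0
    · exact mul_nonpos_of_nonpos_of_nonneg hi.le (sq_nonneg _)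
    · rw [h1 i hi]; simp
  have h4 : 0 ≤ ∑ i, b i * (m i y) ^ 2 := by
    refine Finset.sum_nonneg fun i _ => ?_
    by_cases hi : b i < 0
    · rw [h2 i hi]; simp
    · exact mul_nonneg (not_lt.1 hi) (sq_nonneg _)
  rw [hq] at h3
  linarith

/-- Sylvester's law of inertia: two diagonalizations of a quadratic form have the same number of
negative coefficients. -/
theorem card_neg_eq_of_sum_sq_eq {n : ℕ} (a b : Fin n → ℝ)
    (l m : Fin n → (Fin n → ℝ) →ₗ[ℝ] ℝ)
    (hq : ∀ y, ∑ i, a i * (l i y) ^ 2 = ∑ i, b i * (m i y) ^ 2)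
    (hl : ∀ y, (∀ i, l i y = 0) → y = 0) (hm : ∀ y, (∀ i, m i y = 0) → y = 0) :
    (Finset.univ.filter fun i => a i < 0).card = (Finset.univ.filter fun i => b i < 0).card :=
  le_antisymm (card_neg_le_of_sum_sq_eq a b l m hq hl)
    (card_neg_le_of_sum_sq_eq b a m l (fun y => (hq y).symm) hm)

/-! ### The eigenvalues of finite boxes -/

section Box

variable {d : ℕ} (α : Fin d → ℝ) (v : C(QPTorus d, ℝ))

/-- The restriction of `H(0)` to `{0, …, n-1}` with Dirichlet boundary conditions. -/
def boxMatrix (n : ℕ) : Matrix (Fin n) (Fin n) ℝ :=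
  Matrix.of fun i j => (if (j : ℤ) = i then orbitPotential α v i else 0) +
    (if (j : ℤ) = i + 1 then 1 else 0) + (if (j : ℤ) = i - 1 then 1 else 0)

/-- Extension by zero of a vector on the box `{0, …, n-1}` to `ℤ`. -/
def extendBox {n : ℕ} (y : Fin n → ℝ) (k : ℤ) : ℝ :=
  if h : 0 ≤ k ∧ k < n then y ⟨k.toNat, by omega⟩ else 0

theorem extendBox_fin {n : ℕ} (y : Fin n → ℝ) (i : Fin n) : extendBox y (i : ℤ) = y i := by
  unfold extendBox
  rw [dif_pos ⟨by positivity, by exact_mod_cast i.2⟩]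
  congr 1

theorem extendBox_of_notMem {n : ℕ} (y : Fin n → ℝ) {k : ℤ} (h : ¬ (0 ≤ k ∧ k < n)) :
    extendBox y k = 0 := dif_neg h

theorem sum_ite_mul_eq_extendBox {n : ℕ} (y : Fin n → ℝ) (c : ℝ) (k : ℤ) :
    ∑ j : Fin n, (if (j : ℤ) = k then c else 0) * y j = c * extendBox y k := by
  by_cases h : 0 ≤ k ∧ k < n
  · have hk : ((⟨k.toNat, by omega⟩ : Fin n) : ℤ) = k := by simp [h.1]
    rw [Finset.sum_eq_single ⟨k.toNat, by omega⟩]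
    · rw [if_pos hk, ← extendBox_fin y ⟨k.toNat, by omega⟩, hk]
    · intro j _ hj
      rw [if_neg, zero_mul]
      intro hjk
      apply hj
      ext
      simp only
      omega
    · simp
  · rw [extendBox_of_notMem y h, mul_zero]
    refine Finset.sum_eq_zero fun j _ => ?_
    rw [if_neg, zero_mul]
    intro hjk
    exact h ⟨by omega, by omega⟩

theorem boxMatrix_mulVec {n : ℕ} (y : Fin n → ℝ) (i : Fin n) :
    (boxMatrix α v n).mulVec y i =
      orbitPotential α v i * y i + extendBox y (i + 1) + extendBox y (i - 1) := by
  simp only [Matrix.mulVec, dotProduct, boxMatrix, Matrix.of_apply, add_mul,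
    Finset.sum_add_distrib, sum_ite_mul_eq_extendBox, extendBox_fin, one_mul]

theorem boxMatrix_isHermitian (n : ℕ) : (boxMatrix α v n).IsHermitian := by
  ext i j
  simp only [boxMatrix, Matrix.conjTranspose_apply, Matrix.of_apply, star_trivial]
  by_cases h : i = j
  · subst h; rfl
  · have h' : (i : ℤ) ≠ j := fun h1 => h (Fin.ext (by exact_mod_cast h1))
    rw [if_neg h', if_neg h'.symm]
    have e1 : ((i : ℤ) = j + 1) = ((j : ℤ) = i - 1) := propext ⟨by omega, by omega⟩
    have e2 : ((i : ℤ) = j - 1) = ((j : ℤ) = i + 1) := propext ⟨by omega, by omega⟩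
    simp only [e1, e2]
    ring

/-- The eigenvalues of the box matrix. -/
def boxEigenvalue (n : ℕ) : Fin n → ℝ := (boxMatrix_isHermitian α v n).eigenvalues

/-- The coordinate of a vector along an eigenvector of the box matrix. -/
def boxCoordinate (n : ℕ) (i : Fin n) : (Fin n → ℝ) →ₗ[ℝ] ℝ where
  toFun y := ∑ j, (boxMatrix_isHermitian α v n).eigenvectorBasis i j * y j
  map_add' y z := by simp [mul_add, Finset.sum_add_distrib]
  map_smul' c y := by simp [Finset.mul_sum, mul_left_comm]

theorem sum_boxCoordinate_mul (n : ℕ) (y z : Fin n → ℝ) :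
    ∑ i, boxCoordinate α v n i y * boxCoordinate α v n i z = ∑ j, y j * z j := by
  have h := (boxMatrix_isHermitian α v n).eigenvectorBasis.sum_inner_mul_inner
    (WithLp.toLp 2 y) (WithLp.toLp 2 z)
  simp only [PiLp.inner_apply, RCLike.inner_apply, conj_trivial] at h
  rw [show ∑ j, y j * z j = ∑ j, z j * y j from Finset.sum_congr rfl fun j _ => mul_comm _ _, ← h]
  refine Finset.sum_congr rfl fun i _ => ?_
  simp only [boxCoordinate, LinearMap.coe_mk, AddHom.coe_mk]
  congr 1
  exact Finset.sum_congr rfl fun j _ => mul_comm _ _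

theorem boxCoordinate_mulVec (n : ℕ) (i : Fin n) (y : Fin n → ℝ) :
    boxCoordinate α v n i ((boxMatrix α v n).mulVec y) =
      boxEigenvalue α v n i * boxCoordinate α v n i y := by
  have h := (boxMatrix_isHermitian α v n).mulVec_eigenvectorBasis i
  have h1 : ∀ y, boxCoordinate α v n i y =
    dotProduct (⇑((boxMatrix_isHermitian α v n).eigenvectorBasis i)) y := fun y => rfl
  rw [h1, h1, Matrix.dotProduct_mulVec, ← Matrix.mulVec_transpose]
  have ht : (boxMatrix α v n).transpose = boxMatrix α v n := by
    have := boxMatrix_isHermitian α v n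
    rwa [Matrix.IsHermitian, Matrix.conjTranspose_eq_transpose_of_trivial] at this
  rw [ht, h, smul_dotProduct]
  rfl

/-- Completion of squares: the ratios of the Dirichlet solution are the pivots of the quadratic form of
`E - H`. -/
theorem sum_dirichletRatio_sq {E : ℝ} (h : ∀ n, dirichlet α v E n ≠ 0) (y : ℕ → ℝ) (n : ℕ) :
    ∑ j ∈ Finset.range n, dirichletRatio α v E j * (y j - y (j + 1) / dirichletRatio α v E j) ^ 2 =
      ∑ j ∈ Finset.range n, ((E - orbitPotential α v j) * y j ^ 2 - 2 * y j * y (j + 1)) +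
        dirichletPrev α v E n / dirichlet α v E n * y n ^ 2 := by
  induction n with
  | zero => simp
  | succ n ih =>
    rw [Finset.sum_range_succ, ih, Finset.sum_range_succ, dirichletPrev_div_succ]
    have hr : dirichletRatio α v E n ≠ 0 := div_ne_zero (h _) (h _)
    have h1 := dirichletRatio_eq α v h n
    have h2 : dirichletPrev α v E n / dirichlet α v E n =
      E - orbitPotential α v n - dirichletRatio α v E n := by rw [h1]; ring
    rw [h2]
    field_simp
    ring

theorem sum_mul_extendBox_shift {n : ℕ} (y : Fin n → ℝ) :
    ∑ i : Fin n, y i * extendBox y (i - 1) = ∑ i : Fin n, y i * extendBox y (i + 1) := by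
  have h1 : ∀ i : Fin n, y i * extendBox y (i - 1) =
      ∑ j : Fin n, (if (j : ℤ) = i - 1 then 1 else 0) * y j * y i := by
    intro i
    rw [← Finset.sum_mul, sum_ite_mul_eq_extendBox]; ring
  have h2 : ∀ i : Fin n, y i * extendBox y (i + 1) =
      ∑ j : Fin n, (if (j : ℤ) = i + 1 then 1 else 0) * y j * y i := by
    intro i
    rw [← Finset.sum_mul, sum_ite_mul_eq_extendBox]; ring
  simp only [h1, h2]
  rw [Finset.sum_comm]
  refine Finset.sum_congr rfl fun i _ => Finset.sum_congr rfl fun j _ => ?_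
  have e1 : ((i : ℤ) = j - 1) = ((j : ℤ) = i + 1) := propext ⟨by omega, by omega⟩
  simp only [e1]
  ring

/-- The Dirichlet solution diagonalizes the quadratic form of `E - H` on the box; hence its sign
changes count the eigenvalues above `E`. -/
theorem signChanges_eq_card {E : ℝ} (h : ∀ n, dirichlet α v E n ≠ 0) (n : ℕ) :
    signChanges α v E n = (Finset.univ.filter fun i => E < boxEigenvalue α v n i).card := by
  let l : Fin n → (Fin n → ℝ) →ₗ[ℝ] ℝ := fun i =>
    { toFun := fun y => y i - extendBox y (i + 1) / dirichletRatio α v E i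
      map_add' := fun y z => by
        have : extendBox (y + z) ((i : ℤ) + 1) = extendBox y (i + 1) + extendBox z (i + 1) := by
          unfold extendBox; split_ifs <;> simp
        rw [this, Pi.add_apply]; ring
      map_smul' := fun c y => by
        have : extendBox (c • y) ((i : ℤ) + 1) = c * extendBox y (i + 1) := by
          unfold extendBox; split_ifs <;> simp
        rw [this, Pi.smul_apply, smul_eq_mul, RingHom.id_apply, smul_eq_mul]; ring }
  have hl : ∀ y, (∀ i, l i y = 0) → y = 0 := by
    intro y hy
    -- The forms `l i` are triangular: downward induction from the right end of the box.
    have key : ∀ k : ℕ, ∀ j : ℕ, n ≤ j + k → extendBox y j = 0 := by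
      intro k
      induction k with
      | zero => intro j hj; exact extendBox_of_notMem y (by omega)
      | succ k ih =>
        intro j hj
        by_cases hjn : j < n
        · have h1 : y ⟨j, hjn⟩ - extendBox y ((j : ℤ) + 1) / dirichletRatio α v E j = 0 :=
            hy ⟨j, hjn⟩
          have h2 := ih (j + 1) (by omega)
          push_cast at h2
          rw [h2, zero_div, sub_zero] at h1
          rw [← h1]; exact extendBox_fin y ⟨j, hjn⟩
        · exact extendBox_of_notMem y (by omega)
    ext i
    rw [← extendBox_fin y i]
    exact key n i (by omega)
  have hm : ∀ y, (∀ i, boxCoordinate α v n i y = 0) → y = 0 := by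
    intro y hy
    have h1 := sum_boxCoordinate_mul α v n y y
    simp only [hy, mul_zero, Finset.sum_const_zero] at h1
    have h2 := (Finset.sum_eq_zero_iff_of_nonneg fun i _ => mul_self_nonneg (y i)).1 h1.symm
    ext i
    exact mul_self_eq_zero.1 (h2 i (Finset.mem_univ i))
  have hq : ∀ y, ∑ i : Fin n, dirichletRatio α v E i * (l i y) ^ 2 =
      ∑ i : Fin n, (E - boxEigenvalue α v n i) * (boxCoordinate α v n i y) ^ 2 := by
    intro y
    have h1 := sum_dirichletRatio_sq α v h (fun j => extendBox y j) n
    rw [extendBox_of_notMem y (k := n) (by omega)] at h1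
    rw [Finset.sum_range, Finset.sum_range] at h1
    simp only [extendBox_fin, Nat.cast_add, Nat.cast_one] at h1
    have h2 : ∑ i : Fin n, dirichletRatio α v E i * (l i y) ^ 2 = ∑ i : Fin n,
        ((E - orbitPotential α v i) * y i ^ 2 - 2 * y i * extendBox y (i + 1)) := by
      rw [zero_pow two_ne_zero, mul_zero, add_zero] at h1
      exact h1
    have h3 : ∑ i : Fin n, (E - boxEigenvalue α v n i) * (boxCoordinate α v n i y) ^ 2 =
        E * ∑ i, y i * y i - ∑ i, y i * (boxMatrix α v n).mulVec y i := by
      rw [← sum_boxCoordinate_mul α v n y y,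
        ← sum_boxCoordinate_mul α v n y ((boxMatrix α v n).mulVec y), Finset.mul_sum,
        ← Finset.sum_sub_distrib]
      refine Finset.sum_congr rfl fun i _ => ?_
      rw [boxCoordinate_mulVec]; ring
    have h4 : ∑ i, y i * (boxMatrix α v n).mulVec y i = ∑ i : Fin n,
        (orbitPotential α v i * y i ^ 2 + 2 * (y i * extendBox y (i + 1))) := by
      simp only [boxMatrix_mulVec, mul_add, Finset.sum_add_distrib, sum_mul_extendBox_shift,
        two_mul]
      rw [add_assoc]
      congr 1
      exact Finset.sum_congr rfl fun i _ => by ring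
    rw [h2, h3, h4, Finset.mul_sum, ← Finset.sum_sub_distrib]
    exact Finset.sum_congr rfl fun i _ => by ring
  have h5 := card_neg_eq_of_sum_sq_eq _ _ l (boxCoordinate α v n) hq hl hm
  simp only [sub_neg] at h5
  rw [← h5]
  unfold signChanges
  rw [Finset.card_filter, Finset.sum_range, Finset.card_filter]

theorem abs_boxEigenvalue_le (n : ℕ) (i : Fin n) : |boxEigenvalue α v n i| ≤ 2 + ‖v‖ := by
  set u : Fin n → ℝ := ⇑((boxMatrix_isHermitian α v n).eigenvectorBasis i) with hu
  have hu0 : u ≠ 0 := by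
    intro h0
    have h1 := (boxMatrix_isHermitian α v n).eigenvectorBasis.orthonormal.1 i
    have h2 : (boxMatrix_isHermitian α v n).eigenvectorBasis i = 0 := by
      ext j; exact congrFun h0 j
    rw [h2, norm_zero] at h1
    exact zero_ne_one h1
  have he : ∀ k, (boxMatrix α v n).mulVec u k = boxEigenvalue α v n i * u k := fun k =>
    congrFun ((boxMatrix_isHermitian α v n).mulVec_eigenvectorBasis i) k
  have : Nonempty (Fin n) := ⟨i⟩
  obtain ⟨k, hk⟩ := Finite.exists_max fun k => |u k|
  have hk0 : 0 < |u k| := by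
    obtain ⟨j, hj⟩ := Function.ne_iff.1 hu0
    exact (abs_pos.2 hj).trans_le (hk j)
  have hext : ∀ j, |extendBox u j| ≤ |u k| := by
    intro j
    unfold extendBox
    split_ifs
    · exact hk _
    · rw [abs_zero]; exact hk0.le
  have h1 := he k
  rw [boxMatrix_mulVec] at h1
  have h2 : |boxEigenvalue α v n i| * |u k| ≤ (2 + ‖v‖) * |u k| := by
    rw [← abs_mul, ← h1]
    have h3 := abs_add_le (orbitPotential α v k * u k + extendBox u (k + 1)) (extendBox u (k - 1))
    have h4 := abs_add_le (orbitPotential α v k * u k) (extendBox u (k + 1))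
    have h5 : |orbitPotential α v k * u k| ≤ ‖v‖ * |u k| := by
      rw [abs_mul]
      gcongr
      exact v.norm_coe_le_norm _
    linarith [hext (k + 1), hext (k - 1)]
  exact le_of_mul_le_mul_right h2 hk0

end Box

/-! ### The limiting eigenvalue distribution -/

section Expectation

variable {E : Type*} [NormedAddCommGroup E] [InnerProductSpace ℂ E] [CompleteSpace E]

theorem expectation_const {H : E →L[ℂ] E} (hH : IsSelfAdjoint H) (ψ : E) (c : ℝ) :
    expectation H ψ (fun _ => c) = c * ‖ψ‖ ^ 2 := by
  unfold expectation
  have h : cfc (fun _ : ℝ => c) H = algebraMap ℝ _ c := cfc_const c H hH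
  rw [h, Algebra.algebraMap_eq_smul_one, _root_.smul_apply, one_apply_eq_self,
    inner_smul_right_eq_smul, Complex.smul_re, smul_eq_mul]
  congr 1
  exact inner_self_eq_norm_sq (𝕜 := ℂ) ψ

theorem expectation_pow {H : E →L[ℂ] E} (hH : IsSelfAdjoint H) (ψ : E) (m : ℕ) :
    expectation H ψ (fun t => t ^ m) = (inner ℂ ψ ((H ^ m) ψ)).re := by
  unfold expectation
  rw [cfc_pow_id (R := ℝ) H m hH]

end Expectation

section EigenvalueDistribution

variable {d : ℕ} (α : Fin d → ℝ) (v : C(QPTorus d, ℝ))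

/-- The `m`-th moment `⟨δ₀, H(x)^m δ₀⟩` as a continuous function on the torus. -/
def momentFunction (m : ℕ) : C(QPTorus d, ℂ) :=
  ⟨fun x => inner ℂ (delta 0) ((schrodinger α v x ^ m) (delta 0)),
    continuous_const.inner (((continuous_schrodinger α v).pow m).clm_apply continuous_const)⟩

theorem norm_schrodinger_pow_le (x : QPTorus d) (m : ℕ) (ψ : EllTwo) :
    ‖(schrodinger α v x ^ m) ψ‖ ≤ (2 + ‖v‖) ^ m * ‖ψ‖ := by
  induction m with
  | zero => simp
  | succ m ih =>
    rw [pow_succ', mul_apply_eq_comp, pow_succ', mul_assoc]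
    refine (ContinuousLinearMap.le_of_opNorm_le _ (norm_schrodinger_le α v x) _).trans ?_
    gcongr

theorem norm_momentFunction_le (m : ℕ) (x : QPTorus d) :
    ‖momentFunction α v m x‖ ≤ (2 + ‖v‖) ^ m := by
  refine (norm_inner_le_norm (𝕜 := ℂ) (delta 0) ((schrodinger α v x ^ m) (delta 0))).trans ?_
  have h := norm_schrodinger_pow_le α v x m (delta 0)
  rw [norm_delta, mul_one] at h
  rwa [norm_delta, one_mul]

theorem schrodinger_pow_shift (x : QPTorus d) (n : ℤ) (m : ℕ) (ψ : EllTwo) :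
    (schrodinger α v (x + n • torusPoint α) ^ m) (shift n ψ) =
      shift n ((schrodinger α v x ^ m) ψ) := by
  induction m generalizing ψ with
  | zero => simp
  | succ m ih => rw [pow_succ, pow_succ, mul_apply_eq_comp, mul_apply_eq_comp,
      schrodinger_shift, ih]

theorem momentFunction_orbit (m : ℕ) (n : ℤ) :
    momentFunction α v m (n • torusPoint α) =
      ((schrodinger α v 0 ^ m) (delta n) : ℤ → ℂ) n := by
  have h := schrodinger_pow_shift α v 0 n m (delta n)
  rw [zero_add, shift_delta, sub_self] at h
  change inner ℂ (delta 0) ((schrodinger α v (n • torusPoint α) ^ m) (delta 0)) = _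
  rw [h, inner_delta_left, shift_apply, zero_add]

/-- The `j`-th column of the `m`-th power of the box matrix. -/
def boxPower (n m : ℕ) (j : Fin n) : Fin n → ℝ := ((boxMatrix α v n).mulVec)^[m] (Pi.single j 1)

theorem boxPower_succ (n m : ℕ) (j : Fin n) :
    boxPower α v n (m + 1) j = (boxMatrix α v n).mulVec (boxPower α v n m j) :=
  Function.iterate_succ_apply' _ _ _

theorem abs_boxMatrix_mulVec_le {n : ℕ} {y : Fin n → ℝ} {c : ℝ} (hc : 0 ≤ c)
    (hy : ∀ i, |y i| ≤ c) (i : Fin n) : |(boxMatrix α v n).mulVec y i| ≤ (2 + ‖v‖) * c := by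
  have hext : ∀ j, |extendBox y j| ≤ c := by
    intro j
    unfold extendBox
    split_ifs
    · exact hy _
    · rwa [abs_zero]
  rw [boxMatrix_mulVec]
  have h3 := abs_add_le (orbitPotential α v i * y i + extendBox y (i + 1)) (extendBox y (i - 1))
  have h4 := abs_add_le (orbitPotential α v i * y i) (extendBox y (i + 1))
  have h5 : |orbitPotential α v i * y i| ≤ ‖v‖ * c := by
    rw [abs_mul]
    exact mul_le_mul (v.norm_coe_le_norm _) (hy i) (abs_nonneg _) (norm_nonneg _)
  linarith [hext (i + 1), hext (i - 1)]

theorem abs_boxPower_le (n m : ℕ) (j i : Fin n) : |boxPower α v n m j i| ≤ (2 + ‖v‖) ^ m := by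
  induction m generalizing i with
  | zero =>
    simp only [boxPower, Function.iterate_zero, id, Pi.single_apply, pow_zero]
    split_ifs <;> simp
  | succ m ih =>
    rw [boxPower_succ, pow_succ']
    exact abs_boxMatrix_mulVec_le α v (by positivity) ih i

/-- Finite propagation: far from the boundary, powers of the box matrix agree with powers of
`H(0)`. -/
theorem schrodinger_pow_delta_eq_boxPower {n m : ℕ} (j : Fin n) (h1 : m ≤ j) (h2 : j + m < n)
    (k : ℕ) (hk : k ≤ m) (l : ℤ) :
    ((schrodinger α v 0 ^ k) (delta j) : ℤ → ℂ) l = extendBox (boxPower α v n k j) l ∧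
      ((k : ℤ) < |l - j| → ((schrodinger α v 0 ^ k) (delta j) : ℤ → ℂ) l = 0) := by
  induction k generalizing l with
  | zero =>
    have h0 : ((schrodinger α v 0 ^ 0) (delta j) : ℤ → ℂ) l = if l = j then 1 else 0 := by
      rw [pow_zero, one_apply_eq_self, delta_apply]
    rw [h0]
    refine ⟨?_, fun h => ?_⟩
    · by_cases hl : 0 ≤ l ∧ l < n
      · have hl' : l = ((⟨l.toNat, by omega⟩ : Fin n) : ℤ) := by simp [hl.1]
        rw [hl', extendBox_fin]
        simp only [boxPower, Function.iterate_zero, id, Pi.single_apply, Fin.ext_iff]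
        split_ifs <;> first | omega | simp
      · rw [extendBox_of_notMem _ hl, if_neg (by omega)]; simp
    · rw [if_neg]
      rintro rfl
      simp at h
  | succ k ih =>
    have hs : ((schrodinger α v 0 ^ (k + 1)) (delta j) : ℤ → ℂ) l =
        ((schrodinger α v 0 ^ k) (delta j) : ℤ → ℂ) (l + 1) +
        ((schrodinger α v 0 ^ k) (delta j) : ℤ → ℂ) (l - 1) +
        (orbitPotential α v l : ℂ) * ((schrodinger α v 0 ^ k) (delta j) : ℤ → ℂ) l := by
      rw [pow_succ', mul_apply_eq_comp, schrodinger_apply, zero_add]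
      rfl
    have hsup : ((k + 1 : ℕ) : ℤ) < |l - j| →
        ((schrodinger α v 0 ^ (k + 1)) (delta j) : ℤ → ℂ) l = 0 := by
      intro h
      rw [lt_abs] at h
      push_cast at h
      rw [hs, (ih (by omega) (l + 1)).2 (by rw [lt_abs]; omega),
        (ih (by omega) (l - 1)).2 (by rw [lt_abs]; omega),
        (ih (by omega) l).2 (by rw [lt_abs]; omega)]
      simp
    refine ⟨?_, hsup⟩
    by_cases hl : 0 ≤ l ∧ l < n
    · have hl' : l = ((⟨l.toNat, by omega⟩ : Fin n) : ℤ) := by simp [hl.1]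
      rw [hs, (ih (by omega) (l + 1)).1, (ih (by omega) (l - 1)).1, (ih (by omega) l).1]
      rw [hl', extendBox_fin, extendBox_fin, boxPower_succ, boxMatrix_mulVec]
      push_cast; ring
    · rw [extendBox_of_notMem _ hl, hsup, Complex.ofReal_zero]
      rw [lt_abs]; push_cast; omega

theorem boxPower_diag_eq {n m : ℕ} (j : Fin n) (h1 : m ≤ j) (h2 : j + m < n) :
    boxPower α v n m j j = (momentFunction α v m ((j : ℕ) • torusPoint α)).re := by
  have h := (schrodinger_pow_delta_eq_boxPower α v j h1 h2 m le_rfl j).1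
  have h3 := momentFunction_orbit α v m j
  rw [natCast_zsmul] at h3
  rw [h3, h, extendBox_fin, Complex.ofReal_re]

theorem boxCoordinate_boxPower (n m : ℕ) (i j : Fin n) :
    boxCoordinate α v n i (boxPower α v n m j) =
      boxEigenvalue α v n i ^ m * boxCoordinate α v n i (Pi.single j 1) := by
  induction m with
  | zero => simp [boxPower]
  | succ m ih => rw [boxPower_succ, boxCoordinate_mulVec, ih]; ring

theorem sum_boxEigenvalue_pow (n m : ℕ) :
    ∑ i, boxEigenvalue α v n i ^ m = ∑ j, boxPower α v n m j j := by
  have h1 : ∀ i j : Fin n, boxCoordinate α v n i (Pi.single j 1) =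
      (boxMatrix_isHermitian α v n).eigenvectorBasis i j := fun i j => by
    simp [boxCoordinate, Pi.single_apply]
  have h2 : ∀ i : Fin n, ∑ j, boxCoordinate α v n i (Pi.single j 1) ^ 2 = 1 := fun i => by
    simp only [h1]
    rw [← EuclideanSpace.real_norm_sq_eq,
      (boxMatrix_isHermitian α v n).eigenvectorBasis.orthonormal.1 i, one_pow]
  have h3 : ∀ j : Fin n, boxPower α v n m j j =
      ∑ i, boxEigenvalue α v n i ^ m * boxCoordinate α v n i (Pi.single j 1) ^ 2 := fun j => by
    have h := sum_boxCoordinate_mul α v n (boxPower α v n m j) (Pi.single j 1)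
    simp only [boxCoordinate_boxPower] at h
    rw [show ∑ k, boxPower α v n m j k * (Pi.single j 1 : Fin n → ℝ) k = boxPower α v n m j j by
      simp [Pi.single_apply]] at h
    rw [← h]
    exact Finset.sum_congr rfl fun i _ => by ring
  simp only [h3]
  rw [Finset.sum_comm]
  refine Finset.sum_congr rfl fun i _ => ?_
  rw [← Finset.mul_sum, h2, mul_one]

/-- The trace of the `m`-th power of the box matrix differs from the sum of the diagonal elements of
`H(0)^m` only by the contribution of the `2m` sites near the boundary. -/
theorem abs_sum_boxEigenvalue_pow_sub_le (n m : ℕ) :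
    |∑ i, boxEigenvalue α v n i ^ m -
      ∑ j ∈ Finset.range n, (momentFunction α v m (j • torusPoint α)).re| ≤
      2 * (2 + ‖v‖) ^ m * (2 * m) := by
  rw [sum_boxEigenvalue_pow, Finset.sum_range, ← Finset.sum_sub_distrib]
  have hb : ∀ j : Fin n, |boxPower α v n m j j -
      (momentFunction α v m ((j : ℕ) • torusPoint α)).re| ≤
      if (j : ℕ) < m ∨ n ≤ j + m then 2 * (2 + ‖v‖) ^ m else 0 := by
    intro j
    split_ifs with h
    · have h1 := (Complex.abs_re_le_norm _).trans
        (norm_momentFunction_le α v m ((j : ℕ) • torusPoint α))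
      have h2 := abs_boxPower_le α v n m j j
      have h3 := abs_sub (boxPower α v n m j j)
        (momentFunction α v m ((j : ℕ) • torusPoint α)).re
      linarith
    · push Not at h
      rw [boxPower_diag_eq α v j h.1 h.2, sub_self, abs_zero]
  refine (Finset.abs_sum_le_sum_abs _ _).trans ((Finset.sum_le_sum fun j _ => hb j).trans ?_)
  rw [← Finset.sum_range (fun j : ℕ => if j < m ∨ n ≤ j + m then 2 * (2 + ‖v‖) ^ m else 0),
    ← Finset.sum_filter, Finset.sum_const, nsmul_eq_mul, mul_comm]
  gcongr
  have hsub : (Finset.range n).filter (fun j => j < m ∨ n ≤ j + m) ⊆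
      Finset.range m ∪ Finset.Ico (n - m) n := by
    intro j
    simp only [Finset.mem_filter, Finset.mem_range, Finset.mem_union, Finset.mem_Ico]
    omega
  have := (Finset.card_le_card hsub).trans (Finset.card_union_le _ _)
  rw [Finset.card_range, Nat.card_Ico] at this
  have h2 : ((Finset.range n).filter (fun j => j < m ∨ n ≤ j + m)).card ≤ 2 * m := by omega
  exact_mod_cast h2

theorem densityOfStates_compl_Icc :
    densityOfStates α v (Set.Icc (-(2 + ‖v‖)) (2 + ‖v‖))ᶜ = 0 := by
  unfold densityOfStates
  rw [Measure.bind_apply measurableSet_Icc.compl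
    (measurable_spectralMeasure_schrodinger α v _).aemeasurable]
  simp only [spectralMeasure_compl_Icc (norm_schrodinger_le α v _), lintegral_zero]

theorem ae_densityOfStates_mem_Icc :
    ∀ᵐ t ∂(densityOfStates α v), t ∈ Set.Icc (-(2 + ‖v‖)) (2 + ‖v‖) := by
  rw [ae_iff]; exact densityOfStates_compl_Icc α v

theorem integrable_densityOfStates {f : ℝ → ℝ} (hf : Continuous f) :
    Integrable f (densityOfStates α v) := by
  obtain ⟨C, hC⟩ := isCompact_Icc.exists_bound_of_continuousOn
    (s := Set.Icc (-(2 + ‖v‖)) (2 + ‖v‖)) hf.continuousOn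
  exact Integrable.of_bound hf.aestronglyMeasurable C
    ((ae_densityOfStates_mem_Icc α v).mono fun t ht => hC t ht)

theorem integral_densityOfStates {f : ℝ → ℝ} (hf : Continuous f) :
    ∫ t, f t ∂(densityOfStates α v) =
      ∫ x, expectation (schrodinger α v x) (delta 0) f ∂(torusMeasure d) := by
  obtain ⟨C, hC⟩ := isCompact_Icc.exists_bound_of_continuousOn
    (s := Set.Icc (-(2 + ‖v‖)) (2 + ‖v‖)) hf.continuousOn
  -- Adding a constant reduces the claim to the formula for nonnegative functions.
  have hnn : ∀ t ∈ Set.Icc (-(2 + ‖v‖)) (2 + ‖v‖), 0 ≤ f t - -C := fun t ht => by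
    have := (abs_le.1 (hC t ht)).1
    linarith
  have hcont : Continuous fun x => expectation (schrodinger α v x) (delta 0) fun t => f t - -C :=
    continuous_expectation (continuous_schrodinger α v) (schrodinger_isSelfAdjoint α v)
      (norm_schrodinger_le α v) _ (hf.sub continuous_const)
  have hint : ∀ g : QPTorus d → ℝ, Continuous g → Integrable g (torusMeasure d) := fun g hg =>
    hg.integrable_of_hasCompactSupport (HasCompactSupport.of_compactSpace g)
  have hfc : Continuous fun t => f t - -C := hf.sub continuous_const
  have h1 := lintegral_densityOfStates α v hfc hnn
  rw [← ofReal_integral_eq_lintegral_ofReal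
      ((integrable_densityOfStates α v hfc))
      ((ae_densityOfStates_mem_Icc α v).mono hnn),
    ← ofReal_integral_eq_lintegral_ofReal (hint _ hcont)
      (Eventually.of_forall fun x => expectation_nonneg (norm_schrodinger_le α v x) _ hnn)] at h1
  rw [ENNReal.ofReal_eq_ofReal_iff (integral_nonneg_of_ae
      ((ae_densityOfStates_mem_Icc α v).mono hnn)) (integral_nonneg fun x =>
      expectation_nonneg (norm_schrodinger_le α v x) _ hnn)] at h1
  have h2 : ∀ x, expectation (schrodinger α v x) (delta 0) (fun t => f t - -C) =
      expectation (schrodinger α v x) (delta 0) f - -C := fun x => by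
    rw [expectation_sub _ hf continuous_const,
      expectation_const (schrodinger_isSelfAdjoint α v x), norm_delta, one_pow, mul_one]
  simp only [h2] at h1
  rw [integral_sub (integrable_densityOfStates α v hf) (integrable_const _),
    integral_sub (hint _ (continuous_expectation (continuous_schrodinger α v)
      (schrodinger_isSelfAdjoint α v) (norm_schrodinger_le α v) _ hf)) (integrable_const _)] at h1
  simpa using h1

theorem expectation_schrodinger_pow (x : QPTorus d) (m : ℕ) :
    expectation (schrodinger α v x) (delta 0) (fun t => t ^ m) = (momentFunction α v m x).re :=
  expectation_pow (schrodinger_isSelfAdjoint α v x) _ _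

variable {α} in
/-- The moments of the eigenvalue distributions of the boxes converge to the moments of the density
of states. -/
theorem tendsto_moment (hα : RationallyIndependent α) (m : ℕ) :
    Tendsto (fun n : ℕ => (n : ℝ)⁻¹ * ∑ i, boxEigenvalue α v n i ^ m) atTop
      (𝓝 (∫ t, t ^ m ∂(densityOfStates α v))) := by
  rw [integral_densityOfStates α v (continuous_pow m)]
  simp only [expectation_schrodinger_pow]
  have h1 := (Complex.continuous_re.tendsto _).comp
    (tendsto_average_orbit hα (momentFunction α v m))
  have h2 : (∫ x, momentFunction α v m x ∂(torusMeasure d)).re =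
      ∫ x, (momentFunction α v m x).re ∂(torusMeasure d) :=
    (integral_re ((momentFunction α v m).continuous.integrable_of_hasCompactSupport
      (HasCompactSupport.of_compactSpace _))).symm
  rw [h2] at h1
  -- The boundary contribution is bounded, hence negligible after division by `n`.
  have h3 : Tendsto (fun n : ℕ => (n : ℝ)⁻¹ * (∑ i, boxEigenvalue α v n i ^ m -
      ∑ j ∈ Finset.range n, (momentFunction α v m (j • torusPoint α)).re)) atTop (𝓝 0) := by
    refine squeeze_zero_norm (a := fun n : ℕ => (n : ℝ)⁻¹ * (2 * (2 + ‖v‖) ^ m * (2 * m)))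
      (fun n => ?_) ?_
    · rw [norm_mul, Real.norm_eq_abs, Real.norm_eq_abs, abs_of_nonneg (by positivity)]
      gcongr
      exact abs_sum_boxEigenvalue_pow_sub_le α v n m
    · simpa using (tendsto_inv_atTop_nhds_zero_nat (𝕜 := ℝ)).mul_const
        (2 * (2 + ‖v‖) ^ m * (2 * m))
  have h4 := h3.add h1
  rw [zero_add] at h4
  refine h4.congr fun n => ?_
  have h5 : ((n : ℂ)⁻¹ * ∑ j ∈ Finset.range n, momentFunction α v m (j • torusPoint α)).re =
      (n : ℝ)⁻¹ * ∑ j ∈ Finset.range n, (momentFunction α v m (j • torusPoint α)).re := by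
    have : (n : ℂ)⁻¹ = ((n : ℝ)⁻¹ : ℝ) := by push_cast; rfl
    rw [this, Complex.re_ofReal_mul, Complex.re_sum]
  simp only [Function.comp, h5]
  ring

variable {α} in
theorem tendsto_average_boxEigenvalue_polynomial (hα : RationallyIndependent α)
    (p : Polynomial ℝ) :
    Tendsto (fun n : ℕ => (n : ℝ)⁻¹ * ∑ i, p.eval (boxEigenvalue α v n i)) atTop
      (𝓝 (∫ t, p.eval t ∂(densityOfStates α v))) := by
  induction p using Polynomial.induction_on' with
  | add p q hp hq =>
    simp only [Polynomial.eval_add, Finset.sum_add_distrib, mul_add]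
    rw [integral_add (integrable_densityOfStates α v p.continuous)
      (integrable_densityOfStates α v q.continuous)]
    exact hp.add hq
  | monomial m c =>
    simp only [Polynomial.eval_monomial]
    rw [integral_const_mul]
    refine ((tendsto_moment v hα m).const_mul c).congr fun n => ?_
    rw [← Finset.mul_sum]; ring

variable {α} in
theorem tendsto_average_boxEigenvalue (hα : RationallyIndependent α) {f : ℝ → ℝ}
    (hf : Continuous f) :
    Tendsto (fun n : ℕ => (n : ℝ)⁻¹ * ∑ i, f (boxEigenvalue α v n i)) atTop
      (𝓝 (∫ t, f t ∂(densityOfStates α v))) := by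
  rw [Metric.tendsto_atTop]
  intro ε hε
  obtain ⟨p, hp⟩ := exists_polynomial_near_of_continuousOn (-(2 + ‖v‖)) (2 + ‖v‖) f
    hf.continuousOn (ε / 4) (by positivity)
  obtain ⟨N, hN⟩ := Metric.tendsto_atTop.1
    (tendsto_average_boxEigenvalue_polynomial v hα p) (ε / 4) (by positivity)
  refine ⟨N, fun n hn => ?_⟩
  have h1 := hN n hn
  have h2 : |(n : ℝ)⁻¹ * ∑ i, p.eval (boxEigenvalue α v n i) -
      (n : ℝ)⁻¹ * ∑ i, f (boxEigenvalue α v n i)| ≤ ε / 4 := by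
    rw [← mul_sub, ← Finset.sum_sub_distrib, abs_mul, abs_of_nonneg (by positivity)]
    have h3 : |∑ i, (p.eval (boxEigenvalue α v n i) - f (boxEigenvalue α v n i))| ≤
        n * (ε / 4) := by
      refine (Finset.abs_sum_le_sum_abs _ _).trans ((Finset.sum_le_sum fun i _ =>
        (hp _ (abs_le.1 (abs_boxEigenvalue_le α v n i))).le).trans ?_)
      simp
    calc _ ≤ (n : ℝ)⁻¹ * (n * (ε / 4)) := by gcongr
      _ ≤ 1 * (ε / 4) := by
        rw [← mul_assoc]
        gcongr
        exact inv_mul_le_one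
      _ = _ := one_mul _
  have h4 : |∫ t, p.eval t ∂(densityOfStates α v) - ∫ t, f t ∂(densityOfStates α v)| ≤ ε / 4 := by
    rw [← integral_sub (integrable_densityOfStates α v p.continuous)
      (integrable_densityOfStates α v hf)]
    have := norm_integral_le_of_norm_le_const (μ := densityOfStates α v) (C := ε / 4)
      (f := fun t => p.eval t - f t)
      ((ae_densityOfStates_mem_Icc α v).mono fun t ht => (hp t ht).le)
    simpa using this
  rw [Real.dist_eq] at h1 ⊢
  rw [abs_lt] at h1 ⊢
  rw [abs_le] at h2 h4
  constructor <;> linarith [h1.1, h1.2, h2.1, h2.2, h4.1, h4.2]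

/-- The normalized eigenvalue counting measure of the box of size `n + 1`. -/
def boxMeasure (n : ℕ) : Measure ℝ :=
  ((n + 1 : ℕ) : ℝ≥0∞)⁻¹ • ∑ i, Measure.dirac (boxEigenvalue α v (n + 1) i)

instance boxMeasure.isProbabilityMeasure (n : ℕ) : IsProbabilityMeasure (boxMeasure α v n) := by
  constructor
  simp only [boxMeasure, Measure.smul_apply, Measure.coe_finsetSum, Finset.sum_apply,
    measure_univ, Finset.sum_const, Finset.card_univ, Fintype.card_fin, nsmul_eq_mul, mul_one,
    smul_eq_mul]
  exact ENNReal.inv_mul_cancel (by simp) (by simp)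

variable {α} in
/-- Weak convergence of the normalized counting measures, evaluated on a half-line, whose boundary
point is not an atom of the limit. -/
theorem tendsto_card_boxEigenvalue (hα : RationallyIndependent α) (E : ℝ) :
    Tendsto (fun n : ℕ => ((Finset.univ.filter fun i => E < boxEigenvalue α v n i).card : ℝ) / n)
      atTop (𝓝 (densityOfStates α v (Set.Ioi E)).toReal) := by
  rw [← tendsto_add_atTop_iff_nat 1]
  let μ : ℕ → ProbabilityMeasure ℝ := fun n => ⟨boxMeasure α v n, inferInstance⟩
  let μ' : ProbabilityMeasure ℝ := ⟨densityOfStates α v, inferInstance⟩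
  have h1 : Tendsto μ atTop (𝓝 μ') := by
    rw [ProbabilityMeasure.tendsto_iff_forall_integral_tendsto]
    intro f
    refine ((tendsto_add_atTop_iff_nat 1).2
      (tendsto_average_boxEigenvalue v hα f.continuous)).congr fun n => ?_
    change _ = ∫ t, f t ∂(boxMeasure α v n)
    unfold boxMeasure
    rw [integral_smul_measure, integral_finsetSum_measure]
    · have : ((n : ℝ≥0∞) + 1).toReal = n + 1 := by
        rw [ENNReal.toReal_add (by simp) (by simp)]; simp
      simp [this]
    · intro i _
      exact integrable_dirac (by simp)
  have h2 := ProbabilityMeasure.tendsto_measure_of_null_frontier_of_tendsto' h1 (E := Set.Ioi E)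
    (by
      change densityOfStates α v _ = 0
      rw [frontier_Ioi]; exact densityOfStates_singleton α v E)
  refine ((ENNReal.tendsto_toReal (measure_ne_top _ _)).comp h2).congr fun n => ?_
  change (boxMeasure α v n (Set.Ioi E)).toReal = _
  simp only [boxMeasure, Measure.smul_apply, Measure.coe_finsetSum, Finset.sum_apply,
    measurableSet_Ioi, Measure.dirac_apply', smul_eq_mul, ENNReal.toReal_mul, ENNReal.toReal_inv,
    ENNReal.toReal_natCast, Set.indicator_apply, Set.mem_Ioi, Pi.one_apply]
  rw [← Finset.sum_filter, Finset.sum_const, nsmul_eq_mul, mul_one, ENNReal.toReal_natCast,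
    div_eq_inv_mul]

variable {α} in
/-- The rotation number is half the integrated density of states above `E`. -/
theorem fiberedRotationNumber_eq (hα : RationallyIndependent α) {E : ℝ}
    (h : ∀ n, dirichlet α v E n ≠ 0) :
    fiberedRotationNumber α v E = (densityOfStates α v (Set.Ioi E)).toReal / 2 := by
  refine fiberedRotationNumber_eq_of_tendsto α v h ?_
  simp only [signChanges_eq_card α v h]
  exact tendsto_card_boxEigenvalue v hα E

end EigenvalueDistribution

/-! ### Energies parametrized by the dual phase -/

section Quantile

/-- On the circle `‖θ‖` is the distance to `0`, which is uniformly distributed on `(0, 1/2)`. -/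
theorem map_two_mul_norm_haarAddCircle :
    (AddCircle.haarAddCircle : Measure UnitAddCircle).map (fun θ => 2 * ‖θ‖) =
      (volume : Measure ℝ).restrict (Set.Ioo 0 1) := by
  have hm : Measurable fun θ : UnitAddCircle => 2 * ‖θ‖ := by fun_prop
  have h1 : (volume : Measure UnitAddCircle) = AddCircle.haarAddCircle := by
    rw [AddCircle.volume_eq_smul_haarAddCircle]; simp
  have := Measure.isProbabilityMeasure_map (μ := (AddCircle.haarAddCircle : Measure UnitAddCircle))
    hm.aemeasurable
  refine Measure.ext_of_Iic _ _ fun s => ?_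
  rw [Measure.map_apply hm measurableSet_Iic, Measure.restrict_apply measurableSet_Iic]
  have h2 : (fun θ : UnitAddCircle => 2 * ‖θ‖) ⁻¹' Set.Iic s = Metric.closedBall 0 (s / 2) := by
    ext θ
    simp only [Set.mem_preimage, Set.mem_Iic, mem_closedBall_zero_iff]
    constructor <;> intro h <;> linarith
  rw [h2, ← h1, AddCircle.volume_closedBall, mul_div_cancel₀ _ (two_ne_zero)]
  rcases le_or_gt 1 s with hs | hs
  · rw [min_eq_left hs, Set.inter_eq_self_of_subset_right fun x hx => hx.2.le.trans hs,
      Real.volume_Ioo]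
    simp
  · rw [min_eq_right hs.le]
    have h3 : Set.Iic s ∩ Set.Ioo 0 1 = Set.Ioc 0 s := by
      ext x
      simp only [Set.mem_inter_iff, Set.mem_Iic, Set.mem_Ioo, Set.mem_Ioc]
      exact ⟨fun h => ⟨h.2.1, h.1⟩, fun h => ⟨h.2, h.1, h.2.trans_lt hs⟩⟩
    rw [h3, Real.volume_Ioc, sub_zero]

theorem continuous_measure_Ioi (N : Measure ℝ) [IsProbabilityMeasure N] [NullSingletonClass N] :
    Continuous fun E => (N (Set.Ioi E)).toReal := by
  have h1 : ∀ E, (N (Set.Ioi E)).toReal = 1 - ProbabilityTheory.cdf N E := fun E => by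
    rw [ProbabilityTheory.cdf_eq_real, ← Set.compl_Iic, ← measureReal_def,
      probReal_compl_eq_one_sub measurableSet_Iic]
  simp only [h1]
  refine continuous_const.sub (continuous_iff_continuousAt.2 fun E => ?_)
  rw [(ProbabilityTheory.cdf N).mono.continuousAt_iff_leftLim_eq_rightLim,
    StieltjesFunction.rightLim_eq]
  have h2 := (ProbabilityTheory.cdf N).measure_singleton E
  rw [ProbabilityTheory.measure_cdf, measure_singleton, eq_comm, ENNReal.ofReal_eq_zero] at h2
  exact le_antisymm ((ProbabilityTheory.cdf N).mono.leftLim_le le_rfl) (by linarith)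

theorem exists_measure_Ioi_eq (N : Measure ℝ) [IsProbabilityMeasure N] [NullSingletonClass N] {t : ℝ}
    (ht : t ∈ Set.Ioo (0 : ℝ) 1) : ∃ E, (N (Set.Ioi E)).toReal = t := by
  have h1 : ∀ E, (N (Set.Ioi E)).toReal = 1 - ProbabilityTheory.cdf N E := fun E => by
    rw [ProbabilityTheory.cdf_eq_real, ← Set.compl_Iic, ← measureReal_def,
      probReal_compl_eq_one_sub measurableSet_Iic]
  have hbot : Tendsto (fun E => (N (Set.Ioi E)).toReal) atBot (𝓝 1) := by
    simp only [h1]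
    simpa using tendsto_const_nhds.sub (ProbabilityTheory.tendsto_cdf_atBot N)
  have htop : Tendsto (fun E => (N (Set.Ioi E)).toReal) atTop (𝓝 0) := by
    simp only [h1]
    simpa using (tendsto_const_nhds (x := (1 : ℝ))).sub (ProbabilityTheory.tendsto_cdf_atTop N)
  exact mem_range_of_exists_le_of_exists_ge (continuous_measure_Ioi N)
    ((htop.eventually_le_const ht.1).exists) ((hbot.eventually_const_le ht.2).exists)

/-- A measurable right inverse of the distribution function `E ↦ N (E, ∞)` transports Lebesgue
measure on `(0, 1)` to `N`. -/
theorem exists_quantile (N : Measure ℝ) [IsProbabilityMeasure N] [NullSingletonClass N] :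
    ∃ q : ℝ → ℝ, Measurable q ∧
      (∀ᵐ t ∂(volume.restrict (Set.Ioo (0 : ℝ) 1)), (N (Set.Ioi (q t))).toReal = t) ∧
      (volume.restrict (Set.Ioo (0 : ℝ) 1)).map q = N := by
  choose! q hq using fun t (ht : t ∈ Set.Ioo (0 : ℝ) 1) => exists_measure_Ioi_eq N ht
  have hmono : ∀ {a b : ℝ}, a ≤ b → (N (Set.Ioi b)).toReal ≤ (N (Set.Ioi a)).toReal :=
    fun h => ENNReal.toReal_mono (measure_ne_top _ _) (measure_mono (Set.Ioi_subset_Ioi h))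
  -- Any right inverse of a monotone function is monotone, hence measurable up to a null set.
  have hanti : AntitoneOn q (Set.Ioo 0 1) := by
    intro a ha b hb hab
    by_contra h
    have h1 := hmono (not_le.1 h).le
    rw [hq a ha, hq b hb] at h1
    exact h (le_of_eq (congrArg q (le_antisymm h1 hab)))
  have hae := aemeasurable_restrict_of_antitoneOn (μ := volume) measurableSet_Ioo hanti
  have hmk : ∀ᵐ t ∂(volume.restrict (Set.Ioo (0 : ℝ) 1)),
      (N (Set.Ioi (hae.mk q t))).toReal = t := by
    filter_upwards [hae.ae_eq_mk, ae_restrict_mem measurableSet_Ioo] with t h1 h2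
    rw [← h1, hq t h2]
  refine ⟨hae.mk q, hae.measurable_mk, hmk, ?_⟩
  have : IsProbabilityMeasure ((volume : Measure ℝ).restrict (Set.Ioo (0 : ℝ) 1)) :=
    ⟨by simp⟩
  have := Measure.isProbabilityMeasure_map (μ := (volume : Measure ℝ).restrict (Set.Ioo (0 : ℝ) 1))
    hae.measurable_mk.aemeasurable
  refine Measure.ext_of_Ici _ _ fun E => ?_
  rw [Measure.map_apply hae.measurable_mk measurableSet_Ici,
    ← measure_congr (Ioi_ae_eq_Ici (μ := N) (a := E)),
    ← ENNReal.ofReal_toReal (measure_ne_top N (Set.Ioi E))]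
  set F := (N (Set.Ioi E)).toReal with hF
  have hF1 : F ≤ 1 := ENNReal.toReal_le_of_le_ofReal zero_le_one (by simpa using prob_le_one)
  have hF0 : 0 ≤ F := ENNReal.toReal_nonneg
  refine le_antisymm ?_ ?_
  · calc _ ≤ (volume.restrict (Set.Ioo (0 : ℝ) 1)) (Set.Iic F) := by
          refine measure_mono_ae ?_
          filter_upwards [hmk] with t ht h
          change t ≤ F
          rw [← ht]
          exact hmono h
      _ ≤ volume (Set.Ioc 0 F) := by
          rw [Measure.restrict_apply measurableSet_Iic]
          exact measure_mono fun x hx => ⟨hx.2.1, hx.1⟩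
      _ = _ := by rw [Real.volume_Ioc, sub_zero]
  · calc ENNReal.ofReal F = volume (Set.Iio F ∩ Set.Ioo 0 1) := by
          have : Set.Iio F ∩ Set.Ioo 0 1 = Set.Ioo 0 F := by
            ext x
            simp only [Set.mem_inter_iff, Set.mem_Iio, Set.mem_Ioo]
            exact ⟨fun h => ⟨h.2.1, h.1⟩, fun h => ⟨h.2, h.1, h.2.trans_le hF1⟩⟩
          rw [this, Real.volume_Ioo, sub_zero]
      _ = (volume.restrict (Set.Ioo (0 : ℝ) 1)) (Set.Iio F) :=
          (Measure.restrict_apply measurableSet_Iio).symm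
      _ ≤ _ := by
          refine measure_mono_ae ?_
          filter_upwards [hmk] with t ht h
          change E ≤ _
          by_contra h1
          have h2 := hmono (not_le.1 h1).le
          rw [ht] at h2
          exact absurd (lt_of_lt_of_le h h2) (lt_irrefl _)

/-- A probability measure without atoms is the image of Haar measure on the circle under a
function `e` such that `N (e θ, ∞) = 2 ‖θ‖`. -/
theorem exists_measurePreserving_circle (N : Measure ℝ) [IsProbabilityMeasure N]
    [NullSingletonClass N] :
    ∃ e : UnitAddCircle → ℝ, MeasurePreserving e AddCircle.haarAddCircle N ∧
      ∀ᵐ θ ∂(AddCircle.haarAddCircle : Measure UnitAddCircle),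
        (N (Set.Ioi (e θ))).toReal = 2 * ‖θ‖ := by
  obtain ⟨q, hq, hqF, hqN⟩ := exists_quantile N
  have hm : Measurable fun θ : UnitAddCircle => 2 * ‖θ‖ := by fun_prop
  have h1 : MeasurePreserving (fun θ : UnitAddCircle => 2 * ‖θ‖) AddCircle.haarAddCircle
      (volume.restrict (Set.Ioo (0 : ℝ) 1)) := ⟨hm, map_two_mul_norm_haarAddCircle⟩
  have h2 : MeasurePreserving q (volume.restrict (Set.Ioo (0 : ℝ) 1)) N := ⟨hq, hqN⟩
  have h3 := h2.comp h1
  have h4 := h1.quasiMeasurePreserving.ae hqF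
  refine ⟨q ∘ fun θ => 2 * ‖θ‖, h3, ?_⟩
  simpa only [Function.comp_apply] using h4

theorem coe_norm_unitAddCircle (θ : UnitAddCircle) :
    ((‖θ‖ : ℝ) : UnitAddCircle) = θ ∨ ((‖θ‖ : ℝ) : UnitAddCircle) = -θ := by
  induction θ using QuotientAddGroup.induction_on with
  | H x =>
    have h0 : ((round x : ℝ) : UnitAddCircle) = 0 := by
      rw [AddCircle.coe_eq_zero_iff]
      exact ⟨round x, by simp⟩
    have h1 : ((x - round x : ℝ) : UnitAddCircle) = (x : UnitAddCircle) := by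
      rw [AddCircle.coe_sub, h0, sub_zero]
    have h2 : ‖(x : UnitAddCircle)‖ = |x - round x| := UnitAddCircle.norm_eq
    change ((‖(x : UnitAddCircle)‖ : ℝ) : UnitAddCircle) = (x : UnitAddCircle) ∨
      ((‖(x : UnitAddCircle)‖ : ℝ) : UnitAddCircle) = -(x : UnitAddCircle)
    rw [h2]
    rcases abs_choice (x - round x) with h | h
    · left; rw [h, h1]
    · right; rw [h, AddCircle.coe_neg, h1]

end Quantile

section DualEnergy

variable {d : ℕ} {α : Fin d → ℝ} (v : C(QPTorus d, ℝ))

instance densityOfStates.nullSingletonClass : NullSingletonClass (densityOfStates α v) :=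
  ⟨densityOfStates_singleton α v⟩

/-- The energies can be parametrized by the phase `θ` of the dual operator in such a way that the
rotation number at `e θ` is `‖θ‖`, i.e. `±θ`. -/
theorem exists_dual_energy (hα : RationallyIndependent α) :
    ∃ e : UnitAddCircle → ℝ,
      MeasurePreserving e AddCircle.haarAddCircle (densityOfStates α v) ∧
      (∀ᵐ θ ∂(AddCircle.haarAddCircle : Measure UnitAddCircle),
        (densityOfStates α v (Set.Ioi (e θ))).toReal = 2 * ‖θ‖) ∧
      ∀ᵐ θ ∂(AddCircle.haarAddCircle : Measure UnitAddCircle),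
        fiberedRotationNumber α v (e θ) = ‖θ‖ := by
  obtain ⟨e, he, h1⟩ := exists_measurePreserving_circle (densityOfStates α v)
  refine ⟨e, he, h1, ?_⟩
  have h2 : ∀ᵐ E ∂(densityOfStates α v), ∀ n, dirichlet α v E n ≠ 0 := by
    rw [ae_iff]
    simp only [not_forall, not_not]
    exact (countable_dirichlet_eq_zero α v).measure_zero _
  filter_upwards [h1, he.quasiMeasurePreserving.ae h2] with θ hθ hd
  rw [fiberedRotationNumber_eq v hα hd, hθ]
  ring

end DualEnergy

/-! ### The dual family on the torus -/

/-- The Hilbert space `L²(𝕋^d)`. -/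
abbrev TorusL2 (d : ℕ) : Type := Lp ℂ 2 (torusMeasure d)

section TorusOperators

variable {d : ℕ}

/-- Translation `(τ_a f)(x) = f(x + a)` on `L²(𝕋^d)`. -/
def translateL2 (a : QPTorus d) : TorusL2 d →L[ℂ] TorusL2 d :=
  (Lp.compMeasurePreservingₗᵢ ℂ (fun x => x + a)
    (measurePreserving_add_torus a)).toContinuousLinearMap

theorem coeFn_translateL2 (a : QPTorus d) (f : TorusL2 d) :
    translateL2 a f =ᵐ[torusMeasure d] fun x => f (x + a) :=
  Lp.coeFn_compMeasurePreserving f (measurePreserving_add_torus a)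

theorem norm_translateL2_apply (a : QPTorus d) (f : TorusL2 d) : ‖translateL2 a f‖ = ‖f‖ :=
  (Lp.compMeasurePreservingₗᵢ ℂ (fun x => x + a) (measurePreserving_add_torus a)).norm_map f

theorem ae_translate {p : QPTorus d → Prop} (a : QPTorus d) (h : ∀ᵐ x ∂(torusMeasure d), p x) :
    ∀ᵐ x ∂(torusMeasure d), p (x + a) :=
  (measurePreserving_add_torus a).quasiMeasurePreserving.ae h

theorem translateL2_translateL2 (a b : QPTorus d) (f : TorusL2 d) :
    translateL2 a (translateL2 b f) = translateL2 (a + b) f := by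
  refine Lp.ext ?_
  filter_upwards [coeFn_translateL2 a (translateL2 b f), ae_translate a (coeFn_translateL2 b f),
    coeFn_translateL2 (a + b) f] with x h1 h2 h3
  rw [h1, h2, h3, add_assoc]

theorem translateL2_zero (f : TorusL2 d) : translateL2 0 f = f := by
  refine Lp.ext ?_
  filter_upwards [coeFn_translateL2 0 f] with x h1
  rw [h1, add_zero]

theorem inner_translateL2 (a : QPTorus d) (f g : TorusL2 d) :
    inner ℂ (translateL2 a f) g = inner ℂ f (translateL2 (-a) g) := by
  have h : inner ℂ (translateL2 a f) (translateL2 a (translateL2 (-a) g)) =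
      inner ℂ f (translateL2 (-a) g) :=
    (Lp.compMeasurePreservingₗᵢ ℂ (fun x => x + a)
      (measurePreserving_add_torus a)).inner_map_map f (translateL2 (-a) g)
  rw [← h, translateL2_translateL2, add_neg_cancel, translateL2_zero]

/-- Multiplication by a continuous function on `L²(𝕋^d)`. -/
def multiply (g : C(QPTorus d, ℂ)) : TorusL2 d →L[ℂ] TorusL2 d :=
  (ContinuousLinearMap.mul ℂ ℂ).holderL (torusMeasure d) ∞ 2 2
    (ContinuousMap.toLp ∞ (torusMeasure d) ℂ g)

theorem coeFn_multiply (g : C(QPTorus d, ℂ)) (f : TorusL2 d) :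
    multiply g f =ᵐ[torusMeasure d] fun x => g x * f x := by
  have h1 := (ContinuousLinearMap.mul ℂ ℂ).coeFn_holder (r := 2)
    (ContinuousMap.toLp ∞ (torusMeasure d) ℂ g) f
  have h2 := ContinuousMap.coeFn_toLp (p := ∞) (torusMeasure d) (𝕜 := ℂ) g
  filter_upwards [h1, h2] with x hx hx2
  refine hx.trans ?_
  rw [hx2]; rfl

theorem inner_multiply (g : C(QPTorus d, ℂ)) (f₁ f₂ : TorusL2 d) :
    inner ℂ (multiply g f₁) f₂ = inner ℂ f₁ (multiply (star g) f₂) := by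
  rw [L2.inner_def, L2.inner_def]
  refine integral_congr_ae ?_
  filter_upwards [coeFn_multiply g f₁, coeFn_multiply (star g) f₂] with x h1 h2
  rw [h1, h2]
  simp only [RCLike.inner_apply, map_mul, ContinuousMap.star_apply, RCLike.star_def]
  ring

/-- The potential as a complex-valued function. -/
def complexPotential (v : C(QPTorus d, ℝ)) : C(QPTorus d, ℂ) :=
  ⟨fun x => (v x : ℂ), by fun_prop⟩

variable (α : Fin d → ℝ) (v : C(QPTorus d, ℝ))

/-- The dual operator `(h(θ)f)(x) = e^{2πiθ} f(x + α) + e^{-2πiθ} f(x - α) + v(x) f(x)` on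
`L²(𝕋^d)`. -/
def dualOperator (θ : UnitAddCircle) : TorusL2 d →L[ℂ] TorusL2 d :=
  (fourier 1 θ : ℂ) • translateL2 (torusPoint α) +
    (fourier 1 (-θ) : ℂ) • translateL2 (-torusPoint α) + multiply (complexPotential v)

/-- The dual current `(a(θ)f)(x) = i (e^{2πiθ} f(x + α) - e^{-2πiθ} f(x - α))`. -/
def dualCurrent (θ : UnitAddCircle) : TorusL2 d →L[ℂ] TorusL2 d :=
  Complex.I • ((fourier 1 θ : ℂ) • translateL2 (torusPoint α) -
    (fourier 1 (-θ) : ℂ) • translateL2 (-torusPoint α))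

theorem fourier_one_neg (θ : UnitAddCircle) :
    (fourier 1 (-θ) : ℂ) = starRingEnd ℂ (fourier 1 θ) := by
  rw [← fourier_neg]
  simp [fourier_apply]

theorem norm_fourier_one (θ : UnitAddCircle) : ‖(fourier 1 θ : ℂ)‖ = 1 := by
  rw [fourier_apply, Circle.norm_coe]

theorem fourier_one_mul_neg (θ : UnitAddCircle) :
    (fourier 1 θ : ℂ) * fourier 1 (-θ) = 1 := by
  rw [← fourier_one_add, add_neg_cancel]; simp

theorem norm_translateL2_le (a : QPTorus d) : ‖translateL2 a‖ ≤ 1 :=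
  ContinuousLinearMap.opNorm_le_bound _ zero_le_one fun f => by
    rw [norm_translateL2_apply, one_mul]

theorem norm_dualOperator_le (θ : UnitAddCircle) :
    ‖dualOperator α v θ‖ ≤ 2 + ‖multiply (complexPotential v)‖ := by
  unfold dualOperator
  have h1 := norm_add_le ((fourier 1 θ : ℂ) • translateL2 (torusPoint α) +
    (fourier 1 (-θ) : ℂ) • translateL2 (-torusPoint α)) (multiply (complexPotential v))
  have h2 := norm_add_le ((fourier 1 θ : ℂ) • translateL2 (torusPoint α))
    ((fourier 1 (-θ) : ℂ) • translateL2 (-torusPoint α))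
  rw [norm_smul, norm_smul, norm_fourier_one, norm_fourier_one, one_mul, one_mul] at h2
  linarith [norm_translateL2_le (torusPoint α), norm_translateL2_le (-torusPoint α)]

theorem dualOperator_isSelfAdjoint (θ : UnitAddCircle) : IsSelfAdjoint (dualOperator α v θ) := by
  rw [ContinuousLinearMap.isSelfAdjoint_iff_isSymmetric]
  intro f g
  change inner ℂ ((fourier 1 θ : ℂ) • translateL2 (torusPoint α) f +
    (fourier 1 (-θ) : ℂ) • translateL2 (-torusPoint α) f + multiply (complexPotential v) f) g =
    inner ℂ f ((fourier 1 θ : ℂ) • translateL2 (torusPoint α) g +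
    (fourier 1 (-θ) : ℂ) • translateL2 (-torusPoint α) g + multiply (complexPotential v) g)
  have hv : star (complexPotential v) = complexPotential v := by
    ext x; simp [complexPotential]
  simp only [inner_add_left, inner_add_right, inner_smul_left, inner_smul_right, inner_translateL2,
    inner_multiply, neg_neg, hv, fourier_one_neg, Complex.conj_conj]
  ring

theorem dualCurrent_isSelfAdjoint (θ : UnitAddCircle) : IsSelfAdjoint (dualCurrent α θ) := by
  rw [ContinuousLinearMap.isSelfAdjoint_iff_isSymmetric]
  intro f g
  change inner ℂ (Complex.I • ((fourier 1 θ : ℂ) • translateL2 (torusPoint α) f -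
    (fourier 1 (-θ) : ℂ) • translateL2 (-torusPoint α) f)) g =
    inner ℂ f (Complex.I • ((fourier 1 θ : ℂ) • translateL2 (torusPoint α) g -
    (fourier 1 (-θ) : ℂ) • translateL2 (-torusPoint α) g))
  simp only [inner_sub_left, inner_sub_right, inner_smul_left, inner_smul_right, inner_translateL2,
    neg_neg, fourier_one_neg, Complex.conj_conj, Complex.conj_I]
  ring

theorem coeFn_dualOperator (θ : UnitAddCircle) (f : TorusL2 d) :
    dualOperator α v θ f =ᵐ[torusMeasure d] fun x => fourier 1 θ * f (x + torusPoint α) +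
      fourier 1 (-θ) * f (x - torusPoint α) + v x * f x := by
  have e : dualOperator α v θ f = (fourier 1 θ : ℂ) • translateL2 (torusPoint α) f +
    (fourier 1 (-θ) : ℂ) • translateL2 (-torusPoint α) f + multiply (complexPotential v) f := rfl
  rw [e]
  filter_upwards [Lp.coeFn_add ((fourier 1 θ : ℂ) • translateL2 (torusPoint α) f +
    (fourier 1 (-θ) : ℂ) • translateL2 (-torusPoint α) f) (multiply (complexPotential v) f),
    Lp.coeFn_add ((fourier 1 θ : ℂ) • translateL2 (torusPoint α) f)
      ((fourier 1 (-θ) : ℂ) • translateL2 (-torusPoint α) f),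
    Lp.coeFn_smul (fourier 1 θ : ℂ) (translateL2 (torusPoint α) f),
    Lp.coeFn_smul (fourier 1 (-θ) : ℂ) (translateL2 (-torusPoint α) f),
    coeFn_translateL2 (torusPoint α) f, coeFn_translateL2 (-torusPoint α) f,
    coeFn_multiply (complexPotential v) f] with x h1 h2 h3 h4 h5 h6 h7
  rw [h1, Pi.add_apply, h2, Pi.add_apply, h3, h4, Pi.smul_apply, Pi.smul_apply, h5, h6, h7,
    smul_eq_mul, smul_eq_mul, sub_eq_add_neg]
  rfl

theorem coeFn_dualCurrent (θ : UnitAddCircle) (f : TorusL2 d) :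
    dualCurrent α θ f =ᵐ[torusMeasure d] fun x => Complex.I *
      (fourier 1 θ * f (x + torusPoint α) - fourier 1 (-θ) * f (x - torusPoint α)) := by
  have e : dualCurrent α θ f = Complex.I • ((fourier 1 θ : ℂ) • translateL2 (torusPoint α) f -
    (fourier 1 (-θ) : ℂ) • translateL2 (-torusPoint α) f) := rfl
  rw [e]
  filter_upwards [Lp.coeFn_smul Complex.I ((fourier 1 θ : ℂ) • translateL2 (torusPoint α) f -
    (fourier 1 (-θ) : ℂ) • translateL2 (-torusPoint α) f),
    Lp.coeFn_sub ((fourier 1 θ : ℂ) • translateL2 (torusPoint α) f)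
      ((fourier 1 (-θ) : ℂ) • translateL2 (-torusPoint α) f),
    Lp.coeFn_smul (fourier 1 θ : ℂ) (translateL2 (torusPoint α) f),
    Lp.coeFn_smul (fourier 1 (-θ) : ℂ) (translateL2 (-torusPoint α) f),
    coeFn_translateL2 (torusPoint α) f, coeFn_translateL2 (-torusPoint α) f] with x h1 h2 h3 h4 h5 h6
  rw [h1, Pi.smul_apply, h2, Pi.sub_apply, h3, h4, Pi.smul_apply, Pi.smul_apply, h5, h6,
    smul_eq_mul, smul_eq_mul, smul_eq_mul, sub_eq_add_neg x]

theorem continuous_dualOperator : Continuous (dualOperator α v) := by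
  unfold dualOperator
  have h1 : Continuous fun θ : UnitAddCircle => (fourier 1 θ : ℂ) := (fourier 1).continuous
  have h2 : Continuous fun θ : UnitAddCircle => (fourier 1 (-θ) : ℂ) := h1.comp continuous_neg
  exact ((h1.smul continuous_const).add (h2.smul continuous_const)).add continuous_const

/-- Conjugation by the character `e_k` shifts the phase of the dual operator by `k · α`. -/
theorem dualOperator_multiply (θ : UnitAddCircle) (k : Fin d → ℤ) (f : TorusL2 d) :
    dualOperator α v θ (multiply (UnitAddTorus.mFourier k) f) =
      multiply (UnitAddTorus.mFourier k) (dualOperator α v (θ + frequency α k) f) := by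
  have hm : ∀ x : QPTorus d, UnitAddTorus.mFourier k (x - torusPoint α) =
      UnitAddTorus.mFourier k x * fourier 1 (-frequency α k) := fun x => by
    have h := mFourier_add_arg k (x - torusPoint α) (torusPoint α)
    rw [sub_add_cancel, mFourier_torusPoint] at h
    rw [h, mul_assoc, fourier_one_mul_neg, mul_one]
  refine Lp.ext ?_
  filter_upwards [coeFn_dualOperator α v θ (multiply (UnitAddTorus.mFourier k) f),
    coeFn_multiply (UnitAddTorus.mFourier k) (dualOperator α v (θ + frequency α k) f),
    coeFn_dualOperator α v (θ + frequency α k) f, coeFn_multiply (UnitAddTorus.mFourier k) f,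
    ae_translate (torusPoint α) (coeFn_multiply (UnitAddTorus.mFourier k) f),
    ae_translate (-torusPoint α) (coeFn_multiply (UnitAddTorus.mFourier k) f)]
    with x h1 h2 h3 h4 h5 h6
  rw [← sub_eq_add_neg] at h6
  rw [h1, h2, h3, h4, h5, h6, mFourier_add_arg, mFourier_torusPoint, hm, neg_add, fourier_one_add,
    fourier_one_add]
  ring

theorem dualCurrent_multiply (θ : UnitAddCircle) (k : Fin d → ℤ) (f : TorusL2 d) :
    dualCurrent α θ (multiply (UnitAddTorus.mFourier k) f) =
      multiply (UnitAddTorus.mFourier k) (dualCurrent α (θ + frequency α k) f) := by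
  have hm : ∀ x : QPTorus d, UnitAddTorus.mFourier k (x - torusPoint α) =
      UnitAddTorus.mFourier k x * fourier 1 (-frequency α k) := fun x => by
    have h := mFourier_add_arg k (x - torusPoint α) (torusPoint α)
    rw [sub_add_cancel, mFourier_torusPoint] at h
    rw [h, mul_assoc, fourier_one_mul_neg, mul_one]
  refine Lp.ext ?_
  filter_upwards [coeFn_dualCurrent α θ (multiply (UnitAddTorus.mFourier k) f),
    coeFn_multiply (UnitAddTorus.mFourier k) (dualCurrent α (θ + frequency α k) f),
    coeFn_dualCurrent α (θ + frequency α k) f,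
    ae_translate (torusPoint α) (coeFn_multiply (UnitAddTorus.mFourier k) f),
    ae_translate (-torusPoint α) (coeFn_multiply (UnitAddTorus.mFourier k) f)]
    with x h1 h2 h3 h5 h6
  rw [← sub_eq_add_neg] at h6
  rw [h1, h2, h3, h5, h6, mFourier_add_arg, mFourier_torusPoint, hm, neg_add, fourier_one_add,
    fourier_one_add]
  ring

theorem inner_multiply_mFourier (k : Fin d → ℤ) (f g : TorusL2 d) :
    inner ℂ (multiply (UnitAddTorus.mFourier k) f) (multiply (UnitAddTorus.mFourier k) g) =
      inner ℂ f g := by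
  rw [inner_multiply]
  congr 1
  refine Lp.ext ?_
  filter_upwards [coeFn_multiply (star (UnitAddTorus.mFourier k))
    (multiply (UnitAddTorus.mFourier k) g), coeFn_multiply (UnitAddTorus.mFourier k) g] with x h1 h2
  rw [h1, h2, ContinuousMap.star_apply, ← mul_assoc]
  have h3 : star (UnitAddTorus.mFourier k x) * UnitAddTorus.mFourier k x = 1 := by
    have h5 : star (UnitAddTorus.mFourier k x) * UnitAddTorus.mFourier k x =
      ((‖UnitAddTorus.mFourier k x‖ ^ 2 : ℝ) : ℂ) := by
      rw [RCLike.star_def, mul_comm, Complex.mul_conj, Complex.normSq_eq_norm_sq]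
    have h6 : ‖UnitAddTorus.mFourier k x‖ = 1 := by
      simp only [UnitAddTorus.mFourier, ContinuousMap.coe_mk, norm_prod, fourier_apply,
        Circle.norm_coe, Finset.prod_const_one]
    rw [h5, h6]; simp
  rw [h3, one_mul]

end TorusOperators

/-! ### Floquet solutions -/

section Floquet

variable {d : ℕ} {α : Fin d → ℝ}

/-- A measurable function multiplied by a unimodular constant under the rotation vanishes unless
the constant is a character value: its modulus is invariant, hence constant, so that it lies in
`L²`. -/
theorem ae_eq_zero_of_translate (hα : RationallyIndependent α) {n : QPTorus d → ℂ}
    (hn : AEStronglyMeasurable n (torusMeasure d)) {c : ℂ} (hc : ‖c‖ = 1)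
    (h : ∀ᵐ x ∂(torusMeasure d), n (x + torusPoint α) = c * n x)
    (hf : ∀ k, c ≠ fourier 1 (frequency α k)) : ∀ᵐ x ∂(torusMeasure d), n x = 0 := by
  obtain ⟨r, hr⟩ := (ergodic_add_torusPoint hα).ae_eq_const_of_ae_eq_comp_ae hn.norm (by
    filter_upwards [h] with x hx
    change ‖n (x + torusPoint α)‖ = ‖n x‖
    rw [hx, norm_mul, hc, one_mul])
  have hm : MemLp n 2 (torusMeasure d) := MemLp.of_bound hn r (by
    filter_upwards [hr] with x hx
    exact le_of_eq hx)
  have h0 := eq_zero_of_translate α (hm.toLp n) c (by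
    filter_upwards [h, hm.coeFn_toLp, ae_translate (torusPoint α) hm.coeFn_toLp] with x h1 h2 h3
    rw [h2, h3, h1]) hf
  have h1 := hm.coeFn_toLp
  rw [h0] at h1
  filter_upwards [h1, Lp.coeFn_zero ℂ 2 (torusMeasure d)] with x h2 h3
  rw [← h2, h3]; rfl

variable (α) (v : C(QPTorus d, ℝ))

/-- The equation `z g(x + α) + z⁻¹ g(x - α) + v(x) g(x) = E g(x)` almost everywhere. -/
def IsFloquetSolution (E : ℝ) (z : ℂ) (g : QPTorus d → ℂ) : Prop :=
  ∀ᵐ x ∂(torusMeasure d),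
    z * g (x + torusPoint α) + z⁻¹ * g (x - torusPoint α) + v x * g x = E * g x

/-- The Wronskian of a solution `p` with multiplier `z` and a solution `g` with multiplier `ζ`. The
factors `ζ⁻¹`, `z⁻¹` account for the quasiperiodic factors `zⁿ`, `ζⁿ` of the solutions
`zⁿ p(x + nα)`, `ζⁿ g(x + nα)` of the eigenvalue equation of `H(x)`. -/
def floquetWronskian (z : ℂ) (p : QPTorus d → ℂ) (ζ : ℂ) (g : QPTorus d → ℂ) (x : QPTorus d) : ℂ :=
  ζ⁻¹ * (p x * g (x - torusPoint α)) - z⁻¹ * (p (x - torusPoint α) * g x)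

variable {v}

theorem floquetWronskian_add {E : ℝ} {z ζ : ℂ} (hz : z ≠ 0) (hζ : ζ ≠ 0) {p g : QPTorus d → ℂ}
    (hp : IsFloquetSolution α v E z p) (hg : IsFloquetSolution α v E ζ g) :
    ∀ᵐ x ∂(torusMeasure d), floquetWronskian α z p ζ g (x + torusPoint α) =
      (ζ⁻¹ * z⁻¹) * floquetWronskian α z p ζ g x := by
  filter_upwards [hp, hg] with x h1 h2
  unfold floquetWronskian
  rw [add_sub_cancel_right]
  have h3 : p (x + torusPoint α) =
      z⁻¹ * (E * p x - v x * p x - z⁻¹ * p (x - torusPoint α)) := by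
    rw [← h1]; field_simp; ring
  have h4 : g (x + torusPoint α) =
      ζ⁻¹ * (E * g x - v x * g x - ζ⁻¹ * g (x - torusPoint α)) := by
    rw [← h2]; field_simp; ring
  rw [h3, h4]
  ring

theorem aestronglyMeasurable_floquetWronskian {z ζ : ℂ} {p g : QPTorus d → ℂ}
    (hp : AEStronglyMeasurable p (torusMeasure d)) (hg : AEStronglyMeasurable g (torusMeasure d)) :
    AEStronglyMeasurable (floquetWronskian α z p ζ g) (torusMeasure d) := by
  have ht : ∀ f : QPTorus d → ℂ, AEStronglyMeasurable f (torusMeasure d) →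
      AEStronglyMeasurable (fun x => f (x - torusPoint α)) (torusMeasure d) := fun f hf => by
    simp only [sub_eq_add_neg]
    exact hf.comp_measurePreserving (measurePreserving_add_torus _)
  exact ((hp.mul (ht g hg)).const_mul _).sub (((ht p hp).mul hg).const_mul _)

/-- The Wronskian of two solutions with the same multiplier `z` is multiplied by `z⁻²` under the
rotation, hence vanishes unless `z⁻²` is a character value. -/
theorem floquetWronskian_eq_zero (hα : RationallyIndependent α) {E : ℝ} {z : ℂ} (hz : ‖z‖ = 1)
    (hf : ∀ k, z⁻¹ * z⁻¹ ≠ fourier 1 (frequency α k)) {p g : QPTorus d → ℂ}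
    (hpm : AEStronglyMeasurable p (torusMeasure d)) (hgm : AEStronglyMeasurable g (torusMeasure d))
    (hp : IsFloquetSolution α v E z p) (hg : IsFloquetSolution α v E z g) :
    ∀ᵐ x ∂(torusMeasure d), floquetWronskian α z p z g x = 0 := by
  have hz0 : z ≠ 0 := by rintro rfl; simp at hz
  exact ae_eq_zero_of_translate hα (aestronglyMeasurable_floquetWronskian α hpm hgm)
    (by simp [hz]) (floquetWronskian_add α hz0 hz0 hp hg) hf

/-- The Wronskian of two solutions with inverse multipliers is invariant under the rotation. -/
theorem exists_floquetWronskian_eq (hα : RationallyIndependent α) {E : ℝ} {z : ℂ} (hz : z ≠ 0)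
    {p g : QPTorus d → ℂ}
    (hpm : AEStronglyMeasurable p (torusMeasure d)) (hgm : AEStronglyMeasurable g (torusMeasure d))
    (hp : IsFloquetSolution α v E z p) (hg : IsFloquetSolution α v E z⁻¹ g) :
    ∃ c, ∀ᵐ x ∂(torusMeasure d), floquetWronskian α z p z⁻¹ g x = c := by
  refine (ergodic_add_torusPoint hα).ae_eq_const_of_ae_eq_comp_ae
    (aestronglyMeasurable_floquetWronskian α hpm hgm) ?_
  filter_upwards [floquetWronskian_add α hz (inv_ne_zero hz) hp hg] with x hx
  change floquetWronskian α z p z⁻¹ g (x + torusPoint α) = _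
  rw [hx, inv_inv, mul_inv_cancel₀ hz, one_mul]

variable (v) in
/-- Two square integrable solutions with inverse multipliers whose Wronskian is unimodular. -/
def HasFloquetPair (E : ℝ) (z : ℂ) : Prop :=
  ∃ p q : QPTorus d → ℂ, MemLp p 2 (torusMeasure d) ∧ MemLp q 2 (torusMeasure d) ∧
    IsFloquetSolution α v E z p ∧ IsFloquetSolution α v E z⁻¹ q ∧
    ∀ᵐ x ∂(torusMeasure d), ‖floquetWronskian α z p z⁻¹ q x‖ = 1

theorem HasFloquetPair.inv {E : ℝ} {z : ℂ} (h : HasFloquetPair α v E z) :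
    HasFloquetPair α v E z⁻¹ := by
  obtain ⟨p, q, hp, hq, hp2, hq2, hw⟩ := h
  refine ⟨q, p, hq, hp, hq2, by rwa [inv_inv], ?_⟩
  filter_upwards [hw] with x hx
  rw [← hx, ← norm_neg]
  congr 1
  unfold floquetWronskian
  simp only [inv_inv]
  ring

/-- The upper entries of the two columns of the inverse of a matrix function conjugating the cocycle
to a diagonal matrix form a Floquet pair; its Wronskian is the determinant of the inverse. -/
theorem hasFloquetPair_of_conjugation {E : ℝ} {ρ : ℝ} {B : QPTorus d → Matrix (Fin 2) (Fin 2) ℂ}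
    (hB : ∀ i j, MemLp (fun x => B x i j) 2 (torusMeasure d))
    (hdet : ∀ᵐ x ∂(torusMeasure d), ‖(B x).det‖ = 1)
    (hc : ∀ᵐ x ∂(torusMeasure d),
      B (x + torusPoint α) * (transferMatrix v E x).map Complex.ofReal * (B x)⁻¹ =
        rotationDiag ρ) :
    HasFloquetPair α v E (fourier 1 (ρ : UnitAddCircle)) := by
  set z : ℂ := fourier 1 (ρ : UnitAddCircle) with hz
  have hz0 : z ≠ 0 := by
    have := norm_fourier_one (ρ : UnitAddCircle)
    rintro h; rw [← hz, h] at this; simp at this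
  have hze : Complex.exp (2 * Real.pi * Complex.I * ρ) = z := by
    rw [hz, fourier_coe_apply]; congr 1; push_cast; ring
  have hze' : Complex.exp (-(2 * Real.pi * Complex.I * ρ)) = z⁻¹ := by
    rw [Complex.exp_neg, hze]
  have hinv : ∀ x, ‖(B x).det‖ = 1 → (B x)⁻¹ = (B x).det⁻¹ • (B x).adjugate := fun x hx => by
    rw [Matrix.inv_def, Ring.inverse_eq_inv]
  have hmem : ∀ i j, MemLp (fun x => (B x)⁻¹ i j) 2 (torusMeasure d) := by
    have hdm : AEStronglyMeasurable (fun x => (B x).det⁻¹) (torusMeasure d) := by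
      have : AEStronglyMeasurable (fun x => (B x).det) (torusMeasure d) := by
        simp only [Matrix.det_fin_two]
        exact ((hB 0 0).1.mul (hB 1 1).1).sub ((hB 0 1).1.mul (hB 1 0).1)
      exact this.aemeasurable.inv.aestronglyMeasurable
    have key : ∀ (i j k l : Fin 2) (s : ℂ), ‖s‖ = 1 →
        (∀ x, ‖(B x).det‖ = 1 → (B x)⁻¹ i j = (B x).det⁻¹ * (s * B x k l)) →
        MemLp (fun x => (B x)⁻¹ i j) 2 (torusMeasure d) := by
      intro i j k l s hs h
      have he : (fun x => (B x).det⁻¹ * (s * B x k l)) =ᵐ[torusMeasure d]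
          fun x => (B x)⁻¹ i j := by
        filter_upwards [hdet] with x hx
        exact (h x hx).symm
      refine (MemLp.ae_eq he) ((hB k l).of_le (hdm.mul ((hB k l).1.const_mul s)) ?_)
      filter_upwards [hdet] with x hx
      rw [norm_mul, norm_mul, norm_inv, hx, hs]; simp
    intro i j
    fin_cases i <;> fin_cases j
    · exact key 0 0 1 1 1 (by simp) fun x hx => by simp [hinv x hx, Matrix.adjugate_fin_two]
    · exact key 0 1 0 1 (-1) (by simp) fun x hx => by simp [hinv x hx, Matrix.adjugate_fin_two]
    · exact key 1 0 1 0 (-1) (by simp) fun x hx => by simp [hinv x hx, Matrix.adjugate_fin_two]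
    · exact key 1 1 0 0 1 (by simp) fun x hx => by simp [hinv x hx, Matrix.adjugate_fin_two]
  have hmain : ∀ᵐ x ∂(torusMeasure d),
      (transferMatrix v E x).map Complex.ofReal * (B x)⁻¹ =
        (B (x + torusPoint α))⁻¹ * rotationDiag ρ := by
    filter_upwards [hc, ae_translate (torusPoint α) hdet] with x h1 h2
    have hu : IsUnit (B (x + torusPoint α)).det := by
      rw [isUnit_iff_ne_zero]; rintro h; rw [h] at h2; simp at h2
    rw [← h1, mul_assoc, ← mul_assoc, Matrix.nonsing_inv_mul _ hu, one_mul]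
  have hent : ∀ᵐ x ∂(torusMeasure d),
      ((E - v x) * (B x)⁻¹ 0 0 - (B x)⁻¹ 1 0 = (B (x + torusPoint α))⁻¹ 0 0 * z ∧
      (E - v x) * (B x)⁻¹ 0 1 - (B x)⁻¹ 1 1 = (B (x + torusPoint α))⁻¹ 0 1 * z⁻¹) ∧
      ((B x)⁻¹ 0 0 = (B (x + torusPoint α))⁻¹ 1 0 * z ∧
      (B x)⁻¹ 0 1 = (B (x + torusPoint α))⁻¹ 1 1 * z⁻¹) := by
    filter_upwards [hmain] with x hx
    have h := fun i j => congrFun (congrFun hx i) j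
    have h00 := h 0 0
    have h01 := h 0 1
    have h10 := h 1 0
    have h11 := h 1 1
    simp only [Matrix.mul_apply, Fin.sum_univ_two, transferMatrix, rotationDiag, hze, hze',
      Matrix.map_apply, Matrix.of_apply, Matrix.cons_val', Matrix.cons_val_zero,
      Matrix.cons_val_one, Matrix.cons_val_fin_one, mul_zero, add_zero, zero_add,
      Complex.ofReal_sub, Complex.ofReal_neg, Complex.ofReal_one, Complex.ofReal_zero, zero_mul,
      one_mul, neg_mul] at h00 h01 h10 h11
    exact ⟨⟨by rw [← h00]; ring, by rw [← h01]; ring⟩, h10, h11⟩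
  -- At the point `x - α` the second row of the identity expresses `p(x - α)` through the second row of
  -- `B(x)⁻¹`.
  have hback := ae_translate (-torusPoint α) hent
  simp only [← sub_eq_add_neg, sub_add_cancel] at hback
  refine ⟨fun x => (B x)⁻¹ 0 0, fun x => (B x)⁻¹ 0 1, hmem 0 0, hmem 0 1, ?_, ?_, ?_⟩
  · filter_upwards [hent, hback] with x h1 h2
    rw [h2.2.1]
    have := h1.1.1
    field_simp
    linear_combination -this
  · filter_upwards [hent, hback] with x h1 h2
    rw [h2.2.2]
    have := h1.1.2
    field_simp at this ⊢
    linear_combination -this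
  · filter_upwards [hback, hdet] with x h2 hd
    have hd2 : ((B x)⁻¹).det = (B x).det⁻¹ := by rw [Matrix.det_nonsing_inv, Ring.inverse_eq_inv]
    have : floquetWronskian α z (fun x => (B x)⁻¹ 0 0) z⁻¹ (fun x => (B x)⁻¹ 0 1) x =
        ((B x)⁻¹).det := by
      simp only [floquetWronskian, h2.2.1, h2.2.2, Matrix.det_fin_two]
      field_simp
    rw [this, hd2, norm_inv, hd, inv_one]

variable {α}

theorem isFloquetSolution_of_eigenvector {E : ℝ} {θ : UnitAddCircle} {g : TorusL2 d}
    (h : dualOperator α v θ g = (E : ℂ) • g) : IsFloquetSolution α v E (fourier 1 θ) g := by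
  have h1 := coeFn_dualOperator α v θ g
  rw [h] at h1
  have h0 : (fourier 1 θ : ℂ)⁻¹ = fourier 1 (-θ) :=
    inv_eq_of_mul_eq_one_right (fourier_one_mul_neg θ)
  filter_upwards [h1, Lp.coeFn_smul (E : ℂ) g] with x h2 h3
  rw [h0, ← h2, h3]; rfl

/-- At a nonresonant phase the eigenspace of the dual operator spanned by a Floquet solution is
one-dimensional, and its current does not vanish: up to the factor `i`, the current is the constant
Wronskian of the solution and its conjugate. -/
theorem exists_dual_eigenvector (hα : RationallyIndependent α) {E : ℝ} {θ : UnitAddCircle}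
    (h : HasFloquetPair α v E (fourier 1 θ)) (hθ : ∀ k, θ + θ ≠ frequency α k) :
    ∃ f : TorusL2 d, ‖f‖ = 1 ∧ dualOperator α v θ f = (E : ℂ) • f ∧
      inner ℂ f (dualCurrent α θ f) ≠ 0 ∧
      ∀ g, dualOperator α v θ g = (E : ℂ) • g → ∃ c : ℂ, g = c • f := by
  obtain ⟨p, q, hp, hq, hp2, hq2, hw⟩ := h
  set z : ℂ := fourier 1 θ with hz
  have hz1 : ‖z‖ = 1 := norm_fourier_one θ
  have hz0 : z ≠ 0 := by rintro h; rw [h] at hz1; simp at hz1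
  have hzi : z⁻¹ = fourier 1 (-θ) :=
    inv_eq_of_mul_eq_one_right (fourier_one_mul_neg θ)
  have hzc : starRingEnd ℂ z = z⁻¹ := by rw [hzi, fourier_one_neg]
  have hnr : ∀ k, z⁻¹ * z⁻¹ ≠ fourier 1 (frequency α k) := fun k hk => by
    rw [hzi, ← fourier_one_add] at hk
    have := fourier_one_injective hk
    refine hθ (-k) ?_
    rw [frequency_neg, ← this]; abel
  have hnr' : ∀ k, (z⁻¹)⁻¹ * (z⁻¹)⁻¹ ≠ fourier 1 (frequency α k) := fun k hk => by
    rw [inv_inv, hz, ← fourier_one_add] at hk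
    exact hθ k (fourier_one_injective hk)
  obtain ⟨w, hwc⟩ := exists_floquetWronskian_eq α hα hz0 hp.1 hq.1 hp2 hq2
  have hw0 : w ≠ 0 := by
    obtain ⟨x, h1, h2⟩ := (hw.and hwc).exists
    rintro rfl; rw [h2] at h1; simp at h1
  -- expansion of a solution in terms of the two basic solutions
  have hexp : ∀ (ζ : ℂ) (g : QPTorus d → ℂ), ∀ᵐ x ∂(torusMeasure d), g x * w =
      q x * floquetWronskian α z p ζ g x - p x * floquetWronskian α z⁻¹ q ζ g x := by
    intro ζ g
    filter_upwards [hwc] with x hx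
    rw [← hx]
    unfold floquetWronskian
    rw [inv_inv]; ring
  let F : TorusL2 d := hp.toLp p
  have hF : F =ᵐ[torusMeasure d] p := hp.coeFn_toLp
  have hF0 : F ≠ 0 := by
    intro h0
    have h1 : ∀ᵐ x ∂(torusMeasure d), p x = 0 := by
      rw [h0] at hF
      filter_upwards [hF, Lp.coeFn_zero ℂ 2 (torusMeasure d)] with x h1 h2
      rw [← h1, h2]; rfl
    have h2 := ae_translate (-torusPoint α) h1
    obtain ⟨x, h3, h4, h5⟩ := (h1.and (h2.and hwc)).exists
    rw [← sub_eq_add_neg] at h4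
    unfold floquetWronskian at h5
    rw [h3, h4] at h5
    exact hw0 (by rw [← h5]; simp)
  have hFe : dualOperator α v θ F = (E : ℂ) • F := by
    refine Lp.ext ?_
    filter_upwards [coeFn_dualOperator α v θ F, Lp.coeFn_smul (E : ℂ) F, hF,
      ae_translate (torusPoint α) hF, ae_translate (-torusPoint α) hF, hp2] with x h1 h2 h3 h4 h5 h6
    rw [← sub_eq_add_neg] at h5
    rw [h1, h2, Pi.smul_apply, h3, h4, h5, ← hzi, smul_eq_mul, ← h6]
  have huniq : ∀ g, dualOperator α v θ g = (E : ℂ) • g → ∃ c : ℂ, g = c • F := by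
    intro g hg
    have hgs := isFloquetSolution_of_eigenvector hg
    have hgm : AEStronglyMeasurable g (torusMeasure d) := Lp.aestronglyMeasurable g
    have hzero := floquetWronskian_eq_zero α hα hz1 hnr hp.1 hgm hp2 hgs
    obtain ⟨c, hc⟩ := exists_floquetWronskian_eq α hα (inv_ne_zero hz0) hq.1 hgm hq2
      (by rwa [inv_inv])
    rw [inv_inv] at hc
    refine ⟨-c / w, Lp.ext ?_⟩
    filter_upwards [hexp z g, hzero, hc, Lp.coeFn_smul (-c / w) F, hF] with x h1 h2 h3 h4 h5
    rw [h4, Pi.smul_apply, h5, smul_eq_mul, ← mul_right_inj' hw0, mul_comm w, h1, h2, h3]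
    field_simp; ring
  have hcurrent : inner ℂ F (dualCurrent α θ F) ≠ 0 := by
    let pc : QPTorus d → ℂ := fun x => starRingEnd ℂ (p x)
    have hpcm : AEStronglyMeasurable pc (torusMeasure d) :=
      Complex.continuous_conj.comp_aestronglyMeasurable hp.1
    -- The complex conjugate of a solution is a solution with the inverse multiplier, so that its
    -- Wronskian with `p` is a constant `c`; if `c` vanished, so would `p`.
    have hpc : IsFloquetSolution α v E z⁻¹ pc := by
      filter_upwards [hp2] with x hx
      have := congrArg (starRingEnd ℂ) hx
      simp only [map_add, map_mul, map_inv₀, hzc, Complex.conj_ofReal] at this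
      exact this
    have hzero := floquetWronskian_eq_zero α hα (by rw [norm_inv, hz1, inv_one]) hnr' hq.1 hpcm
      hq2 hpc
    obtain ⟨c, hc⟩ := exists_floquetWronskian_eq α hα hz0 hp.1 hpcm hp2 hpc
    have hc0 : c ≠ 0 := by
      rintro rfl
      have h0 : ∀ᵐ x ∂(torusMeasure d), p x = 0 := by
        filter_upwards [hexp z⁻¹ pc, hzero, hc] with x h1 h2 h3
        rw [h2, h3, mul_zero, mul_zero, sub_zero, mul_eq_zero, or_iff_left hw0] at h1
        exact (map_eq_zero _).1 h1
      refine hF0 (Lp.ext ?_)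
      filter_upwards [hF, h0, Lp.coeFn_zero ℂ 2 (torusMeasure d)] with x h1 h2 h3
      rw [h1, h2, h3]; rfl
    have hint1 : Integrable (fun x => p x * pc (x - torusPoint α)) (torusMeasure d) := by
      have hpc2 : MemLp pc 2 (torusMeasure d) := hp.of_le hpcm (by simp [pc])
      have := (hpc2.comp_measurePreserving (measurePreserving_add_torus (-torusPoint α)))
      refine (hp.integrable_mul this).congr (Eventually.of_forall fun x => ?_)
      simp [Function.comp, sub_eq_add_neg]
    have hint2 : Integrable (fun x => p (x - torusPoint α) * pc x) (torusMeasure d) := by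
      have hpc2 : MemLp pc 2 (torusMeasure d) := hp.of_le hpcm (by simp [pc])
      have := (hp.comp_measurePreserving (measurePreserving_add_torus (-torusPoint α)))
      refine (this.integrable_mul hpc2).congr (Eventually.of_forall fun x => ?_)
      simp [Function.comp, sub_eq_add_neg]
    have hint3 : Integrable (fun x => p (x + torusPoint α) * pc x) (torusMeasure d) := by
      have := (measurePreserving_add_torus (torusPoint α)).integrable_comp_of_integrable hint1
      refine this.congr (Eventually.of_forall fun x => ?_)
      simp [Function.comp]
    have h1 : inner ℂ F (dualCurrent α θ F) = Complex.I *
        (z * ∫ x, p (x + torusPoint α) * pc x ∂(torusMeasure d) -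
          z⁻¹ * ∫ x, p (x - torusPoint α) * pc x ∂(torusMeasure d)) := by
      rw [L2.inner_def, ← integral_const_mul, ← integral_const_mul,
        ← integral_sub (hint3.const_mul _) (hint2.const_mul _), ← integral_const_mul]
      refine integral_congr_ae ?_
      filter_upwards [coeFn_dualCurrent α θ F, hF,
        ae_translate (torusPoint α) hF, ae_translate (-torusPoint α) hF] with x h1 h2 h3 h4
      rw [← sub_eq_add_neg] at h4
      rw [RCLike.inner_apply, h1, h2, h3, h4, ← hzi]
      ring
    have h2 : ∫ x, p (x + torusPoint α) * pc x ∂(torusMeasure d) =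
        ∫ x, p x * pc (x - torusPoint α) ∂(torusMeasure d) := by
      rw [← integral_add_right_eq_self (fun x => p x * pc (x - torusPoint α)) (torusPoint α)]
      simp
    rw [h1, h2, ← integral_const_mul, ← integral_const_mul,
      ← integral_sub (hint1.const_mul _) (hint2.const_mul _)]
    have h3 : ∫ x, (z * (p x * pc (x - torusPoint α)) - z⁻¹ * (p (x - torusPoint α) * pc x))
        ∂(torusMeasure d) = c := by
      rw [integral_congr_ae (g := fun _ => c)]
      · simp
      · filter_upwards [hc] with x hx
        rw [← hx]
        unfold floquetWronskian
        rw [inv_inv]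
    rw [h3]
    exact mul_ne_zero Complex.I_ne_zero hc0
  have hn0 : (‖F‖ : ℂ) ≠ 0 := by exact_mod_cast norm_ne_zero_iff.2 hF0
  refine ⟨(‖F‖ : ℂ)⁻¹ • F, ?_, ?_, ?_, ?_⟩
  · rw [norm_smul, norm_inv, Complex.norm_real, norm_norm, inv_mul_cancel₀]
    exact norm_ne_zero_iff.2 hF0
  · rw [map_smul, hFe, smul_comm]
  · rw [map_smul, inner_smul_left, inner_smul_right]
    exact mul_ne_zero ((map_ne_zero _).2 (inv_ne_zero hn0)) (mul_ne_zero (inv_ne_zero hn0) hcurrent)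
  · intro g hg
    obtain ⟨c, hc⟩ := huniq g hg
    exact ⟨c * ‖F‖, by rw [smul_smul, mul_assoc, mul_inv_cancel₀ hn0, mul_one]; exact hc⟩

end Floquet

/-! ### Completeness of the dual eigenvectors -/

/-- An orthonormal family is total as soon as Bessel's inequality is an equality on a total
family. -/
theorem span_eq_top_of_le_tsum {E : Type*} [NormedAddCommGroup E] [InnerProductSpace ℂ E]
    [CompleteSpace E] {ι κ : Type*} {b : ι → E} (hb : Orthonormal ℂ b) {w : κ → E}
    (hw : ∀ m, ENNReal.ofReal (‖w m‖ ^ 2) ≤ ∑' k, ENNReal.ofReal (‖inner ℂ (b k) (w m)‖ ^ 2))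
    (hs : (Submodule.span ℂ (Set.range w)).topologicalClosure = ⊤) :
    (Submodule.span ℂ (Set.range b)).topologicalClosure = ⊤ := by
  rw [Submodule.topologicalClosure_eq_top_iff, Submodule.eq_bot_iff] at hs ⊢
  intro u hu
  rw [Submodule.mem_orthogonal] at hu
  by_contra hu0
  have hub : ∀ k, inner ℂ (b k) u = 0 := fun k => hu _ (Submodule.subset_span ⟨k, rfl⟩)
  have hun : (‖u‖ : ℂ) ≠ 0 := by exact_mod_cast norm_ne_zero_iff.2 hu0
  let b' : Option ι → E := fun o => o.elim ((‖u‖ : ℂ)⁻¹ • u) b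
  have hb' : Orthonormal ℂ b' := by
    refine ⟨?_, ?_⟩
    · rintro (_ | k)
      · simp only [b', Option.elim_none, norm_smul, norm_inv, Complex.norm_real, norm_norm]
        exact inv_mul_cancel₀ (norm_ne_zero_iff.2 hu0)
      · exact hb.1 k
    · rintro (_ | k) (_ | l) hkl
      · exact absurd rfl hkl
      · simp only [b', Option.elim_none, Option.elim_some, inner_smul_left]
        rw [← inner_conj_symm, hub, map_zero, mul_zero]
      · simp only [b', Option.elim_none, Option.elim_some, inner_smul_right]
        rw [hub, mul_zero]
      · exact hb.2 fun h => hkl (congrArg some h)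
  apply hu0
  refine hs u ?_
  have hwu : ∀ m, inner ℂ u (w m) = 0 := by
    intro m
    have h1 : ∀ s : Finset ι, ENNReal.ofReal (‖inner ℂ (b' none) (w m)‖ ^ 2) +
        ∑ k ∈ s, ENNReal.ofReal (‖inner ℂ (b k) (w m)‖ ^ 2) ≤ ENNReal.ofReal (‖w m‖ ^ 2) := by
      intro s
      have h2 := hb'.sum_inner_products_le (w m) (s := Finset.insertNone s)
      rw [Finset.sum_insertNone] at h2
      rw [← ENNReal.ofReal_sum_of_nonneg fun _ _ => by positivity,
        ← ENNReal.ofReal_add (by positivity) (Finset.sum_nonneg fun _ _ => by positivity)]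
      exact ENNReal.ofReal_le_ofReal h2
    have h3 : ENNReal.ofReal (‖inner ℂ (b' none) (w m)‖ ^ 2) +
        ∑' k, ENNReal.ofReal (‖inner ℂ (b k) (w m)‖ ^ 2) ≤ ENNReal.ofReal (‖w m‖ ^ 2) := by
      rw [ENNReal.tsum_eq_iSup_sum, ENNReal.add_iSup]
      exact iSup_le h1
    have h4 : ENNReal.ofReal (‖inner ℂ (b' none) (w m)‖ ^ 2) + ENNReal.ofReal (‖w m‖ ^ 2) ≤
        0 + ENNReal.ofReal (‖w m‖ ^ 2) := by
      rw [zero_add]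
      exact (add_le_add_right (hw m) _).trans h3
    have h5 := (ENNReal.add_le_add_iff_right ENNReal.ofReal_ne_top).1 h4
    rw [nonpos_iff_eq_zero, ENNReal.ofReal_eq_zero] at h5
    have h6 : inner ℂ (b' none) (w m) = 0 := by
      rw [← norm_eq_zero]
      exact pow_eq_zero_iff two_ne_zero |>.1 (le_antisymm h5 (by positivity))
    simp only [b', Option.elim_none, inner_smul_left] at h6
    exact (mul_eq_zero.1 h6).resolve_left ((map_ne_zero _).2 (inv_ne_zero hun))
  rw [Submodule.mem_orthogonal]
  intro x hx
  induction hx using Submodule.span_induction with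
  | mem x hx =>
    obtain ⟨m, rfl⟩ := hx
    rw [← inner_conj_symm, hwu, map_zero]
  | zero => simp
  | add x y _ _ h1 h2 => rw [inner_add_left, h1, h2, add_zero]
  | smul c x _ h1 => rw [inner_smul_left, h1, mul_zero]

section Completeness

variable {d : ℕ} {α : Fin d → ℝ} (v : C(QPTorus d, ℝ))

instance haarAddCircle.nullSingletonClass :
    NullSingletonClass (AddCircle.haarAddCircle : Measure UnitAddCircle) := by
  constructor
  intro x
  have h1 : (volume : Measure UnitAddCircle) = AddCircle.haarAddCircle := by
    rw [AddCircle.volume_eq_smul_haarAddCircle]; simp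
  rw [← Metric.closedBall_zero, ← h1, AddCircle.volume_closedBall]
  simp

theorem ae_nonresonant (α : Fin d → ℝ) :
    ∀ᵐ θ ∂(AddCircle.haarAddCircle : Measure UnitAddCircle), ∀ k, θ + θ ≠ frequency α k := by
  rw [ae_all_iff]
  intro k
  obtain ⟨c, hc⟩ := QuotientAddGroup.mk_surjective (frequency α k)
  have hsub : {θ : UnitAddCircle | ¬ θ + θ ≠ frequency α k} ⊆
      Set.range fun n : ℤ => (((c + n) / 2 : ℝ) : UnitAddCircle) := by
    intro θ hθ
    obtain ⟨x, rfl⟩ := QuotientAddGroup.mk_surjective θ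
    have h1 : ((x + x - c : ℝ) : UnitAddCircle) = 0 := by
      have h2 : ((x : ℝ) : UnitAddCircle) + (x : UnitAddCircle) = frequency α k := not_not.1 hθ
      have h3 : ((c : ℝ) : UnitAddCircle) = frequency α k := hc
      rw [AddCircle.coe_sub, AddCircle.coe_add, h2, h3, sub_self]
    obtain ⟨n, hn⟩ := AddCircle.coe_eq_zero_iff (p := (1 : ℝ)) |>.1 h1
    refine ⟨n, ?_⟩
    have h4 : (c + n) / 2 = x := by
      have : (n : ℝ) = x + x - c := by simpa using hn
      rw [this]; ring
    simp only [h4]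
  exact ((Set.countable_range _).mono hsub).measure_zero _

/-- A phase with a Floquet pair, without resonance, at which the integrated density of states
determines `‖θ‖`. -/
def IsRegularPhase (α : Fin d → ℝ) (e : UnitAddCircle → ℝ) (θ : UnitAddCircle) : Prop :=
  HasFloquetPair α v (e θ) (fourier 1 θ) ∧ (∀ k, θ + θ ≠ frequency α k) ∧
    (densityOfStates α v (Set.Ioi (e θ))).toReal = 2 * ‖θ‖

theorem exists_ae_isRegularPhase (hα : RationallyIndependent α)
    (hred : IsL2DegreeZeroReducible α v) :
    ∃ e : UnitAddCircle → ℝ,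
      MeasurePreserving e AddCircle.haarAddCircle (densityOfStates α v) ∧
      ∀ᵐ θ ∂(AddCircle.haarAddCircle : Measure UnitAddCircle), IsRegularPhase v α e θ := by
  obtain ⟨e, he, h1, h2⟩ := exists_dual_energy v hα
  refine ⟨e, he, ?_⟩
  filter_upwards [h1, h2, he.quasiMeasurePreserving.ae hred, ae_nonresonant α] with θ h3 h4 h5 h6
  refine ⟨?_, h6, h3⟩
  obtain ⟨B, hB, hdet, hc⟩ := h5
  rw [h4] at hc
  have h7 := hasFloquetPair_of_conjugation α hB hdet hc
  rcases coe_norm_unitAddCircle θ with h8 | h8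
  · rwa [h8] at h7
  · rw [h8] at h7
    have h9 := h7.inv
    rwa [inv_eq_of_mul_eq_one_left (fourier_one_mul_neg θ)] at h9

/-- `N(·, ∞)` takes the value `2‖θ + k·α‖` at the energy with index `k`, and for a nonresonant `θ` the
phases `θ + k·α` do not coincide up to sign. -/
theorem IsRegularPhase.injective (hα : RationallyIndependent α) {e : UnitAddCircle → ℝ}
    {θ : UnitAddCircle} (h : ∀ k, IsRegularPhase v α e (θ + frequency α k)) :
    Function.Injective fun k => e (θ + frequency α k) := by
  intro k l hkl
  have h1 : ‖θ + frequency α k‖ = ‖θ + frequency α l‖ := by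
    have h2 := (h k).2.2
    have h3 := (h l).2.2
    simp only at hkl
    rw [hkl, h3] at h2
    linarith
  have hθ : ∀ k, θ + θ ≠ frequency α k := fun k hk => by
    refine (h 0).2.1 k ?_
    have : frequency α (0 : Fin d → ℤ) = 0 := by simp [frequency]
    rw [this, add_zero, hk]
  have h4 : θ + frequency α k = θ + frequency α l ∨
      θ + frequency α k = -(θ + frequency α l) := by
    have h5 := coe_norm_unitAddCircle (θ + frequency α k)
    have h6 := coe_norm_unitAddCircle (θ + frequency α l)
    rw [← h1] at h6
    rcases h5 with h5 | h5 <;> rcases h6 with h6 | h6 <;> rw [h5] at h6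
    · exact Or.inl h6
    · exact Or.inr h6
    · right; rw [← h6, neg_neg]
    · left; exact neg_injective h6
  rcases h4 with h4 | h4
  · have h5 : frequency α (k - l) = 0 := by rw [frequency_sub, add_left_cancel h4, sub_self]
    exact sub_eq_zero.1 (hα.frequency_eq_zero h5)
  · exfalso
    refine hθ (-(k + l)) ?_
    rw [frequency_neg, frequency_add]
    rw [eq_neg_iff_add_eq_zero] at h4 ⊢
    rw [← h4]; abel

theorem multiply_torusBasis (k m : Fin d → ℤ) :
    multiply (UnitAddTorus.mFourier k) (torusBasis d (m - k)) = torusBasis d m := by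
  refine Lp.ext ?_
  filter_upwards [coeFn_multiply (UnitAddTorus.mFourier k) (torusBasis d (m - k)),
    coeFn_torusBasis (m - k), coeFn_torusBasis m] with x h1 h2 h3
  rw [h1, h2, h3, ← UnitAddTorus.mFourier_add, add_sub_cancel]

theorem starProjection_ker_eq {E : Type*} [NormedAddCommGroup E] [InnerProductSpace ℂ E]
    [CompleteSpace E] {T : E →L[ℂ] E} {g : E} (hg : ‖g‖ = 1) (hT : T g = 0)
    (hu : ∀ w, T w = 0 → ∃ c : ℂ, w = c • g) (u : E) :
    T.ker.starProjection u = inner ℂ g u • g := by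
  refine Submodule.eq_starProjection_of_mem_of_inner_eq_zero (T.ker.smul_mem _ hT) ?_
  intro w hw
  obtain ⟨c, rfl⟩ := hu w hw
  rw [inner_smul_right, inner_sub_left, inner_smul_left, inner_self_eq_norm_sq_to_K, hg,
    inner_conj_symm]
  simp

/-- At almost every phase, the products of the eigenvectors `f_{θ + k·α}` with characters form an
orthonormal basis of eigenvectors of `h(θ)` with simple eigenvalues and nonzero currents. -/
theorem ae_exists_injective_limit_dual (hα : RationallyIndependent α)
    (hred : IsL2DegreeZeroReducible α v) :
    ∀ᵐ θ ∂(AddCircle.haarAddCircle : Measure UnitAddCircle),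
      ∃ Q : TorusL2 d →L[ℂ] TorusL2 d, ‖Q‖ ≤ ‖dualCurrent α θ‖ ∧
        (∀ u, Tendsto (fun T => timeAverage (dualOperator α v θ) (dualCurrent α θ) T u) atTop
          (𝓝 (Q u))) ∧ ∀ u, Q u = 0 → u = 0 := by
  obtain ⟨e, he, hreg⟩ := exists_ae_isRegularPhase v hα hred
  choose! g hg1 hge hgc hgu using fun (θ : UnitAddCircle) (h : IsRegularPhase v α e θ) =>
    exists_dual_eigenvector hα h.1 h.2.1
  have hreg' : ∀ᵐ θ ∂(AddCircle.haarAddCircle : Measure UnitAddCircle),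
      ∀ k, IsRegularPhase v α e (θ + frequency α k) := by
    rw [ae_all_iff]
    intro k
    exact (measurePreserving_add_right AddCircle.haarAddCircle
      (frequency α k)).quasiMeasurePreserving.ae hreg
  -- the squared Fourier coefficients of the eigenvectors are measurable functions of the phase
  let φ : (Fin d → ℤ) → UnitAddCircle → ℝ≥0∞ := fun m θ =>
    ENNReal.ofReal (‖inner ℂ (g θ) (torusBasis d m)‖ ^ 2)
  have hφ : ∀ m, AEMeasurable (φ m) AddCircle.haarAddCircle := by
    intro m
    set M := ‖multiply (complexPotential v)‖
    set R : ℝ := 2 + M + (2 + ‖v‖) + 1 with hR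
    have hR0 : 0 < R := by positivity
    let T : UnitAddCircle → TorusL2 d →L[ℂ] TorusL2 d := fun θ =>
      dualOperator α v θ - (e θ : ℂ) • 1
    have hTm : StronglyMeasurable T := by
      refine (continuous_dualOperator α v).stronglyMeasurable.sub ?_
      have : StronglyMeasurable fun θ => (e θ : ℂ) :=
        (Complex.measurable_ofReal.comp he.measurable).stronglyMeasurable
      exact this.smul_const _
    have hkm : ∀ n, StronglyMeasurable fun θ => kernelMean (T θ) R n (torusBasis d m) := by
      intro n
      have : Continuous fun S : TorusL2 d →L[ℂ] TorusL2 d => kernelMean S R n (torusBasis d m) := by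
        refine Continuous.clm_apply ?_ continuous_const
        unfold kernelMean
        fun_prop
      exact this.comp_stronglyMeasurable hTm
    refine aemeasurable_of_tendsto_metrizable_ae atTop
      (f := fun n θ => ENNReal.ofReal (‖kernelMean (T θ) R n (torusBasis d m)‖ ^ 2))
      (fun n => (ENNReal.measurable_ofReal.comp
        ((hkm n).norm.measurable.pow_const 2)).aemeasurable) ?_
    filter_upwards [hreg, he.quasiMeasurePreserving.ae (ae_densityOfStates_mem_Icc α v)]
      with θ h1 h2
    have hTsa : IsSelfAdjoint (T θ) := by
      refine (dualOperator_isSelfAdjoint α v θ).sub ?_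
      rw [IsSelfAdjoint, star_smul]; simp
    have hTR : ‖T θ‖ ≤ R := by
      refine (norm_sub_le _ _).trans ?_
      have h3 : ‖(e θ : ℂ) • (1 : TorusL2 d →L[ℂ] TorusL2 d)‖ ≤ |e θ| := by
        rw [norm_smul, Complex.norm_real, Real.norm_eq_abs]
        calc _ ≤ |e θ| * 1 := by gcongr; exact ContinuousLinearMap.norm_id_le
          _ = _ := mul_one _
      linarith [norm_dualOperator_le α v θ, abs_le.2 h2]
    have hlim := tendsto_kernelMean hTsa hR0 hTR (torusBasis d m)
    have hker : ∀ w, T θ w = 0 ↔ dualOperator α v θ w = (e θ : ℂ) • w := fun w => by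
      change dualOperator α v θ w - (e θ : ℂ) • w = 0 ↔ _
      rw [sub_eq_zero]
    rw [starProjection_ker_eq (hg1 θ h1) ((hker _).2 (hge θ h1))
      fun w hw => hgu θ h1 w ((hker w).1 hw)] at hlim
    have h4 := hlim.norm.pow 2
    rw [norm_smul, hg1 θ h1, mul_one] at h4
    exact (ENNReal.continuous_ofReal.tendsto _).comp h4
  -- the eigenvectors of `h(θ)` obtained from those of `h(θ + k·α)` by multiplication with characters
  let b : UnitAddCircle → (Fin d → ℤ) → TorusL2 d := fun θ k =>
    multiply (UnitAddTorus.mFourier k) (g (θ + frequency α k))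
  have hinner : ∀ θ k m, ENNReal.ofReal (‖inner ℂ (b θ k) (torusBasis d m)‖ ^ 2) =
      φ (m - k) (θ + frequency α k) := by
    intro θ k m
    simp only [b, φ]
    rw [← multiply_torusBasis k m, inner_multiply_mFourier]
  have hbe : ∀ θ, (∀ k, IsRegularPhase v α e (θ + frequency α k)) → ∀ k,
      dualOperator α v θ (b θ k) = (e (θ + frequency α k) : ℂ) • b θ k := by
    intro θ h k
    simp only [b]
    rw [dualOperator_multiply, hge _ (h k), map_smul]
  have hbo : ∀ θ, (∀ k, IsRegularPhase v α e (θ + frequency α k)) → Orthonormal ℂ (b θ) := by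
    intro θ h
    refine ⟨fun k => ?_, fun k l hkl => ?_⟩
    · have h2 : ‖b θ k‖ ^ 2 = 1 := by
        rw [← inner_self_eq_norm_sq (𝕜 := ℂ), inner_multiply_mFourier, inner_self_eq_norm_sq,
          hg1 _ (h k), one_pow]
      exact (pow_eq_one_iff_of_nonneg (norm_nonneg _) two_ne_zero).1 h2
    · exact inner_eq_zero_of_eigenvalue_ne (dualOperator_isSelfAdjoint α v θ) (hbe θ h k)
        (hbe θ h l) fun h' => hkl (IsRegularPhase.injective v hα h h')
  have hφm : ∀ m k, AEMeasurable (fun θ => φ (m - k) (θ + frequency α k))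
      AddCircle.haarAddCircle := fun m k =>
    (hφ (m - k)).comp_quasiMeasurePreserving
      (measurePreserving_add_right AddCircle.haarAddCircle (frequency α k)).quasiMeasurePreserving
  have hpars : ∀ θ, IsRegularPhase v α e θ → ∑' m, φ m θ = 1 := by
    intro θ h
    have h1 := Complex.hasSum_re ((torusBasis d).hasSum_inner_mul_inner (g θ) (g θ))
    have h2 : ∀ m, (inner ℂ (g θ) (torusBasis d m) * inner ℂ (torusBasis d m) (g θ)).re =
        ‖inner ℂ (g θ) (torusBasis d m)‖ ^ 2 := fun m => by
      rw [← inner_conj_symm (torusBasis d m), Complex.mul_conj, Complex.normSq_eq_norm_sq,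
        Complex.ofReal_re]
    simp only [h2] at h1
    rw [inner_self_eq_norm_sq_to_K, hg1 θ h] at h1
    simp only [φ]
    rw [← ENNReal.ofReal_tsum_of_nonneg (fun _ => by positivity) h1.summable, h1.tsum_eq]
    simp
  -- By translation invariance the mean over `θ` of the Bessel sums at `e_m` is the mean of
  -- `‖f_θ‖² = 1`.
  have htot : ∀ m, ∫⁻ θ, ∑' k, φ (m - k) (θ + frequency α k) ∂AddCircle.haarAddCircle = 1 := by
    intro m
    rw [lintegral_tsum (hφm m)]
    have h1 : ∀ k, ∫⁻ θ, φ (m - k) (θ + frequency α k) ∂AddCircle.haarAddCircle =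
        ∫⁻ θ, φ (m - k) θ ∂AddCircle.haarAddCircle := fun k =>
      lintegral_add_right_eq_self _ _
    simp only [h1]
    rw [show ∑' k, ∫⁻ θ, φ (m - k) θ ∂AddCircle.haarAddCircle =
        ∑' k, ∫⁻ θ, φ k θ ∂AddCircle.haarAddCircle from
        (Equiv.subLeft m).tsum_eq (fun k => ∫⁻ θ, φ k θ ∂AddCircle.haarAddCircle),
      ← lintegral_tsum hφ, lintegral_congr_ae (g := fun _ => 1) (hreg.mono hpars)]
    simp
  -- The Bessel sums are at most `1` and have mean `1`, so they are equal to `1` almost everywhere.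
  have hcomp : ∀ᵐ θ ∂(AddCircle.haarAddCircle : Measure UnitAddCircle), ∀ m,
      1 ≤ ∑' k, φ (m - k) (θ + frequency α k) := by
    rw [ae_all_iff]
    intro m
    have hle : ∀ᵐ θ ∂(AddCircle.haarAddCircle : Measure UnitAddCircle),
        ∑' k, φ (m - k) (θ + frequency α k) ≤ 1 := by
      filter_upwards [hreg'] with θ h
      rw [ENNReal.tsum_eq_iSup_sum]
      refine iSup_le fun s => ?_
      simp only [← hinner]
      rw [← ENNReal.ofReal_sum_of_nonneg fun _ _ => by positivity, ENNReal.ofReal_le_one]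
      refine ((hbo θ h).sum_inner_products_le _).trans ?_
      rw [(torusBasis d).orthonormal.1 m, one_pow]
    have h1 := ae_eq_of_ae_le_of_lintegral_le hle (by rw [htot]; simp) aemeasurable_const
      (by rw [htot]; simp)
    filter_upwards [h1] with θ h2
    exact le_of_eq h2.symm
  filter_upwards [hreg', hcomp] with θ h1 h2
  refine exists_injective_limit_timeAverage (dualOperator_isSelfAdjoint α v θ)
    (dualCurrent_isSelfAdjoint α θ) (b θ) (fun k => e (θ + frequency α k)) (hbe θ h1)
    (IsRegularPhase.injective v hα h1) ?_ ?_
  · refine span_eq_top_of_le_tsum (hbo θ h1) (w := torusBasis d) (fun m => ?_)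
      (torusBasis d).dense_span
    simp only [hinner]
    rw [(torusBasis d).orthonormal.1 m]
    simpa using h2 m
  · intro k
    simp only [b]
    rw [dualCurrent_multiply, inner_multiply_mFourier]
    exact hgc _ (h1 k)

end Completeness

/-! ### Dual pairs of vector fields -/

section Parseval

theorem lintegral_enorm_sq {X E : Type*} [MeasurableSpace X] [NormedAddCommGroup E]
    (μ : Measure X) (f : X → E) : ∫⁻ x, ‖f x‖ₑ ^ 2 ∂μ = eLpNorm f 2 μ ^ 2 := by
  rw [eLpNorm_eq_lintegral_rpow_enorm_toReal two_ne_zero ENNReal.ofNat_ne_top, ← ENNReal.rpow_two,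
    ← ENNReal.rpow_mul]
  simp

theorem enorm_sq_eq_ofReal {E : Type*} [NormedAddCommGroup E] (y : E) :
    ‖y‖ₑ ^ 2 = ENNReal.ofReal (‖y‖ ^ 2) := by
  rw [← ofReal_norm, ENNReal.ofReal_pow (norm_nonneg _)]

theorem HilbertBasis.tsum_enorm_sq {ι E : Type*} [NormedAddCommGroup E] [InnerProductSpace ℂ E]
    (b : HilbertBasis ι ℂ E) (x : E) : ∑' i, ‖inner ℂ (b i) x‖ₑ ^ 2 = ‖x‖ₑ ^ 2 := by
  have h1 := Complex.hasSum_re (b.hasSum_inner_mul_inner x x)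
  have h2 : ∀ i, (inner ℂ x (b i) * inner ℂ (b i) x).re = ‖inner ℂ (b i) x‖ ^ 2 := fun i => by
    rw [← inner_conj_symm x, mul_comm, Complex.mul_conj, Complex.normSq_eq_norm_sq,
      Complex.ofReal_re]
  simp only [h2] at h1
  have h3 : (inner ℂ x x : ℂ).re = ‖x‖ ^ 2 := inner_self_eq_norm_sq (𝕜 := ℂ) x
  rw [h3] at h1
  simp only [enorm_sq_eq_ofReal]
  rw [← ENNReal.ofReal_tsum_of_nonneg (fun _ => by positivity) h1.summable, h1.tsum_eq]

/-- The standard Hilbert basis of `ℓ²(ℤ)`. -/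
def deltaBasis : HilbertBasis ℤ ℂ EllTwo := HilbertBasis.mk orthonormal_delta span_delta.ge

theorem deltaBasis_apply (n : ℤ) : deltaBasis n = delta n := by
  simp [deltaBasis]

theorem tsum_enorm_sq_coe (ψ : EllTwo) : ∑' n, ‖(ψ : ℤ → ℂ) n‖ₑ ^ 2 = ‖ψ‖ₑ ^ 2 := by
  rw [← deltaBasis.tsum_enorm_sq ψ]
  simp only [deltaBasis_apply, inner_delta_left]

theorem tsum_enorm_sq_integral_fourier {f : UnitAddCircle → ℂ}
    (hf : MemLp f 2 (AddCircle.haarAddCircle : Measure UnitAddCircle)) :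
    ∑' n : ℤ, ‖∫ θ, fourier n θ * f θ ∂AddCircle.haarAddCircle‖ₑ ^ 2 =
      eLpNorm f 2 (AddCircle.haarAddCircle : Measure UnitAddCircle) ^ 2 := by
  have h1 := fourierBasis.tsum_enorm_sq (hf.toLp f)
  rw [Lp.enorm_toLp] at h1
  rw [← h1, ← (Equiv.neg ℤ).tsum_eq]
  refine tsum_congr fun n => ?_
  rw [← HilbertBasis.repr_apply_apply, fourierBasis_repr, fourierCoeff]
  congr 2
  refine integral_congr_ae ?_
  filter_upwards [hf.coeFn_toLp] with θ h
  rw [h]; rfl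

end Parseval

section DualPairs

variable {d : ℕ} (α : Fin d → ℝ)

/-- Duality between fields of vectors `F : 𝕋^d → ℓ²(ℤ)` and `G : 𝕋 → L²(𝕋^d)`: writing
`F(x) = ∑ c_n(x) δ_n`, it means that `G(θ)(x) = ∑ e^{-2πinθ} c_n(x - nα)`, stated in terms of the
Fourier coefficients of `G`. -/
structure IsDualPair (F : QPTorus d → EllTwo) (G : UnitAddCircle → TorusL2 d) : Prop where
  memLp_left : MemLp F 2 (torusMeasure d)
  memLp_right : MemLp G 2 AddCircle.haarAddCircle
  coeff : ∀ n : ℤ, (∫ θ, (fourier n θ : ℂ) • G θ ∂AddCircle.haarAddCircle : TorusL2 d)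
    =ᵐ[torusMeasure d] fun x => (F (x - n • torusPoint α) : ℤ → ℂ) n

theorem integrable_fourier_smul {E : Type*} [NormedAddCommGroup E] [NormedSpace ℂ E]
    {G : UnitAddCircle → E}
    (hG : MemLp G 2 (AddCircle.haarAddCircle : Measure UnitAddCircle)) (n : ℤ) :
    Integrable (fun θ => (fourier n θ : ℂ) • G θ) AddCircle.haarAddCircle := by
  refine (hG.integrable one_le_two).bdd_smul 1 (fourier n).continuous.aestronglyMeasurable ?_
  exact Eventually.of_forall fun θ => by rw [fourier_apply, Circle.norm_coe]

variable {α}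

/-- Duality preserves `L²` norms, by Parseval's identity in both variables. -/
theorem IsDualPair.eLpNorm_eq {F : QPTorus d → EllTwo} {G : UnitAddCircle → TorusL2 d}
    (h : IsDualPair α F G) :
    eLpNorm F 2 (torusMeasure d) = eLpNorm G 2 AddCircle.haarAddCircle := by
  have hsq : eLpNorm F 2 (torusMeasure d) ^ 2 = eLpNorm G 2 AddCircle.haarAddCircle ^ 2 := by
    have hFn : ∀ n : ℤ, AEStronglyMeasurable (fun x => (F x : ℤ → ℂ) n) (torusMeasure d) := by
      intro n
      have : (fun x => (F x : ℤ → ℂ) n) = fun x => inner ℂ (delta n) (F x) := by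
        funext x; rw [inner_delta_left]
      rw [this]
      exact aestronglyMeasurable_const.inner h.memLp_left.1
    have hGm : ∀ m, MemLp (fun θ => inner ℂ (torusBasis d m) (G θ)) 2
        (AddCircle.haarAddCircle : Measure UnitAddCircle) := fun m =>
      h.memLp_right.const_inner _
    calc eLpNorm F 2 (torusMeasure d) ^ 2
        = ∑' n : ℤ, ∫⁻ x, ‖(F x : ℤ → ℂ) n‖ₑ ^ 2 ∂(torusMeasure d) := by
          rw [← lintegral_enorm_sq, ← lintegral_tsum fun n => (hFn n).enorm.pow_const 2]
          simp only [tsum_enorm_sq_coe]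
      -- the translation by `nα` does not change the norm in `L²(𝕋^d)`
      _ = ∑' n : ℤ, ‖(∫ θ, (fourier n θ : ℂ) • G θ ∂AddCircle.haarAddCircle : TorusL2 d)‖ₑ ^ 2 := by
          refine tsum_congr fun n => ?_
          rw [Lp.enorm_def, eLpNorm_congr_ae (h.coeff n), ← lintegral_enorm_sq]
          simp only [sub_eq_add_neg]
          exact (lintegral_add_right_eq_self (fun x => ‖(F x : ℤ → ℂ) n‖ₑ ^ 2)
            (-(n • torusPoint α))).symm
      _ = ∑' n : ℤ, ∑' m, ‖∫ θ, fourier n θ * inner ℂ (torusBasis d m) (G θ)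
            ∂AddCircle.haarAddCircle‖ₑ ^ 2 := by
          refine tsum_congr fun n => ?_
          rw [← (torusBasis d).tsum_enorm_sq]
          refine tsum_congr fun m => ?_
          rw [← integral_inner (integrable_fourier_smul h.memLp_right n)]
          simp only [inner_smul_right]
      _ = ∑' m, eLpNorm (fun θ => inner ℂ (torusBasis d m) (G θ)) 2 AddCircle.haarAddCircle ^ 2 := by
          rw [ENNReal.tsum_comm]
          exact tsum_congr fun m => tsum_enorm_sq_integral_fourier (hGm m)
      _ = eLpNorm G 2 AddCircle.haarAddCircle ^ 2 := by
          simp only [← lintegral_enorm_sq]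
          rw [← lintegral_tsum fun m => (hGm m).1.enorm.pow_const 2]
          simp only [(torusBasis d).tsum_enorm_sq]
  exact (ENNReal.pow_right_strictMono two_ne_zero).injective hsq

theorem IsDualPair.add {F F' : QPTorus d → EllTwo} {G G' : UnitAddCircle → TorusL2 d}
    (h : IsDualPair α F G) (h' : IsDualPair α F' G') :
    IsDualPair α (fun x => F x + F' x) (fun θ => G θ + G' θ) where
  memLp_left := h.memLp_left.add h'.memLp_left
  memLp_right := h.memLp_right.add h'.memLp_right
  coeff n := by
    simp only [smul_add]
    rw [integral_add (integrable_fourier_smul h.memLp_right n)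
      (integrable_fourier_smul h'.memLp_right n)]
    filter_upwards [Lp.coeFn_add (∫ θ, (fourier n θ : ℂ) • G θ ∂AddCircle.haarAddCircle : TorusL2 d)
      (∫ θ, (fourier n θ : ℂ) • G' θ ∂AddCircle.haarAddCircle : TorusL2 d), h.coeff n, h'.coeff n]
      with x h1 h2 h3
    rw [h1, Pi.add_apply, h2, h3]; rfl

theorem IsDualPair.const_smul {F : QPTorus d → EllTwo} {G : UnitAddCircle → TorusL2 d}
    (h : IsDualPair α F G) (c : ℂ) :
    IsDualPair α (fun x => c • F x) (fun θ => c • G θ) where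
  memLp_left := h.memLp_left.const_smul c
  memLp_right := h.memLp_right.const_smul c
  coeff n := by
    simp only [smul_comm _ c]
    rw [integral_smul]
    filter_upwards [Lp.coeFn_smul c
      (∫ θ, (fourier n θ : ℂ) • G θ ∂AddCircle.haarAddCircle : TorusL2 d), h.coeff n] with x h1 h2
    rw [h1, Pi.smul_apply, h2]; rfl

theorem IsDualPair.sub {F F' : QPTorus d → EllTwo} {G G' : UnitAddCircle → TorusL2 d}
    (h : IsDualPair α F G) (h' : IsDualPair α F' G') :
    IsDualPair α (fun x => F x - F' x) (fun θ => G θ - G' θ) := by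
  have := h.add (h'.const_smul (-1))
  simpa only [neg_smul, one_smul, ← sub_eq_add_neg] using this

variable (α) in
/-- The constant fields `δ₀` and `1` are dual to each other. -/
theorem isDualPair_delta_zero :
    IsDualPair α (fun _ => delta 0) (fun _ => torusBasis d 0) where
  memLp_left := memLp_const _
  memLp_right := memLp_const _
  coeff n := by
    rw [integral_smul_const]
    have h1 : ∫ θ : UnitAddCircle, (fourier n θ : ℂ) ∂AddCircle.haarAddCircle =
        if n = 0 then 1 else 0 := by
      have h := (orthonormal_iff_ite.1 (fourierBasis (T := (1 : ℝ))).orthonormal) 0 n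
      simp only [coe_fourierBasis] at h
      rw [L2.inner_def] at h
      rw [if_congr (eq_comm (a := n)) rfl rfl, ← h]
      refine integral_congr_ae ?_
      filter_upwards [coeFn_fourierLp (T := (1 : ℝ)) 2 n, coeFn_fourierLp (T := (1 : ℝ)) 2 0]
        with θ h2 h3
      rw [h2, h3]
      simp
    rw [h1]
    filter_upwards [Lp.coeFn_smul (if n = 0 then (1 : ℂ) else 0) (torusBasis d 0),
      coeFn_torusBasis (0 : Fin d → ℤ)] with x h2 h3
    rw [h2, Pi.smul_apply, h3, UnitAddTorus.mFourier_zero, delta_apply]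
    simp

/-- Fields of bounded operators on `ℓ²(ℤ)` and on `L²(𝕋^d)` that preserve duality of fields of
vectors. Such fields are automatically measurable enough for their action on square integrable
fields, since `IsDualPair` contains the measurability. -/
def IsIntertwined (α : Fin d → ℝ) (X : QPTorus d → EllTwo →L[ℂ] EllTwo)
    (Y : UnitAddCircle → TorusL2 d →L[ℂ] TorusL2 d) : Prop :=
  ∀ F G, IsDualPair α F G → IsDualPair α (fun x => X x (F x)) (fun θ => Y θ (G θ))

theorem IsIntertwined.one : IsIntertwined α (fun _ => 1) (fun _ => 1) := fun _ _ h => h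

theorem IsIntertwined.mul {X X' : QPTorus d → EllTwo →L[ℂ] EllTwo}
    {Y Y' : UnitAddCircle → TorusL2 d →L[ℂ] TorusL2 d} (h : IsIntertwined α X Y)
    (h' : IsIntertwined α X' Y') :
    IsIntertwined α (fun x => X x * X' x) (fun θ => Y θ * Y' θ) := fun _ _ hF => h _ _ (h' _ _ hF)

theorem IsIntertwined.add {X X' : QPTorus d → EllTwo →L[ℂ] EllTwo}
    {Y Y' : UnitAddCircle → TorusL2 d →L[ℂ] TorusL2 d} (h : IsIntertwined α X Y)
    (h' : IsIntertwined α X' Y') :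
    IsIntertwined α (fun x => X x + X' x) (fun θ => Y θ + Y' θ) := fun _ _ hF =>
  (h _ _ hF).add (h' _ _ hF)

theorem IsIntertwined.const_smul {X : QPTorus d → EllTwo →L[ℂ] EllTwo}
    {Y : UnitAddCircle → TorusL2 d →L[ℂ] TorusL2 d} (h : IsIntertwined α X Y) (c : ℂ) :
    IsIntertwined α (fun x => c • X x) (fun θ => c • Y θ) := fun _ _ hF => (h _ _ hF).const_smul c

theorem IsIntertwined.sub {X X' : QPTorus d → EllTwo →L[ℂ] EllTwo}
    {Y Y' : UnitAddCircle → TorusL2 d →L[ℂ] TorusL2 d} (h : IsIntertwined α X Y)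
    (h' : IsIntertwined α X' Y') :
    IsIntertwined α (fun x => X x - X' x) (fun θ => Y θ - Y' θ) := fun _ _ hF =>
  (h _ _ hF).sub (h' _ _ hF)

theorem IsIntertwined.pow {X : QPTorus d → EllTwo →L[ℂ] EllTwo}
    {Y : UnitAddCircle → TorusL2 d →L[ℂ] TorusL2 d} (h : IsIntertwined α X Y) (n : ℕ) :
    IsIntertwined α (fun x => X x ^ n) (fun θ => Y θ ^ n) := by
  induction n with
  | zero => simpa only [pow_zero] using IsIntertwined.one
  | succ n ih => simpa only [pow_succ] using ih.mul h

theorem IsIntertwined.sum {X : ℕ → QPTorus d → EllTwo →L[ℂ] EllTwo}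
    {Y : ℕ → UnitAddCircle → TorusL2 d →L[ℂ] TorusL2 d} (h : ∀ j, IsIntertwined α (X j) (Y j))
    (n : ℕ) :
    IsIntertwined α (fun x => ∑ j ∈ Finset.range n, X j x)
      (fun θ => ∑ j ∈ Finset.range n, Y j θ) := by
  induction n with
  | zero =>
    simp only [Finset.sum_range_zero]
    simpa only [zero_smul] using (IsIntertwined.one (α := α)).const_smul 0
  | succ n ih => simpa only [Finset.sum_range_succ] using ih.add (h n)

/-- An almost everywhere pointwise limit of a sequence converging in `L²` is its limit. -/
theorem ae_eq_of_tendsto_Lp {X : Type*} [MeasurableSpace X] {μ : Measure X} {K : ℕ → Lp ℂ 2 μ}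
    {K' : Lp ℂ 2 μ} (hK : Tendsto K atTop (𝓝 K')) {k : ℕ → X → ℂ} {k' : X → ℂ}
    (h : ∀ j, K j =ᵐ[μ] k j) (hk : ∀ᵐ x ∂μ, Tendsto (fun j => k j x) atTop (𝓝 (k' x))) :
    K' =ᵐ[μ] k' := by
  obtain ⟨ns, hns, hlim⟩ := (tendstoInMeasure_of_tendsto_Lp hK).exists_seq_tendsto_ae
  filter_upwards [hlim, hk, ae_all_iff.2 h] with x h1 h2 h3
  simp only [h3] at h1
  exact tendsto_nhds_unique h1 (h2.comp hns.tendsto_atTop)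

/-- Intertwining is preserved under bounded strong limits. -/
theorem IsIntertwined.of_tendsto {X : ℕ → QPTorus d → EllTwo →L[ℂ] EllTwo}
    {Y : ℕ → UnitAddCircle → TorusL2 d →L[ℂ] TorusL2 d} (h : ∀ j, IsIntertwined α (X j) (Y j))
    {X' : QPTorus d → EllTwo →L[ℂ] EllTwo} {Y' : UnitAddCircle → TorusL2 d →L[ℂ] TorusL2 d} {C : ℝ}
    (hX : ∀ j x, ‖X j x‖ ≤ C) (hY : ∀ j θ, ‖Y j θ‖ ≤ C)
    (hXl : ∀ᵐ x ∂(torusMeasure d), ∀ u, Tendsto (fun j => X j x u) atTop (𝓝 (X' x u)))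
    (hYl : ∀ᵐ θ ∂(AddCircle.haarAddCircle : Measure UnitAddCircle),
      ∀ u, Tendsto (fun j => Y j θ u) atTop (𝓝 (Y' θ u))) :
    IsIntertwined α X' Y' := by
  intro F G hFG
  have hp := fun j => h j F G hFG
  have hXm : AEStronglyMeasurable (fun x => X' x (F x)) (torusMeasure d) :=
    aestronglyMeasurable_of_tendsto_ae atTop (fun j => (hp j).memLp_left.1)
      (hXl.mono fun x hx => hx (F x))
  have hYm : AEStronglyMeasurable (fun θ => Y' θ (G θ)) AddCircle.haarAddCircle :=
    aestronglyMeasurable_of_tendsto_ae atTop (fun j => (hp j).memLp_right.1)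
      (hYl.mono fun θ hθ => hθ (G θ))
  refine ⟨?_, ?_, fun n => ?_⟩
  · refine hFG.memLp_left.of_le_mul (c := C) hXm ?_
    filter_upwards [hXl] with x hx
    exact le_of_tendsto (hx (F x)).norm (Eventually.of_forall fun j =>
      (X j x).le_of_opNorm_le (hX j x) _)
  · refine hFG.memLp_right.of_le_mul (c := C) hYm ?_
    filter_upwards [hYl] with θ hθ
    exact le_of_tendsto (hθ (G θ)).norm (Eventually.of_forall fun j =>
      (Y j θ).le_of_opNorm_le (hY j θ) _)
  · refine ae_eq_of_tendsto_Lp (K := fun j =>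
      ∫ θ, (fourier n θ : ℂ) • Y j θ (G θ) ∂AddCircle.haarAddCircle) ?_
      (fun j => (hp j).coeff n) ?_
    · refine tendsto_integral_of_dominated_convergence (fun θ => C * ‖G θ‖)
        (fun j => (integrable_fourier_smul (hp j).memLp_right n).1)
        ((hFG.memLp_right.integrable one_le_two).norm.const_mul C) (fun j => ?_) ?_
      · refine Eventually.of_forall fun θ => ?_
        rw [norm_smul, fourier_apply, Circle.norm_coe, one_mul]
        exact (Y j θ).le_of_opNorm_le (hY j θ) _
      · filter_upwards [hYl] with θ hθ
        exact (hθ (G θ)).const_smul _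
    · have hXl' := ae_translate (-(n • torusPoint α)) hXl
      filter_upwards [hXl'] with x hx
      rw [← sub_eq_add_neg] at hx
      have := (tendsto_const_nhds (x := delta n)).inner (𝕜 := ℂ) (hx (F (x - n • torusPoint α)))
      simpa only [inner_delta_left] using this

end DualPairs

/-! ### Intertwined fields of operators -/

section Exponential

theorem tendsto_sum_exp {E : Type*} [NormedAddCommGroup E] [InnerProductSpace ℂ E]
    [CompleteSpace E] (X : E →L[ℂ] E) :
    Tendsto (fun n => ∑ k ∈ Finset.range n, ((k.factorial : ℂ)⁻¹) • X ^ k) atTop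
      (𝓝 (NormedSpace.exp X)) := by
  let +nondep : NormedAlgebra ℚ (E →L[ℂ] E) := NormedAlgebra.restrictScalars ℚ ℂ _
  exact (NormedSpace.exp_series_hasSum_exp' (𝕂 := ℂ) X).tendsto_sum_nat

theorem norm_sum_exp_le {E : Type*} [NormedAddCommGroup E] [InnerProductSpace ℂ E]
    {X : E →L[ℂ] E} {R : ℝ} (hR : ‖X‖ ≤ R) (n : ℕ) :
    ‖∑ k ∈ Finset.range n, ((k.factorial : ℂ)⁻¹) • X ^ k‖ ≤ Real.exp R := by
  have hR0 : 0 ≤ R := (norm_nonneg _).trans hR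
  have hpow : ∀ k, ‖X ^ k‖ ≤ R ^ k := by
    intro k
    induction k with
    | zero => rw [pow_zero, pow_zero]; exact ContinuousLinearMap.norm_id_le
    | succ k ih =>
      rw [pow_succ, pow_succ]
      exact (norm_mul_le _ _).trans (mul_le_mul ih hR (norm_nonneg _) (by positivity))
  refine (norm_sum_le _ _).trans (le_trans (Finset.sum_le_sum fun k _ => ?_)
    (Real.sum_le_exp_of_nonneg hR0 n))
  rw [norm_smul, norm_inv, Complex.norm_natCast, div_eq_inv_mul]
  gcongr
  exact hpow k

/-- Riemann sums of a continuous function converge to its mean. -/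
theorem tendsto_riemann_sum {E : Type*} [NormedAddCommGroup E] [NormedSpace ℝ E]
    [CompleteSpace E] {f : ℝ → E} (hf : Continuous f) {T : ℝ} (hT : 0 < T) :
    Tendsto (fun n : ℕ => ((n + 1 : ℕ) : ℝ)⁻¹ • ∑ j ∈ Finset.range (n + 1), f (T * j / (n + 1 : ℕ)))
      atTop (𝓝 (T⁻¹ • ∫ t in (0 : ℝ)..T, f t)) := by
  rw [Metric.tendsto_atTop]
  intro ε hε
  have hu := isCompact_Icc.uniformContinuousOn_of_continuous (s := Set.Icc 0 T) hf.continuousOn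
  rw [Metric.uniformContinuousOn_iff] at hu
  obtain ⟨δ, hδ, h⟩ := hu (ε / 2) (by positivity)
  obtain ⟨N, hN⟩ := exists_nat_gt (T / δ)
  refine ⟨N, fun n hn => ?_⟩
  set m : ℕ := n + 1 with hm
  have hm0 : (0 : ℝ) < m := by positivity
  have hTm : T / m < δ := by
    rw [div_lt_comm₀ hm0 hδ]
    refine hN.trans ?_
    rw [hm]
    exact_mod_cast Nat.lt_succ_of_le hn
  have hsum : ∑ j ∈ Finset.range m, ∫ t in (T * j / m)..(T * (j + 1 : ℕ) / m), f t =
      ∫ t in (0 : ℝ)..T, f t := by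
    rw [intervalIntegral.sum_integral_adjacent_intervals
      (a := fun j : ℕ => T * j / m) fun k _ => hf.intervalIntegrable _ _]
    congr 1
    · simp
    · field_simp
  have hpiece : ∀ j ∈ Finset.range m,
      ‖(T / m) • f (T * j / m) - ∫ t in (T * j / m)..(T * (j + 1 : ℕ) / m), f t‖ ≤
        ε / 2 * (T / m) := by
    intro j hj
    have hj' : (j : ℝ) + 1 ≤ m := by exact_mod_cast Finset.mem_range.1 hj
    have hlen : T * (j + 1 : ℕ) / m - T * j / m = T / m := by push_cast; field_simp; ring
    have hle : T * j / m ≤ T * (j + 1 : ℕ) / m := by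
      have : 0 < T / m := by positivity
      linarith
    have h1 : (T / m) • f (T * j / m) =
        ∫ t in (T * j / m)..(T * (j + 1 : ℕ) / m), f (T * j / m) := by
      rw [intervalIntegral.integral_const, hlen]
    rw [h1, ← intervalIntegral.integral_sub (continuous_const.intervalIntegrable _ _)
      (hf.intervalIntegrable _ _)]
    have h2 := intervalIntegral.norm_integral_le_of_norm_le_const (a := T * j / m)
      (b := T * (j + 1 : ℕ) / m) (C := ε / 2) (f := fun t => f (T * j / m) - f t) ?_
    · rwa [hlen, abs_of_pos (by positivity)] at h2
    · intro t ht
      rw [Set.uIoc_of_le hle] at ht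
      have h0 : 0 ≤ T * j / m := by positivity
      have h3 : T * (j + 1 : ℕ) / m ≤ T := by
        rw [div_le_iff₀ hm0]; push_cast; gcongr
      rw [← dist_eq_norm]
      refine (h _ ⟨h0, by linarith [ht.1, ht.2]⟩ t ⟨by linarith [ht.1], ht.2.trans h3⟩ ?_).le
      rw [dist_comm, Real.dist_eq, abs_of_pos (by linarith [ht.1])]
      linarith [ht.2]
  have hT' : T⁻¹ * (T / m) = (m : ℝ)⁻¹ := by field_simp
  rw [dist_eq_norm, ← hsum, ← hT', mul_smul, ← smul_sub, Finset.smul_sum,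
    ← Finset.sum_sub_distrib, norm_smul, norm_inv, Real.norm_of_nonneg hT.le]
  calc _ ≤ T⁻¹ * ∑ j ∈ Finset.range m, ε / 2 * (T / m) := by
        gcongr
        exact (norm_sum_le _ _).trans (Finset.sum_le_sum hpiece)
    _ = ε / 2 := by
        rw [Finset.sum_const, Finset.card_range, nsmul_eq_mul]; field_simp
    _ < ε := by linarith

end Exponential

section IntertwinedOperators

variable {d : ℕ} {α : Fin d → ℝ}

theorem IsIntertwined.exp {X : QPTorus d → EllTwo →L[ℂ] EllTwo}
    {Y : UnitAddCircle → TorusL2 d →L[ℂ] TorusL2 d} (h : IsIntertwined α X Y) {R : ℝ}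
    (hX : ∀ x, ‖X x‖ ≤ R) (hY : ∀ θ, ‖Y θ‖ ≤ R) :
    IsIntertwined α (fun x => NormedSpace.exp (X x)) (fun θ => NormedSpace.exp (Y θ)) := by
  refine IsIntertwined.of_tendsto
    (X := fun n x => ∑ k ∈ Finset.range n, ((k.factorial : ℂ)⁻¹) • X x ^ k)
    (Y := fun n θ => ∑ k ∈ Finset.range n, ((k.factorial : ℂ)⁻¹) • Y θ ^ k) (C := Real.exp R)
    (fun n => IsIntertwined.sum (fun k => (h.pow k).const_smul _) n)
    (fun n x => norm_sum_exp_le (hX x) n) (fun n θ => norm_sum_exp_le (hY θ) n)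
    (Eventually.of_forall fun x u => ?_) (Eventually.of_forall fun θ u => ?_)
  · exact ((ContinuousLinearMap.apply ℂ EllTwo u).continuous.tendsto _).comp (tendsto_sum_exp (X x))
  · exact ((ContinuousLinearMap.apply ℂ (TorusL2 d) u).continuous.tendsto _).comp
      (tendsto_sum_exp (Y θ))

theorem IsIntertwined.heisenberg {X A : QPTorus d → EllTwo →L[ℂ] EllTwo}
    {Y B : UnitAddCircle → TorusL2 d →L[ℂ] TorusL2 d} (h : IsIntertwined α X Y)
    (hA : IsIntertwined α A B) {R : ℝ} (hX : ∀ x, ‖X x‖ ≤ R) (hY : ∀ θ, ‖Y θ‖ ≤ R) (t : ℝ) :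
    IsIntertwined α (fun x => heisenberg (X x) (A x) t) (fun θ => heisenberg (Y θ) (B θ) t) := by
  have hb : ∀ {E : Type} [NormedAddCommGroup E] [InnerProductSpace ℂ E] (S : E →L[ℂ] E),
      ‖S‖ ≤ R → ‖(Complex.I * (t : ℂ)) • S‖ ≤ |t| * R := by
    intro E _ _ S hS
    rw [norm_smul, norm_mul, Complex.norm_I, one_mul, Complex.norm_real, Real.norm_eq_abs]
    gcongr
  have hneg : ∀ {M : Type} [AddCommGroup M] [Module ℂ M] (S : M),
      -((Complex.I * (t : ℂ)) • S) = (-(Complex.I * (t : ℂ))) • S := fun S => (neg_smul _ _).symm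
  have hb' : ∀ {E : Type} [NormedAddCommGroup E] [InnerProductSpace ℂ E] (S : E →L[ℂ] E),
      ‖S‖ ≤ R → ‖-((Complex.I * (t : ℂ)) • S)‖ ≤ |t| * R := by
    intro E _ _ S hS
    rw [norm_neg]; exact hb S hS
  have h1 := (h.const_smul (Complex.I * (t : ℂ))).exp (fun x => hb _ (hX x)) (fun θ => hb _ (hY θ))
  have h2 : IsIntertwined α (fun x => -((Complex.I * (t : ℂ)) • X x))
      (fun θ => -((Complex.I * (t : ℂ)) • Y θ)) := by
    simp only [hneg]
    exact h.const_smul _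
  exact (h1.mul hA).mul (h2.exp (fun x => hb' _ (hX x)) (fun θ => hb' _ (hY θ)))

theorem IsIntertwined.timeAverage {X A : QPTorus d → EllTwo →L[ℂ] EllTwo}
    {Y B : UnitAddCircle → TorusL2 d →L[ℂ] TorusL2 d} (h : IsIntertwined α X Y)
    (hA : IsIntertwined α A B) {R C : ℝ} (hX : ∀ x, ‖X x‖ ≤ R) (hY : ∀ θ, ‖Y θ‖ ≤ R)
    (hXs : ∀ x, IsSelfAdjoint (X x)) (hYs : ∀ θ, IsSelfAdjoint (Y θ))
    (hAC : ∀ x, ‖A x‖ ≤ C) (hBC : ∀ θ, ‖B θ‖ ≤ C) {T : ℝ} (hT : 0 < T) :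
    IsIntertwined α (fun x => timeAverage (X x) (A x) T) (fun θ => timeAverage (Y θ) (B θ) T) := by
  have hnorm : ∀ {E : Type} [NormedAddCommGroup E] [InnerProductSpace ℂ E] [CompleteSpace E]
      (S W : E →L[ℂ] E), IsSelfAdjoint S → ‖W‖ ≤ C → ∀ n : ℕ,
      ‖((((n + 1 : ℕ) : ℝ)⁻¹ : ℝ) : ℂ) • ∑ j ∈ Finset.range (n + 1),
        _root_.heisenberg S W (T * j / (n + 1 : ℕ))‖ ≤ C := by
    intro E _ _ _ S W hS hW n
    rw [norm_smul, Complex.norm_real, Real.norm_of_nonneg (by positivity)]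
    have h1 : ‖∑ j ∈ Finset.range (n + 1), _root_.heisenberg S W (T * j / (n + 1 : ℕ))‖ ≤
        (n + 1 : ℕ) * C := by
      refine (norm_sum_le _ _).trans ((Finset.sum_le_sum fun j _ =>
        (norm_heisenberg_le hS W _).trans hW).trans ?_)
      rw [Finset.sum_const, Finset.card_range, nsmul_eq_mul]
    calc _ ≤ ((n + 1 : ℕ) : ℝ)⁻¹ * ((n + 1 : ℕ) * C) := by gcongr
      _ = C := by rw [← mul_assoc, inv_mul_cancel₀ (by positivity), one_mul]
  have hlim : ∀ {E : Type} [NormedAddCommGroup E] [InnerProductSpace ℂ E] [CompleteSpace E]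
      (S W : E →L[ℂ] E) (u : E), Tendsto (fun n : ℕ => (((((n + 1 : ℕ) : ℝ)⁻¹ : ℝ) : ℂ) •
        ∑ j ∈ Finset.range (n + 1), _root_.heisenberg S W (T * j / (n + 1 : ℕ))) u) atTop
        (𝓝 (_root_.timeAverage S W T u)) := by
    intro E _ _ _ S W u
    have h1 := tendsto_riemann_sum (continuous_heisenberg S W) hT
    have h2 := ((ContinuousLinearMap.apply ℂ E u).continuous.tendsto _).comp h1
    exact h2
  exact IsIntertwined.of_tendsto
    (X := fun n x => ((((n + 1 : ℕ) : ℝ)⁻¹ : ℝ) : ℂ) • ∑ j ∈ Finset.range (n + 1),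
      _root_.heisenberg (X x) (A x) (T * j / (n + 1 : ℕ)))
    (Y := fun n θ => ((((n + 1 : ℕ) : ℝ)⁻¹ : ℝ) : ℂ) • ∑ j ∈ Finset.range (n + 1),
      _root_.heisenberg (Y θ) (B θ) (T * j / (n + 1 : ℕ)))
    (fun n => (IsIntertwined.sum (fun j => h.heisenberg hA hX hY _) (n + 1)).const_smul _)
    (fun n x => hnorm _ _ (hXs x) (hAC x) n) (fun n θ => hnorm _ _ (hYs θ) (hBC θ) n)
    (Eventually.of_forall fun x u => hlim _ _ u) (Eventually.of_forall fun θ u => hlim _ _ u)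

theorem IsIntertwined.kernelMean {X : QPTorus d → EllTwo →L[ℂ] EllTwo}
    {Y : UnitAddCircle → TorusL2 d →L[ℂ] TorusL2 d} (h : IsIntertwined α X Y) (R : ℝ) (n : ℕ) :
    IsIntertwined α (fun x => kernelMean (X x) R n) (fun θ => kernelMean (Y θ) R n) :=
  (IsIntertwined.sum (fun k => (IsIntertwined.one.sub ((h.mul h).const_smul _)).pow k) n).const_smul
    _

variable (α)

/-- The Fourier phase `e^{2πimθ}` moves the coefficient of index `n + m` to index `n`, and the
translation by `mα` compensates for the base point `x - nα` in the definition of duality. -/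
theorem isIntertwined_shift (m : ℤ) :
    IsIntertwined α (fun _ => shift m)
      (fun θ => (fourier m θ : ℂ) • translateL2 (m • torusPoint α)) := by
  intro F G h
  have hG2 : MemLp (fun θ => translateL2 (m • torusPoint α) (G θ)) 2
      (AddCircle.haarAddCircle : Measure UnitAddCircle) :=
    (translateL2 (m • torusPoint α)).comp_memLp' h.memLp_right
  refine ⟨(shift m).comp_memLp' h.memLp_left, ?_, fun n => ?_⟩
  · refine hG2.of_le ((fourier m).continuous.aestronglyMeasurable.smul hG2.1)
      (Eventually.of_forall fun θ => ?_)
    change ‖(fourier m θ : ℂ) • translateL2 (m • torusPoint α) (G θ)‖ ≤ _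
    rw [norm_smul, fourier_apply, Circle.norm_coe, one_mul]
  · have h1 : (∫ θ, (fourier n θ : ℂ) • (((fourier m θ : ℂ) •
        translateL2 (m • torusPoint α)) (G θ)) ∂AddCircle.haarAddCircle : TorusL2 d) =
        translateL2 (m • torusPoint α)
          (∫ θ, (fourier (n + m) θ : ℂ) • G θ ∂AddCircle.haarAddCircle) := by
      rw [← ContinuousLinearMap.integral_comp_comm _ (integrable_fourier_smul h.memLp_right _)]
      refine integral_congr_ae (Eventually.of_forall fun θ => ?_)
      simp only [_root_.smul_apply, map_smul, fourier_add, mul_smul]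
    rw [h1]
    filter_upwards [coeFn_translateL2 (m • torusPoint α)
      (∫ θ, (fourier (n + m) θ : ℂ) • G θ ∂AddCircle.haarAddCircle),
      ae_translate (m • torusPoint α) (h.coeff (n + m))] with x h2 h3
    rw [h2, h3, shift_apply]
    rw [add_smul]; abel_nf

variable (v : C(QPTorus d, ℝ))

theorem isIntertwined_potential :
    IsIntertwined α (potential α v) (fun _ => multiply (complexPotential v)) := by
  intro F G h
  refine ⟨?_, (multiply (complexPotential v)).comp_memLp' h.memLp_right, fun n => ?_⟩
  · refine h.memLp_left.of_le_mul (c := ‖v‖) ?_ (Eventually.of_forall fun x =>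
      (potential α v x).le_of_opNorm_le (norm_potential_le α v x) _)
    exact ((ContinuousLinearMap.id ℂ (EllTwo →L[ℂ] EllTwo)).aestronglyMeasurable_comp₂
      (continuous_potential α v).aestronglyMeasurable h.memLp_left.1)
  · have h1 : (∫ θ, (fourier n θ : ℂ) • multiply (complexPotential v) (G θ)
        ∂AddCircle.haarAddCircle : TorusL2 d) = multiply (complexPotential v)
          (∫ θ, (fourier n θ : ℂ) • G θ ∂AddCircle.haarAddCircle) := by
      rw [← ContinuousLinearMap.integral_comp_comm _ (integrable_fourier_smul h.memLp_right _)]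
      refine integral_congr_ae (Eventually.of_forall fun θ => ?_)
      simp only [map_smul]
    rw [h1]
    filter_upwards [coeFn_multiply (complexPotential v)
      (∫ θ, (fourier n θ : ℂ) • G θ ∂AddCircle.haarAddCircle), h.coeff n] with x h2 h3
    rw [h2, h3, potential_apply, sub_add_cancel]
    rfl

theorem fourier_neg_one_eq (θ : UnitAddCircle) : (fourier (-1) θ : ℂ) = fourier 1 (-θ) := by
  simp [fourier_apply]

theorem isIntertwined_schrodinger :
    IsIntertwined α (schrodinger α v) (dualOperator α v) := by
  have h := ((isIntertwined_shift α 1).add (isIntertwined_shift α (-1))).add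
    (isIntertwined_potential α v)
  simp only [one_smul, neg_smul, fourier_neg_one_eq] at h
  exact h

theorem isIntertwined_currentOp :
    IsIntertwined α (fun _ => currentOp) (dualCurrent α) := by
  have h := ((isIntertwined_shift α 1).sub (isIntertwined_shift α (-1))).const_smul Complex.I
  simp only [one_smul, neg_smul, fourier_neg_one_eq] at h
  exact h

theorem norm_currentOp_le : ‖currentOp‖ ≤ 2 := by
  unfold currentOp
  rw [norm_smul, Complex.norm_I, one_mul]
  linarith [norm_sub_le (shift 1) (shift (-1)), norm_shift_le 1, norm_shift_le (-1)]

theorem norm_dualCurrent_le (θ : UnitAddCircle) : ‖dualCurrent α θ‖ ≤ 2 := by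
  unfold dualCurrent
  rw [norm_smul, Complex.norm_I, one_mul]
  have h := norm_sub_le ((fourier 1 θ : ℂ) • translateL2 (torusPoint α))
    ((fourier 1 (-θ) : ℂ) • translateL2 (-torusPoint α))
  rw [norm_smul, norm_smul, norm_fourier_one, norm_fourier_one, one_mul, one_mul] at h
  linarith [norm_translateL2_le (torusPoint α), norm_translateL2_le (-torusPoint α)]

theorem currentOp_isSelfAdjoint : IsSelfAdjoint currentOp := by
  rw [ContinuousLinearMap.isSelfAdjoint_iff_isSymmetric]
  intro ψ φ
  have h1 := inner_shift 1 ψ φ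
  have h2 := inner_shift (-1) ψ φ
  rw [neg_neg] at h2
  change inner ℂ (Complex.I • (shift 1 ψ - shift (-1) ψ)) φ =
    inner ℂ ψ (Complex.I • (shift 1 φ - shift (-1) φ))
  simp only [inner_smul_left, inner_smul_right, inner_sub_left, inner_sub_right, h1, h2,
    Complex.conj_I]
  ring

/-- The time averages of the current are intertwined with those of the dual current. -/
theorem isIntertwined_timeAverage {T : ℝ} (hT : 0 < T) :
    IsIntertwined α (fun x => timeAverage (schrodinger α v x) currentOp T)
      (fun θ => timeAverage (dualOperator α v θ) (dualCurrent α θ) T) :=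
  (isIntertwined_schrodinger α v).timeAverage (isIntertwined_currentOp α)
    (fun x => (norm_schrodinger_le α v x).trans (le_max_left _ _))
    (fun θ => (norm_dualOperator_le α v θ).trans (le_max_right _ _))
    (schrodinger_isSelfAdjoint α v) (dualOperator_isSelfAdjoint α v)
    (fun _ => norm_currentOp_le) (norm_dualCurrent_le α) hT

end IntertwinedOperators

/-! ### Covariance, and convergence along a sequence of times -/

section Covariance

theorem exp_apply_of_semiconj {E : Type*} [NormedAddCommGroup E] [InnerProductSpace ℂ E]
    [CompleteSpace E] {X Y U : E →L[ℂ] E} (h : ∀ ψ, X (U ψ) = U (Y ψ)) (ψ : E) :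
    NormedSpace.exp X (U ψ) = U (NormedSpace.exp Y ψ) := by
  have hpow : ∀ (k : ℕ) (ψ : E), (X ^ k) (U ψ) = U ((Y ^ k) ψ) := by
    intro k
    induction k with
    | zero => intro ψ; simp
    | succ k ih => intro ψ; rw [pow_succ, pow_succ, mul_apply_eq_comp, mul_apply_eq_comp, h, ih]
  have h1 := ((ContinuousLinearMap.apply ℂ E (U ψ)).continuous.tendsto _).comp (tendsto_sum_exp X)
  have h2 := (U.continuous.tendsto _).comp
    (((ContinuousLinearMap.apply ℂ E ψ).continuous.tendsto _).comp (tendsto_sum_exp Y))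
  refine tendsto_nhds_unique h1 (h2.congr fun n => ?_)
  simp only [Function.comp, ContinuousLinearMap.apply_apply]
  rw [_root_.sum_apply, _root_.sum_apply, map_sum]
  simp only [_root_.smul_apply, map_smul, hpow]

/-- Semiconjugacies pass to time averages, as limits of polynomials in the operators. -/
theorem timeAverage_apply_of_semiconj {E : Type*} [NormedAddCommGroup E] [InnerProductSpace ℂ E]
    [CompleteSpace E] {X Y A B U : E →L[ℂ] E} (h : ∀ ψ, X (U ψ) = U (Y ψ))
    (hA : ∀ ψ, A (U ψ) = U (B ψ)) {T : ℝ} (hT : 0 < T) (ψ : E) :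
    timeAverage X A T (U ψ) = U (timeAverage Y B T ψ) := by
  have hh : ∀ (t : ℝ) (ψ : E), heisenberg X A t (U ψ) = U (heisenberg Y B t ψ) := by
    intro t ψ
    have h1 : ∀ ψ, ((Complex.I * (t : ℂ)) • X) (U ψ) = U (((Complex.I * (t : ℂ)) • Y) ψ) := by
      intro ψ; simp only [_root_.smul_apply, h, map_smul]
    have h2 : ∀ ψ, (-((Complex.I * (t : ℂ)) • X)) (U ψ) =
        U ((-((Complex.I * (t : ℂ)) • Y)) ψ) := by
      intro ψ; rw [_root_.neg_apply, _root_.neg_apply, h1, map_neg]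
    unfold heisenberg
    simp only [mul_apply_eq_comp]
    rw [exp_apply_of_semiconj h2, hA, exp_apply_of_semiconj h1]
  have h1 := ((ContinuousLinearMap.apply ℂ E (U ψ)).continuous.tendsto _).comp
    (tendsto_riemann_sum (continuous_heisenberg X A) hT)
  have h2 := (U.continuous.tendsto _).comp (((ContinuousLinearMap.apply ℂ E ψ).continuous.tendsto
    _).comp (tendsto_riemann_sum (continuous_heisenberg Y B) hT))
  refine tendsto_nhds_unique h1 (h2.congr fun n => ?_)
  simp only [Function.comp, ContinuousLinearMap.apply_apply]
  rw [_root_.smul_apply, _root_.smul_apply, _root_.sum_apply, _root_.sum_apply]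
  simp only [hh]
  rw [← map_sum]
  exact (U.restrictScalars ℝ).map_smul _ _

variable {d : ℕ} (α : Fin d → ℝ) (v : C(QPTorus d, ℝ))

theorem currentOp_shift (n : ℤ) (ψ : EllTwo) :
    currentOp (shift n ψ) = shift n (currentOp ψ) := by
  change Complex.I • (shift 1 (shift n ψ) - shift (-1) (shift n ψ)) =
    shift n (Complex.I • (shift 1 ψ - shift (-1) ψ))
  rw [map_smul, map_sub, shift_shift, shift_shift, shift_shift, shift_shift, add_comm 1,
    add_comm (-1)]

theorem timeAverage_shift (x : QPTorus d) (n : ℤ) {T : ℝ} (hT : 0 < T) (ψ : EllTwo) :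
    timeAverage (schrodinger α v (x + n • torusPoint α)) currentOp T (shift n ψ) =
      shift n (timeAverage (schrodinger α v x) currentOp T ψ) :=
  timeAverage_apply_of_semiconj (schrodinger_shift α v x n) (currentOp_shift n) hT ψ

end Covariance

section L2Convergence

theorem tendsto_toLp_of_bounded {X E : Type*} [MeasurableSpace X] [NormedAddCommGroup E]
    {μ : Measure X} [IsFiniteMeasure μ] {f : ℕ → X → E} {g : X → E} {C : ℝ}
    (hf : ∀ n, MemLp (f n) 2 μ) (hg : MemLp g 2 μ) (hb : ∀ n, ∀ᵐ x ∂μ, ‖f n x‖ ≤ C)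
    (h : ∀ᵐ x ∂μ, Tendsto (fun n => f n x) atTop (𝓝 (g x))) :
    Tendsto (fun n => (hf n).toLp (f n)) atTop (𝓝 (hg.toLp g)) := by
  rw [Lp.tendsto_Lp_iff_tendsto_eLpNorm'']
  have h1 : Tendsto (fun n => ∫⁻ x, ‖(f n - g) x‖ₑ ^ 2 ∂μ) atTop (𝓝 (∫⁻ _, 0 ∂μ)) := by
    refine tendsto_lintegral_of_dominated_convergence' (fun _ => ENNReal.ofReal (C + C) ^ 2)
      (fun n => ((hf n).1.sub hg.1).enorm.pow_const 2) (fun n => ?_) (by simp; finiteness) ?_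
    · filter_upwards [hb n, ae_all_iff.2 hb, h] with x h2 h3 h4
      have h5 : ‖g x‖ ≤ C := le_of_tendsto h4.norm (Eventually.of_forall h3)
      gcongr
      rw [← ofReal_norm]
      exact ENNReal.ofReal_le_ofReal ((norm_sub_le _ _).trans (add_le_add h2 h5))
    · filter_upwards [h] with x h4
      have h5 : Tendsto (fun n => (f n - g) x) atTop (𝓝 0) := by
        simpa using h4.sub_const (g x)
      simpa [Function.comp_def] using ((ENNReal.continuous_pow 2).tendsto _).comp h5.enorm
  simp only [lintegral_enorm_sq, lintegral_zero] at h1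
  have h2 := (ENNReal.continuous_rpow_const (y := 1 / 2)).tendsto 0 |>.comp h1
  simp only [Function.comp_def, ← ENNReal.rpow_two, ← ENNReal.rpow_mul] at h2
  simpa using h2

theorem separableSpace_ellTwo : TopologicalSpace.SeparableSpace EllTwo := by
  rw [← TopologicalSpace.isSeparable_univ_iff]
  have h := ((Set.countable_range delta).isSeparable.span (R := ℂ)).closure
  have h2 : closure (Submodule.span ℂ (Set.range delta) : Set EllTwo) = Set.univ := by
    rw [← Submodule.topologicalClosure_coe, span_delta]; rfl
  rwa [h2] at h

/-- The norm of a strongly measurable field of operators on a separable space is measurable. -/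
theorem aemeasurable_opNorm {X E : Type*} [MeasurableSpace X] {μ : Measure X}
    [NormedAddCommGroup E] [InnerProductSpace ℂ E] [TopologicalSpace.SeparableSpace E]
    {Q : X → E →L[ℂ] E} (h : ∀ u, AEStronglyMeasurable (fun x => Q x u) μ) :
    AEMeasurable (fun x => ‖Q x‖) μ := by
  let D := TopologicalSpace.denseSeq E
  have hD : ∀ x, ‖Q x‖ₑ = ⨆ i, ‖Q x (D i)‖ₑ / ‖D i‖ₑ := by
    intro x
    refine le_antisymm ?_ (iSup_le fun i => ?_)
    · set c := ⨆ i, ‖Q x (D i)‖ₑ / ‖D i‖ₑ with hc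
      rcases eq_or_ne c ⊤ with hct | hct
      · rw [hct]; exact le_top
      have h1 : ∀ u, ‖Q x u‖ ≤ c.toReal * ‖u‖ := by
        intro u
        refine (TopologicalSpace.denseRange_denseSeq E).induction_on u
          (isClosed_le (Q x).continuous.norm (continuous_const.mul continuous_norm)) fun i => ?_
        by_cases hi : D i = 0
        · change ‖Q x (D i)‖ ≤ c.toReal * ‖D i‖
          rw [hi]; simp
        have h2 : ‖Q x (D i)‖ₑ / ‖D i‖ₑ ≤ c := le_iSup (fun i => ‖Q x (D i)‖ₑ / ‖D i‖ₑ) i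
        rw [ENNReal.div_le_iff (by simpa using hi) (by simp)] at h2
        have h3 := ENNReal.toReal_mono (ENNReal.mul_ne_top hct (by simp)) h2
        simpa using h3
      have h4 := (Q x).opNorm_le_bound ENNReal.toReal_nonneg h1
      rw [← ofReal_norm]
      exact ENNReal.ofReal_le_of_le_toReal h4
    · refine ENNReal.div_le_of_le_mul ?_
      exact (Q x).le_opENorm (D i)
  have h1 : AEMeasurable (fun x => ‖Q x‖ₑ) μ := by
    simp only [hD]
    exact AEMeasurable.iSup fun i => (h (D i)).enorm.div_const _
  simpa using h1.ennreal_toReal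

end L2Convergence

section Limit

variable {d : ℕ} {α : Fin d → ℝ} (v : C(QPTorus d, ℝ))

/-- Along a sequence of times the averages of the current, applied to `δ₀`, converge at almost every
phase. -/
theorem exists_subsequence_ae_tendsto (hα : RationallyIndependent α)
    (hred : IsL2DegreeZeroReducible α v) :
    ∃ ns : ℕ → ℕ, StrictMono ns ∧ ∀ᵐ x ∂(torusMeasure d), ∃ w, Tendsto
      (fun k => timeAverage (schrodinger α v x) currentOp ((ns k + 1 : ℕ) : ℝ) (delta 0)) atTop
      (𝓝 w) := by
  have hQ := ae_exists_injective_limit_dual v hα hred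
  have hT : ∀ n : ℕ, (0 : ℝ) < ((n + 1 : ℕ) : ℝ) := fun n => by positivity
  have hp := fun n : ℕ => isIntertwined_timeAverage α v (hT n) _ _ (isDualPair_delta_zero α)
  have hTlim : Tendsto (fun n : ℕ => ((n + 1 : ℕ) : ℝ)) atTop atTop :=
    tendsto_natCast_atTop_atTop.comp (tendsto_add_atTop_nat 1)
  have hlim : ∀ᵐ θ ∂(AddCircle.haarAddCircle : Measure UnitAddCircle), ∃ w, Tendsto
      (fun n : ℕ => timeAverage (dualOperator α v θ) (dualCurrent α θ) ((n + 1 : ℕ) : ℝ)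
        (torusBasis d 0)) atTop (𝓝 w) := by
    filter_upwards [hQ] with θ h
    obtain ⟨Q, -, h2, -⟩ := h
    exact ⟨_, (h2 (torusBasis d 0)).comp hTlim⟩
  have hb : ∀ (n : ℕ) (θ : UnitAddCircle), ‖timeAverage (dualOperator α v θ) (dualCurrent α θ)
      ((n + 1 : ℕ) : ℝ) (torusBasis d 0)‖ ≤ 2 := by
    intro n θ
    have h1 := ContinuousLinearMap.le_of_opNorm_le _ ((norm_timeAverage_le
      (dualOperator_isSelfAdjoint α v θ) (dualCurrent α θ) (hT n).le).trans
      (norm_dualCurrent_le α θ)) (torusBasis d 0)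
    rwa [(torusBasis d).orthonormal.1, mul_one] at h1
  obtain ⟨g, hgm, hg⟩ := exists_stronglyMeasurable_limit_of_tendsto_ae
    (fun n => (hp n).memLp_right.1) hlim
  have hgL : MemLp g 2 (AddCircle.haarAddCircle : Measure UnitAddCircle) :=
    MemLp.of_bound hgm.aestronglyMeasurable 2 (by
      filter_upwards [hg] with θ h
      exact le_of_tendsto h.norm (Eventually.of_forall fun n => hb n θ))
  have hK := (tendsto_toLp_of_bounded (fun n => (hp n).memLp_right) hgL
    (fun n => Eventually.of_forall (hb n)) hg).cauchySeq
  -- Duality preserves `L²` norms of differences, so the Cauchy property is transferred from the circle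
  -- to the torus.
  have hL : CauchySeq fun n => (hp n).memLp_left.toLp _ := by
    rw [EMetric.cauchySeq_iff] at hK ⊢
    intro ε hε
    obtain ⟨N, hN⟩ := hK ε hε
    refine ⟨N, fun m hm n hn => ?_⟩
    have h1 := hN m hm n hn
    rw [Lp.edist_toLp_toLp] at h1 ⊢
    have h2 := ((hp m).sub (hp n)).eLpNorm_eq
    exact lt_of_eq_of_lt h2 h1
  obtain ⟨u, hu⟩ := cauchySeq_tendsto_of_complete hL
  obtain ⟨ns, hns, hae⟩ := (tendstoInMeasure_of_tendsto_Lp hu).exists_seq_tendsto_ae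
  refine ⟨ns, hns, ?_⟩
  filter_upwards [hae, ae_all_iff.2 fun n => (hp n).memLp_left.coeFn_toLp] with x h1 h2
  simp only [h2] at h1
  exact ⟨_, h1⟩

end Limit

/-! ### The limit field -/

section LimitField

variable {d : ℕ} {α : Fin d → ℝ} {v : C(QPTorus d, ℝ)}

/-- The field of limits of the averaged current, extended by `0` to the exceptional phases. -/
theorem exists_limit_field (hα : RationallyIndependent α) (hred : IsL2DegreeZeroReducible α v) :
    ∃ (T : ℕ → ℝ) (Q : QPTorus d → EllTwo →L[ℂ] EllTwo), Tendsto T atTop atTop ∧ (∀ k, 0 < T k) ∧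
      (∀ x, ‖Q x‖ ≤ 2 ∧ IsSelfAdjoint (Q x)) ∧
      ∀ᵐ x ∂(torusMeasure d), ∀ u, Tendsto
        (fun k => timeAverage (schrodinger α v x) currentOp (T k) u) atTop (𝓝 (Q x u)) := by
  obtain ⟨ns, hns, hlim⟩ := exists_subsequence_ae_tendsto v hα hred
  have hT : ∀ k, (0 : ℝ) < ((ns k + 1 : ℕ) : ℝ) := fun k => by positivity
  have hTlim : Tendsto (fun k => ((ns k + 1 : ℕ) : ℝ)) atTop atTop :=
    tendsto_natCast_atTop_atTop.comp ((tendsto_add_atTop_nat 1).comp hns.tendsto_atTop)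
  have hQ : ∀ x, ∃ Q : EllTwo →L[ℂ] EllTwo, (‖Q‖ ≤ 2 ∧ IsSelfAdjoint Q) ∧
      ((∀ n : ℤ, ∃ w, Tendsto (fun k => timeAverage (schrodinger α v (x + n • torusPoint α))
        currentOp ((ns k + 1 : ℕ) : ℝ) (delta 0)) atTop (𝓝 w)) → ∀ u, Tendsto (fun k =>
          timeAverage (schrodinger α v x) currentOp ((ns k + 1 : ℕ) : ℝ) u) atTop (𝓝 (Q u))) := by
    intro x
    by_cases hx : ∀ n : ℤ, ∃ w, Tendsto (fun k => timeAverage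
      (schrodinger α v (x + n • torusPoint α)) currentOp ((ns k + 1 : ℕ) : ℝ) (delta 0)) atTop (𝓝 w)
    · have hsa : ∀ k : ℕ, IsSelfAdjoint
          (timeAverage (schrodinger α v x) currentOp ((ns k + 1 : ℕ) : ℝ)) := fun k =>
        isSelfAdjoint_timeAverage (schrodinger_isSelfAdjoint α v x) currentOp_isSelfAdjoint _
      obtain ⟨Q, hQ1, hQ2⟩ := exists_strong_limit (l := atTop)
        (fun k => timeAverage (schrodinger α v x) currentOp ((ns k + 1 : ℕ) : ℝ)) zero_le_two
        (Eventually.of_forall fun k => (norm_timeAverage_le (schrodinger_isSelfAdjoint α v x)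
          currentOp (hT k).le).trans norm_currentOp_le) span_delta (by
          rintro _ ⟨n, rfl⟩
          obtain ⟨w, hw⟩ := hx n
          refine ⟨shift (-n) w, (((shift (-n)).continuous.tendsto _).comp hw).congr fun k => ?_⟩
          have h1 := timeAverage_shift α v x n (hT k) (delta n)
          rw [shift_delta, sub_self] at h1
          rw [Function.comp, h1, shift_shift, neg_add_cancel, shift_zero])
      exact ⟨Q, ⟨hQ1, isSelfAdjoint_of_tendsto hsa hQ2⟩, fun _ => hQ2⟩
    · exact ⟨0, ⟨by simp, IsSelfAdjoint.zero _⟩, fun h => absurd h hx⟩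
  choose Q hQ1 hQ2 using hQ
  refine ⟨_, Q, hTlim, hT, hQ1, ?_⟩
  filter_upwards [ae_all_iff.2 fun n : ℤ => ae_translate (n • torusPoint α) hlim] with x hx
  exact hQ2 x hx

/-- The field of limits of the averages of the dual current, extended by `0` to the exceptional
phases. -/
theorem exists_dual_limit_field (hα : RationallyIndependent α)
    (hred : IsL2DegreeZeroReducible α v) :
    ∃ Q : UnitAddCircle → TorusL2 d →L[ℂ] TorusL2 d,
      (∀ θ, ‖Q θ‖ ≤ 2 ∧ IsSelfAdjoint (Q θ)) ∧
      ∀ᵐ θ ∂(AddCircle.haarAddCircle : Measure UnitAddCircle),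
        (∀ u, Tendsto (fun T => timeAverage (dualOperator α v θ) (dualCurrent α θ) T u) atTop
          (𝓝 (Q θ u))) ∧ ∀ u, Q θ u = 0 → u = 0 := by
  have hQ : ∀ θ, ∃ Q : TorusL2 d →L[ℂ] TorusL2 d, (‖Q‖ ≤ 2 ∧ IsSelfAdjoint Q) ∧
      ((∃ Q : TorusL2 d →L[ℂ] TorusL2 d, ‖Q‖ ≤ ‖dualCurrent α θ‖ ∧
        (∀ u, Tendsto (fun T => timeAverage (dualOperator α v θ) (dualCurrent α θ) T u) atTop
          (𝓝 (Q u))) ∧ ∀ u, Q u = 0 → u = 0) →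
        (∀ u, Tendsto (fun T => timeAverage (dualOperator α v θ) (dualCurrent α θ) T u) atTop
          (𝓝 (Q u))) ∧ ∀ u, Q u = 0 → u = 0) := by
    intro θ
    by_cases hθ : ∃ Q : TorusL2 d →L[ℂ] TorusL2 d, ‖Q‖ ≤ ‖dualCurrent α θ‖ ∧
        (∀ u, Tendsto (fun T => timeAverage (dualOperator α v θ) (dualCurrent α θ) T u) atTop
          (𝓝 (Q u))) ∧ ∀ u, Q u = 0 → u = 0
    · obtain ⟨Q, h1, h2, h3⟩ := hθ
      exact ⟨Q, ⟨h1.trans (norm_dualCurrent_le α θ), isSelfAdjoint_of_tendsto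
        (fun T => isSelfAdjoint_timeAverage (dualOperator_isSelfAdjoint α v θ)
          (dualCurrent_isSelfAdjoint α θ) T) h2⟩, fun _ => ⟨h2, h3⟩⟩
    · exact ⟨0, ⟨by simp, IsSelfAdjoint.zero _⟩, fun h => absurd h hθ⟩
  choose Q hQ1 hQ2 using hQ
  refine ⟨Q, hQ1, ?_⟩
  filter_upwards [ae_exists_injective_limit_dual v hα hred] with θ h
  exact hQ2 θ h

/-- The kernel projections of intertwined self-adjoint fields are intertwined. -/
theorem IsIntertwined.starProjection_ker {X : QPTorus d → EllTwo →L[ℂ] EllTwo}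
    {Y : UnitAddCircle → TorusL2 d →L[ℂ] TorusL2 d} (h : IsIntertwined α X Y) {R : ℝ} (hR : 0 < R)
    (hX : ∀ x, ‖X x‖ ≤ R ∧ IsSelfAdjoint (X x)) (hY : ∀ θ, ‖Y θ‖ ≤ R ∧ IsSelfAdjoint (Y θ)) :
    IsIntertwined α (fun x => (X x).ker.starProjection) (fun θ => (Y θ).ker.starProjection) :=
  IsIntertwined.of_tendsto (fun n => h.kernelMean R n)
    (fun n x => norm_kernelMean_le (hX x).2 hR (hX x).1 n)
    (fun n θ => norm_kernelMean_le (hY θ).2 hR (hY θ).1 n)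
    (Eventually.of_forall fun x => tendsto_kernelMean (hX x).2 hR (hX x).1)
    (Eventually.of_forall fun θ => tendsto_kernelMean (hY θ).2 hR (hY θ).1)

/-- If a field of operators on `L²(𝕋^d)` is injective at almost every phase, then `δ₀` is orthogonal
to the kernels of the intertwined field on `ℓ²(ℤ)`. -/
theorem ae_starProjection_ker_delta_zero {X : QPTorus d → EllTwo →L[ℂ] EllTwo}
    {Y : UnitAddCircle → TorusL2 d →L[ℂ] TorusL2 d} (h : IsIntertwined α X Y) {R : ℝ} (hR : 0 < R)
    (hX : ∀ x, ‖X x‖ ≤ R ∧ IsSelfAdjoint (X x)) (hY : ∀ θ, ‖Y θ‖ ≤ R ∧ IsSelfAdjoint (Y θ))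
    (hinj : ∀ᵐ θ ∂(AddCircle.haarAddCircle : Measure UnitAddCircle), ∀ u, Y θ u = 0 → u = 0) :
    ∀ᵐ x ∂(torusMeasure d), (X x).ker.starProjection (delta 0) = 0 := by
  have hp := h.starProjection_ker hR hX hY _ _ (isDualPair_delta_zero α)
  have h0 : (fun θ => (Y θ).ker.starProjection (torusBasis d 0)) =ᵐ[AddCircle.haarAddCircle]
      (0 : UnitAddCircle → TorusL2 d) := by
    filter_upwards [hinj] with θ hθ
    exact hθ _ (Submodule.starProjection_apply_mem (Y θ).ker _)
  have h1 := hp.eLpNorm_eq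
  rw [eLpNorm_congr_ae h0, eLpNorm_zero, eLpNorm_eq_zero_iff hp.memLp_left.1 two_ne_zero] at h1
  exact h1

/-- Fields on `ℓ²(ℤ)` that are intertwined with some field are strongly measurable: they are
measurable on each `δ_n`, because the constant field `δ_n` is part of a dual pair. -/
theorem IsIntertwined.aestronglyMeasurable_apply {X : QPTorus d → EllTwo →L[ℂ] EllTwo}
    {Y : UnitAddCircle → TorusL2 d →L[ℂ] TorusL2 d} (h : IsIntertwined α X Y) (u : EllTwo) :
    AEStronglyMeasurable (fun x => X x u) (torusMeasure d) := by
  have hdelta : ∀ n : ℤ, AEStronglyMeasurable (fun x => X x (delta n)) (torusMeasure d) := by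
    intro n
    have hp := (h _ _ (isIntertwined_shift α (-n) _ _ (isDualPair_delta_zero α))).memLp_left.1
    simpa only [shift_delta, zero_sub, neg_neg] using hp
  have hsum : HasSum (fun n : ℤ => (u : ℤ → ℂ) n • delta n) u := by
    have h1 := deltaBasis.hasSum_repr u
    simpa only [HilbertBasis.repr_apply_apply, deltaBasis_apply, inner_delta_left] using h1
  refine aestronglyMeasurable_of_tendsto_ae (atTop : Filter (Finset ℤ))
    (f := fun s x => ∑ n ∈ s, (u : ℤ → ℂ) n • X x (delta n)) (fun s => ?_)
    (Eventually.of_forall fun x => ?_)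
  · exact Finset.aestronglyMeasurable_fun_sum s fun n _ => (hdelta n).const_smul ((u : ℤ → ℂ) n)
  · have h2 := ((X x).continuous.tendsto u).comp hsum
    refine h2.congr fun s => ?_
    simp only [Function.comp, map_sum, map_smul]

end LimitField

theorem theorem3p1 {d : ℕ} (α : Fin d → ℝ) (hα : RationallyIndependent α)
    (v : C(QPTorus d, ℝ)) (hred : IsL2DegreeZeroReducible α v) :
    ∃ (T₀ : Set (QPTorus d)) (T : ℕ → ℝ) (Q : QPTorus d → EllTwo →L[ℂ] EllTwo),
      MeasurableSet T₀ ∧ torusMeasure d T₀ᶜ = 0 ∧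
      Tendsto T atTop atTop ∧
      (∀ x ∈ T₀, ∀ ψ : EllTwo,
        Tendsto (fun k => cesaroAverage (schrodinger α v x) currentOp (T k) ψ) atTop
          (𝓝 (Q x ψ))) ∧
      (∀ x ∈ T₀, ∀ ψ : EllTwo, Q x ψ = 0 → ψ = 0) ∧
      (∀ x ∈ T₀, ∀ y ∈ T₀, ‖Q x‖ = ‖Q y‖) := by
  obtain ⟨T, Q, hTlim, hT, hQ, hlim⟩ := exists_limit_field hα hred
  obtain ⟨Q', hQ', hlim'⟩ := exists_dual_limit_field hα hred
  have hint : IsIntertwined α Q Q' := IsIntertwined.of_tendsto (C := 2)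
    (fun k => isIntertwined_timeAverage α v (hT k))
    (fun k x => (norm_timeAverage_le (schrodinger_isSelfAdjoint α v x) _ (hT k).le).trans
      norm_currentOp_le)
    (fun k θ => (norm_timeAverage_le (dualOperator_isSelfAdjoint α v θ) _ (hT k).le).trans
      (norm_dualCurrent_le α θ)) hlim
    (hlim'.mono fun θ h u => (h.1 u).comp hTlim)
  -- The projection of `δ₀` onto the kernel of `Q(x)` vanishes almost everywhere.
  have hker := ae_starProjection_ker_delta_zero hint two_pos hQ hQ' (hlim'.mono fun θ h => h.2)
  have hlim_orbit := ae_all_iff.2 fun n : ℤ => ae_translate (n • torusPoint α) hlim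
  have hker_orbit := ae_all_iff.2 fun n : ℤ => ae_translate (n • torusPoint α) hker
  have hcov : ∀ᵐ x ∂(torusMeasure d), ∀ (n : ℤ) (u : EllTwo),
      Q (x + n • torusPoint α) (shift n u) = shift n (Q x u) := by
    filter_upwards [hlim, hlim_orbit] with x h1 h2 n u
    refine tendsto_nhds_unique (h2 n (shift n u))
      ((((shift n).continuous.tendsto _).comp (h1 u)).congr fun k => ?_)
    exact (timeAverage_shift α v x n (hT k) u).symm
  have hinj : ∀ᵐ x ∂(torusMeasure d), ∀ ψ : EllTwo, Q x ψ = 0 → ψ = 0 := by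
    filter_upwards [hcov, hker_orbit] with x h1 h2 ψ hψ
    ext n
    -- By covariance `shift n ψ` lies in the kernel at `x + nα`, and `ψ_n` is its inner product with `δ₀`.
    have h3 : shift n ψ ∈ (Q (x + n • torusPoint α)).ker := by
      rw [LinearMap.mem_ker]
      change Q (x + n • torusPoint α) (shift n ψ) = 0
      rw [h1, hψ, map_zero]
    have h4 := Submodule.inner_starProjection_left_eq_right
      (Q (x + n • torusPoint α)).ker (delta 0) (shift n ψ)
    rw [h2, Submodule.starProjection_eq_self_iff.2 h3, inner_zero_left, inner_delta_left,
      shift_apply, zero_add] at h4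
    exact h4.symm
  have hnorm : ∃ c : ℝ, ∀ᵐ x ∂(torusMeasure d), ‖Q x‖ = c := by
    have hsep := separableSpace_ellTwo
    have hm := (aemeasurable_opNorm hint.aestronglyMeasurable_apply).aestronglyMeasurable
    refine (ergodic_add_torusPoint hα).ae_eq_const_of_ae_eq_comp_ae hm ?_
    filter_upwards [hcov] with x h
    have h1 := h 1
    simp only [one_smul] at h1
    change ‖Q (x + torusPoint α)‖ = ‖Q x‖
    refine le_antisymm ?_ ?_
    · refine ContinuousLinearMap.opNorm_le_bound _ (norm_nonneg _) fun u => ?_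
      have h2 : shift 1 (shift (-1) u) = u := by rw [shift_shift, add_neg_cancel, shift_zero]
      rw [← h2, h1, norm_shift_apply 1 (shift (-1) u), norm_shift_apply 1 (Q x _)]
      exact (Q x).le_opNorm _
    · refine ContinuousLinearMap.opNorm_le_bound _ (norm_nonneg _) fun u => ?_
      rw [← norm_shift_apply 1 (Q x u), ← h1, ← norm_shift_apply 1 u]
      exact (Q (x + torusPoint α)).le_opNorm _
  obtain ⟨c, hc⟩ := hnorm
  have hgood : ∀ᵐ x ∂(torusMeasure d), (∀ u, Tendsto
      (fun k => timeAverage (schrodinger α v x) currentOp (T k) u) atTop (𝓝 (Q x u))) ∧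
      (∀ ψ : EllTwo, Q x ψ = 0 → ψ = 0) ∧ ‖Q x‖ = c := by
    filter_upwards [hlim, hinj, hc] with x h1 h2 h3
    exact ⟨h1, h2, h3⟩
  -- The good set need not be measurable; it contains a measurable set of full measure.
  obtain ⟨N, hN1, hN2, hN3⟩ := exists_measurable_superset_of_null (ae_iff.1 hgood)
  have hmem : ∀ x ∈ Nᶜ, (∀ u, Tendsto
      (fun k => timeAverage (schrodinger α v x) currentOp (T k) u) atTop (𝓝 (Q x u))) ∧
      (∀ ψ : EllTwo, Q x ψ = 0 → ψ = 0) ∧ ‖Q x‖ = c := fun x hx => by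
    by_contra h
    exact hx (hN1 h)
  refine ⟨Nᶜ, T, Q, hN2.compl, by rwa [compl_compl], hTlim, fun x hx => (hmem x hx).1,
    fun x hx => (hmem x hx).2.1, fun x hx y hy => ?_⟩
  rw [(hmem x hx).2.2, (hmem y hy).2.2]
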